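/- Write $\mathbb T=\mathbb R/\mathbb Z$ with Lebesgue measure $\lambda$. Let $\alpha$ be an irrational real number, with continued fraction $\alpha=[a_0;a_1,a_2,\dots]$ and convergents $(p_n/q_n)_{n\ge0}$ (so $q_0=1$, $q_1=a_1$ and $q_{n+2}=a_{n+2}q_{n+1}+q_n$), and let $Tx=x+\alpha$ on $\mathbb T$. For $x\in\mathbb R$ let $[x]$ be the nearest integer to $x$ and $\|x\|=|x-[x]|$. For $\beta\in\mathbb T$, identified with its representative in $[0,1)$, let $\phi_\beta=\mathbf 1_{[0,\beta)}-\beta:\mathbb T\to\mathbb R$. Let $s$ be a non-integer real number and let $\beta,t\in\mathbb T$. There exists a measurable function $f$ of modulus $1$ on $\mathbb T$ such that, $\lambda$-almost everywhere, $$\exp(2i\pi s\,\phi_\beta)=e^{2i\pi t}\,\frac{f}{f\circ T},$$ if and only if there exist a sequence of integers $(b_n)_{n\ge 0}$ and an integer $k'$ such that $$\beta=\sum_{n\ge0}b_nq_n\alpha \mod 1\quad\text{and}\quad t=k'\alpha-\sum_{n\ge0}[b_ns]\,q_n\alpha \mod 1,$$ with $$\sum_{n\ge0}\frac{|b_n|}{a_{n+1}}<\infty\quad\text{and}\quad\sum_{n\ge0}\|b_ns\|^2<\infty,$$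 where both series of multiples of $\alpha$ converge in $\mathbb T$. -/

import Mathlib

open MeasureTheory

noncomputable section

namespace IrrationalRotation

/-- The partial quotients `a 0 = ⌊α⌋, a 1, a 2, …` of the (regular) continued fraction
`α = a 0 + 1 / (a 1 + 1 / (a 2 + ⋯))`, as real numbers. The sequence of partial denominators
`GenContFract.partDens` starts with `a 1`; for irrational `α` it never terminates, so the
default value `0` is never used. -/
def partialQuotient (α : ℝ) : ℕ → ℝ
  | 0 => (GenContFract.of α).h
  | n + 1 => ((GenContFract.of α).partDens.get? n).getD 0

/-- The denominator `q n` of the `n`-th convergent `p n / q n` of the continued fraction of `α`,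
as a real number (`q 0 = 1`, `q 1 = a 1`, `q (n + 2) = a (n + 2) * q (n + 1) + q n`). -/
def convergentDen (α : ℝ) (n : ℕ) : ℝ :=
  (GenContFract.of α).dens n

/-- The representative in `[0, 1)` of a point of the circle `ℝ / ℤ`. -/
def frac (x : UnitAddCircle) : ℝ :=
  (AddCircle.equivIco 1 0 x : ℝ)

/-- The distance of a real number to the nearest integer. -/
def distNearestInt (x : ℝ) : ℝ :=
  |x - round x|

/-- The function `φ_β = 1_{[0, β)} - β` on the circle, where `β` is identified with its
representative in `[0, 1)`. -/
def phi (β x : UnitAddCircle) : ℝ :=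
  (if frac x < frac β then 1 else 0) - frac β

end IrrationalRotation

end

/-! Write `A` for the class of `α`. Since `phi β x = frac (x - β) - frac x`, the cocycle telescopes
when `β = m • A`: it is the coboundary of a sum `Psi A m` of `m` translates of `frac`. Both
directions compare a general `β` with multiples of `A`, at the scales `1 / q n`.

Sufficiency (`exists_isTransfer`). Put `k N = ∑ b n * q n` and `m N = ∑ l n * q n`, where `l n` is
the integer nearest to `b n * s`. The functions `e (s * Psi A (k N) x - m N • x)` solve the equation
for `k N • A` and `-(m N • A)`. Off a set of measure `O(|b n| / a n)`, passing from `N = n` to `n +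
1` changes the exponent by a constant plus `(b n * s - l n)` times a translate of `sawSum (q n) (p
n)` (`phase_step`). These sawtooth sums are almost orthogonal (`integral_sum_sawSum_le`), so square
summability of `b n * s - l n`, with Borel-Cantelli for the exceptional sets, yields convergence
almost everywhere along a subsequence, after normalising constants.

Necessity (`exists_digits`). Let `f` be a solution. As the `q n` are lacunary, the energies of `f`
at the scales `ρ / q n` are summable (`summable_integral_dif`). The cocycle jumps by the factor `e s
≠ 1` at `0`, so `f` cannot look constant both before and after an orbit passes `0`, unless the orbit
also meets the compensating jump at `β` (`le_norm_dif_add_norm_dif`, `window_le`). Hence `β` is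
close to some `k n • A` with `k n = o(q n)` (`exists_approx`), and a lopsided window bounds `|k n| /
q n` by the energy (`summable_approx`). Successive `k n` differ by a multiple `b n * q n`, which
gives the digits and the first series.

Next, translation by `q n • A`, which is tiny, multiplies `f` by a phase `θ n` outside a small set.
Comparison with the energy shows that `a n * ‖θ n‖` is square summable (`summable_phase`), and a
determinant identity expresses `b (n + 1) * s` modulo `1`, up to sign, by three consecutive phases
(`phase_sub`).

With these digits the sufficiency part produces a solution for `-τ`. The quotient of two solutions
is an eigenfunction of the rotation, so `t + τ` is a multiple of `A` (`exists_sub_eq_zsmul`). -/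

namespace IrrationalRotation

/-! ### Convergents and Diophantine approximation. -/

/-- `a n` is the partial quotient of index `n + 1` and `p n / q n` the `n`-th convergent of `α`,
all as integers. -/
structure ConvergentData (α : ℝ) (a q : ℕ → ℕ) (p : ℕ → ℤ) : Prop where
  a_pos : ∀ n, 1 ≤ a n
  q_zero : q 0 = 1
  q_one : q 1 = a 0
  q_succ : ∀ n, q (n + 2) = a (n + 1) * q (n + 1) + q n
  p_succ : ∀ n, p (n + 2) = a (n + 1) * p (n + 1) + p n
  det : ∀ n, p (n + 1) * q n - p n * q (n + 1) = (-1) ^ n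
  abs_sub_le : ∀ n, |q n * α - p n| ≤ 1 / q (n + 1)

theorem of_not_terminatedAt {α : ℝ} (hα : Irrational α) (n : ℕ) :
    ¬ (GenContFract.of α).TerminatedAt n := by
  intro h
  obtain ⟨x, hx⟩ := (GenContFract.terminates_iff_rat α).1 ⟨n, h⟩
  exact hα ⟨x, hx.symm⟩

theorem exists_convergentData {α : ℝ} (hα : Irrational α) :
    ∃ (a q : ℕ → ℕ) (p : ℕ → ℤ), ConvergentData α a q p ∧
      (∀ n, convergentDen α n = q n) ∧ ∀ n, partialQuotient α (n + 1) = a n := by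
  set g := GenContFract.of α with hg
  have hs : ∀ n, ∃ m : ℕ, 1 ≤ m ∧ g.s.get? n = some ⟨1, (m : ℝ)⟩ := by
    intro n
    have h1 : ¬ g.s.get? n = none := of_not_terminatedAt hα n
    obtain ⟨gp, hgp⟩ := Option.ne_none_iff_exists'.1 h1
    obtain ⟨ha, z, hz⟩ := GenContFract.of_partNum_eq_one_and_exists_int_partDen_eq hgp
    have h2 : 1 ≤ gp.b :=
      GenContFract.of_one_le_get?_partDen (GenContFract.partDen_eq_s_b hgp)
    rw [hz] at h2
    have h3 : 1 ≤ z := by exact_mod_cast h2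
    lift z to ℕ using by omega
    refine ⟨z, by omega, ?_⟩
    rw [hgp]
    rcases gp with ⟨x, y⟩
    simp at ha hz
    simp [ha, hz]
  choose a ha1 ha using hs
  -- Recursion on pairs of consecutive terms makes the two-step recurrences hold by `rfl`.
  let q : ℕ → ℕ := fun n => (Nat.rec (1, a 0) (fun n x => (x.2, a (n + 1) * x.2 + x.1)) n : ℕ × ℕ).1
  let p : ℕ → ℤ := fun n =>
    (Nat.rec (⌊α⌋, a 0 * ⌊α⌋ + 1) (fun n x => (x.2, a (n + 1) * x.2 + x.1)) n : ℤ × ℤ).1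
  have q0 : q 0 = 1 := rfl
  have q1 : q 1 = a 0 := rfl
  have q2 : ∀ n, q (n + 2) = a (n + 1) * q (n + 1) + q n := fun n => rfl
  have p0 : p 0 = ⌊α⌋ := rfl
  have p1 : p 1 = a 0 * ⌊α⌋ + 1 := rfl
  have p2 : ∀ n, p (n + 2) = a (n + 1) * p (n + 1) + p n := fun n => rfl
  have hc0 : g.conts 0 = ⟨(p 0 : ℝ), (q 0 : ℝ)⟩ := by
    rw [GenContFract.zeroth_cont_eq_h_one]; simp [p0, q0, hg, GenContFract.of_h_eq_floor]
  have hc1 : g.conts 1 = ⟨(p 1 : ℝ), (q 1 : ℝ)⟩ := by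
    rw [GenContFract.first_cont_eq (ha 0)]
    simp [p1, q1, hg, GenContFract.of_h_eq_floor]
  have hc : ∀ n, g.conts n = ⟨(p n : ℝ), (q n : ℝ)⟩ ∧
      g.conts (n + 1) = ⟨(p (n + 1) : ℝ), (q (n + 1) : ℝ)⟩ := by
    intro n
    induction n with
    | zero => exact ⟨hc0, hc1⟩
    | succ n ih =>
      refine ⟨ih.2, ?_⟩
      rw [GenContFract.conts_recurrence (ha (n + 1)) ih.1 ih.2]
      simp [p2, q2]
  have hnum : ∀ n, g.nums n = p n := fun n => by
    rw [GenContFract.num_eq_conts_a, (hc n).1]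
  have hden : ∀ n, g.dens n = q n := fun n => by
    rw [GenContFract.den_eq_conts_b, (hc n).1]
  have hqpos : ∀ n, 0 < q n ∧ 0 < q (n + 1) := by
    intro n
    induction n with
    | zero => exact ⟨by simp [q0], by have := ha1 0; simp [q1]; omega⟩
    | succ n ih => exact ⟨ih.2, by rw [q2]; omega⟩
  refine ⟨a, q, p, ⟨ha1, q0, q1, q2, p2, ?_, ?_⟩, hden, ?_⟩
  · intro n
    induction n with
    | zero => rw [zero_add, p0, p1, q0, q1]; push_cast; ring
    | succ n ih =>
      rw [p2, q2, pow_succ, ← ih]; push_cast; ring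
  · intro n
    have h := GenContFract.abs_sub_convs_le (of_not_terminatedAt hα n)
    rw [GenContFract.conv_eq_num_div_den, ← hg, hnum, hden, hden] at h
    have h1 : (0 : ℝ) < q n := by exact_mod_cast (hqpos n).1
    have h2 : (0 : ℝ) < q (n + 1) := by exact_mod_cast (hqpos n).2
    have h3 : (q n : ℝ) * α - p n = q n * (α - p n / q n) := by field_simp
    rw [h3, abs_mul, abs_of_pos h1]
    calc _ ≤ (q n : ℝ) * (1 / (q n * q (n + 1))) := by gcongr
      _ = _ := by field_simp
  · intro n
    show ((GenContFract.of α).partDens.get? n).getD 0 = _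
    rw [GenContFract.partDen_eq_s_b (ha n)]; rfl

namespace ConvergentData

variable {α : ℝ} {a q : ℕ → ℕ} {p : ℕ → ℤ}

theorem q_pos (h : ConvergentData α a q p) (n : ℕ) : 0 < q n := by
  have : 0 < q n ∧ 0 < q (n + 1) := by
    induction n with
    | zero => exact ⟨by simp [h.q_zero], by rw [h.q_one]; exact h.a_pos 0⟩
    | succ n ih => exact ⟨ih.2, by rw [h.q_succ]; omega⟩
  exact this.1

theorem q_le_succ (h : ConvergentData α a q p) (n : ℕ) : q n ≤ q (n + 1) := by
  cases n with
  | zero => rw [h.q_zero]; exact h.q_pos 1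
  | succ n =>
    rw [h.q_succ]
    nlinarith [h.a_pos (n + 1), h.q_pos (n + 1)]

/-- Lacunarity of the scales `1 / q n`. Two steps are needed, since a partial quotient equal to `1`
need not double the denominator. -/
theorem two_mul_q_le (h : ConvergentData α a q p) (n : ℕ) : 2 * q n ≤ q (n + 2) := by
  rw [h.q_succ]
  nlinarith [h.a_pos (n + 1), h.q_pos (n + 1), h.q_le_succ n]

theorem a_mul_q_le (h : ConvergentData α a q p) (n : ℕ) : a n * q n ≤ q (n + 1) := by
  cases n with
  | zero => rw [h.q_zero, h.q_one]; omega
  | succ n => rw [h.q_succ]; omega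

theorem q_succ_le (h : ConvergentData α a q p) (n : ℕ) : q (n + 1) ≤ 2 * a n * q n := by
  cases n with
  | zero => rw [h.q_zero, h.q_one]; omega
  | succ n =>
    rw [h.q_succ]
    nlinarith [h.a_pos (n + 1), h.q_pos (n + 1), h.q_le_succ n]

theorem isCoprime (h : ConvergentData α a q p) (n : ℕ) : IsCoprime (q n : ℤ) (p n) := by
  have h1 := h.det n
  have h2 : ((-1 : ℤ) ^ n) * (-1) ^ n = 1 := by rw [← mul_pow]; simp
  refine ⟨(-1) ^ n * p (n + 1), -((-1) ^ n * q (n + 1)), ?_⟩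
  linear_combination (-1) ^ n * h1 + h2

theorem q_pos' (h : ConvergentData α a q p) (n : ℕ) : (0 : ℝ) < q n := by
  exact_mod_cast h.q_pos n

theorem tendsto_q (h : ConvergentData α a q p) :
    Filter.Tendsto (fun n => (q n : ℝ)) Filter.atTop Filter.atTop := by
  have h1 : ∀ n, n ≤ 2 * q n := by
    intro n
    induction n using Nat.strong_induction_on with
    | _ n ih =>
      rcases n with _ | _ | n
      · omega
      · have := h.q_pos 1
        simp; omega
      · have h2 := ih n (by omega)
        have h3 := h.two_mul_q_le n
        have h4 := h.q_pos n
        show n + 2 ≤ 2 * q (n + 2)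
        omega
  refine Filter.tendsto_atTop_mono (f := fun n : ℕ => (n : ℝ) / 2) (fun n => ?_) ?_
  · have : (n : ℝ) ≤ 2 * q n := by exact_mod_cast h1 n
    linarith
  · exact tendsto_natCast_atTop_atTop.atTop_div_const (by norm_num)

/-- The determinant form `j p n - m q n` is controlled by the two approximation errors. -/
theorem abs_det_le (h : ConvergentData α a q p) (n : ℕ) (j m : ℤ) :
    |(j * p n - m * q n : ℝ)| ≤ |(j : ℝ)| / q (n + 1) + q n * |j * α - m| := by
  have h0 := h.q_pos' n
  have : (j * p n - m * q n : ℝ) = -(j * (q n * α - p n)) + q n * (j * α - m) := by ring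
  rw [this]
  refine (abs_add_le _ _).trans ?_
  rw [abs_neg, abs_mul, abs_mul, abs_of_pos h0, div_eq_mul_one_div]
  gcongr
  exact h.abs_sub_le n

/-- Multiples of `α` of order at most `q n / 2` are at distance at least `1 / (2 q n)` from the
integers. -/
theorem one_div_le_abs (h : ConvergentData α a q p) (n : ℕ) (j m : ℤ) (hj : j ≠ 0)
    (hjq : 2 * |j| ≤ q n) : 1 / (2 * q n : ℝ) ≤ |j * α - m| := by
  have h0 := h.q_pos' n
  have h1 := h.q_pos' (n + 1)
  have hne : j * p n - m * q n ≠ 0 := by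
    intro h2
    have h3 : (q n : ℤ) ∣ j * p n := ⟨m, by linarith⟩
    have h4 := (h.isCoprime n).dvd_of_dvd_mul_right h3
    have h5 := Int.le_of_dvd (abs_pos.2 hj) ((dvd_abs _ _).2 h4)
    have := h.q_pos n
    omega
  have h2 : (1 : ℝ) ≤ |(j * p n - m * q n : ℝ)| := by
    have := Int.one_le_abs hne
    exact_mod_cast this
  have h3 := h.abs_det_le n j m
  have h4 : |(j : ℝ)| / q (n + 1) ≤ 1 / 2 := by
    rw [div_le_iff₀ h1]
    have h5 : (2 * |(j : ℝ)|) ≤ q n := by exact_mod_cast hjq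
    have h6 : (q n : ℝ) ≤ q (n + 1) := by exact_mod_cast h.q_le_succ n
    linarith
  have h7 : 1 / 2 ≤ q n * |j * α - m| := by linarith
  rw [div_le_iff₀ (by positivity)]
  nlinarith

/-- If `d` is small compared with `q (n + 1)` and `d α` is very close to an integer, then `d` is a
multiple of `q n`. -/
theorem dvd_of_small (h : ConvergentData α a q p) (n : ℕ) (d m : ℤ)
    (hd : |(d : ℝ)| / q (n + 1) + q n * |d * α - m| < 1) : (q n : ℤ) ∣ d := by
  have h3 := (h.abs_det_le n d m).trans_lt hd
  have h4 : |d * p n - m * q n| < 1 := by exact_mod_cast h3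
  have h5 := Int.abs_lt_one_iff.1 h4
  exact (h.isCoprime n).dvd_of_dvd_mul_right ⟨m, by linarith⟩

theorem one_div_le_norm_zsmul (h : ConvergentData α a q p) (n : ℕ) (j : ℤ) (hj : j ≠ 0)
    (hjq : 2 * |j| ≤ q n) : 1 / (2 * q n : ℝ) ≤ ‖j • (α : UnitAddCircle)‖ := by
  have := h.one_div_le_abs n j (round (j * α)) hj hjq
  rwa [← AddCircle.coe_zsmul, UnitAddCircle.norm_eq, zsmul_eq_mul]

theorem dvd_of_small_norm (h : ConvergentData α a q p) (n : ℕ) (d : ℤ)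
    (hd : |(d : ℝ)| / q (n + 1) + q n * ‖d • (α : UnitAddCircle)‖ < 1) : (q n : ℤ) ∣ d := by
  refine h.dvd_of_small n d (round (d * α)) ?_
  rwa [← AddCircle.coe_zsmul, UnitAddCircle.norm_eq, zsmul_eq_mul] at hd

theorem coe_q_zsmul (_h : ConvergentData α a q p) (n : ℕ) :
    (q n : ℤ) • (α : UnitAddCircle) = ((q n * α - p n : ℝ) : UnitAddCircle) := by
  rw [← AddCircle.coe_zsmul, ← sub_eq_zero, ← AddCircle.coe_sub, AddCircle.coe_eq_zero_iff]
  exact ⟨p n, by simp⟩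

end ConvergentData
end IrrationalRotation

/-! ### Characters, fractional parts and sums of their translates. -/

namespace IrrationalRotation

/-- The standard character `x ↦ exp (2 π i x)` of the circle. -/
noncomputable def e (x : UnitAddCircle) : ℂ := AddCircle.toCircle x

theorem e_zero : e 0 = 1 := by simp [e]

theorem e_add (x y : UnitAddCircle) : e (x + y) = e x * e y := by
  simp [e, AddCircle.toCircle_add]

theorem norm_e (x : UnitAddCircle) : ‖e x‖ = 1 := Circle.norm_coe _

theorem e_ne_zero (x : UnitAddCircle) : e x ≠ 0 := by simp [e]

theorem e_neg (x : UnitAddCircle) : e (-x) = (e x)⁻¹ :=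
  eq_inv_of_mul_eq_one_left (by rw [← e_add, neg_add_cancel, e_zero])

theorem e_sub (x y : UnitAddCircle) : e (x - y) = e x / e y := by
  rw [sub_eq_add_neg, e_add, e_neg, div_eq_mul_inv]

theorem continuous_e : Continuous e :=
  continuous_subtype_val.comp AddCircle.continuous_toCircle

theorem e_coe (x : ℝ) : e (x : UnitAddCircle) = Complex.exp (2 * Real.pi * Complex.I * x) := by
  rw [e, AddCircle.toCircle_apply_mk, Circle.coe_exp]
  push_cast; congr 1; ring

theorem fourier_eq_e (k : ℤ) (x : UnitAddCircle) : fourier k x = e (k • x) := rfl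

theorem norm_e_coe_sub_one (x : ℝ) :
    ‖e (x : UnitAddCircle) - 1‖ = 2 * |Real.sin (Real.pi * x)| := by
  rw [e_coe, show (2 * Real.pi * Complex.I * x : ℂ) = Complex.I * ((2 * Real.pi * x : ℝ) : ℂ) by
    push_cast; ring, Complex.norm_exp_I_mul_ofReal_sub_one]
  rw [norm_mul, Real.norm_eq_abs, Real.norm_eq_abs, abs_two]
  congr 3; ring

theorem norm_e_sub_one_le (x : ℝ) : ‖e (x : UnitAddCircle) - 1‖ ≤ 2 * Real.pi * |x| := by
  rw [norm_e_coe_sub_one]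
  have := Real.abs_sin_le_abs (x := Real.pi * x)
  rw [abs_mul, abs_of_pos Real.pi_pos] at this
  linarith

theorem norm_e_sub_one_le_two (x : UnitAddCircle) : ‖e x - 1‖ ≤ 2 :=
  (norm_sub_le _ _).trans (by simp [norm_e]; norm_num)

theorem exists_coe_eq_abs_eq_norm (x : UnitAddCircle) :
    ∃ y : ℝ, (y : UnitAddCircle) = x ∧ |y| = ‖x‖ := by
  induction x using QuotientAddGroup.induction_on with
  | H x =>
    refine ⟨x - round x, ?_, (UnitAddCircle.norm_eq).symm⟩
    have : ((round x : ℝ) : UnitAddCircle) = 0 := (AddCircle.coe_eq_zero_iff 1).2 ⟨round x, by simp⟩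
    rw [AddCircle.coe_sub, this, sub_zero]

theorem norm_coe_le (x : ℝ) : ‖(x : UnitAddCircle)‖ ≤ |x| := by
  rw [UnitAddCircle.norm_eq]
  simpa using round_le x 0

theorem norm_le_half (x : UnitAddCircle) : ‖x‖ ≤ 1 / 2 := by
  simpa using AddCircle.norm_le_half_period (p := (1 : ℝ)) (x := x) one_ne_zero

theorem four_mul_norm_le (x : UnitAddCircle) : 4 * ‖x‖ ≤ ‖e x - 1‖ := by
  obtain ⟨y, rfl, hy⟩ := exists_coe_eq_abs_eq_norm x
  have h2 : |y| ≤ 1 / 2 := hy ▸ norm_le_half _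
  rw [norm_e_coe_sub_one, ← hy]
  have h3 : |Real.sin (Real.pi * y)| = Real.sin (Real.pi * |y|) := by
    rcases abs_cases y with ⟨h, h'⟩ | ⟨h, h'⟩ <;> rw [h]
    · exact abs_of_nonneg (Real.sin_nonneg_of_nonneg_of_le_pi (by positivity)
        (by nlinarith [Real.pi_pos]))
    · rw [mul_neg, Real.sin_neg, abs_of_nonpos]
      have := Real.sin_nonneg_of_nonneg_of_le_pi (x := Real.pi * -y)
        (by nlinarith [Real.pi_pos]) (by nlinarith [Real.pi_pos])
      rw [mul_neg, Real.sin_neg] at this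
      linarith
  have h4 := Real.mul_le_sin (x := Real.pi * |y|) (by positivity) (by nlinarith [Real.pi_pos])
  rw [h3]
  have h5 : 2 / Real.pi * (Real.pi * |y|) = 2 * |y| := by field_simp
  linarith

theorem e_coe_ne_one {s : ℝ} (hs : ∀ m : ℤ, s ≠ m) : e (s : UnitAddCircle) ≠ 1 := by
  intro h
  have h1 := four_mul_norm_le (s : UnitAddCircle)
  rw [h, sub_self, norm_zero] at h1
  have h2 : ‖(s : UnitAddCircle)‖ = 0 := le_antisymm (by linarith) (norm_nonneg _)
  rw [UnitAddCircle.norm_eq, abs_eq_zero, sub_eq_zero] at h2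
  exact hs _ h2

/-! ### The representative in `[0, 1)` -/

theorem coe_frac (x : UnitAddCircle) : ((frac x : ℝ) : UnitAddCircle) = x :=
  (AddCircle.equivIco 1 0).symm_apply_apply x

theorem frac_mem (x : UnitAddCircle) : 0 ≤ frac x ∧ frac x < 1 := by
  have h : 0 ≤ frac x ∧ frac x < 0 + 1 := (AddCircle.equivIco 1 0 x).2
  rwa [zero_add] at h

theorem frac_coe (y : ℝ) : frac (y : UnitAddCircle) = Int.fract y := by
  rw [frac, AddCircle.coe_equivIco_mk_apply]; simp

theorem frac_coe_of_mem {y : ℝ} (h0 : 0 ≤ y) (h1 : y < 1) : frac (y : UnitAddCircle) = y := by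
  rw [frac_coe, Int.fract_eq_self.2 ⟨h0, h1⟩]

theorem measurable_frac : Measurable frac :=
  measurable_subtype_coe.comp (AddCircle.measurableEquivIco 1 0).measurable

theorem norm_le_frac (x : UnitAddCircle) : ‖x‖ ≤ frac x ∧ ‖x‖ ≤ 1 - frac x := by
  have h := frac_mem x
  have hx := coe_frac x
  constructor
  · conv_lhs => rw [← hx]
    exact (norm_coe_le _).trans (abs_of_nonneg h.1).le
  · conv_lhs => rw [← hx]
    rw [UnitAddCircle.norm_eq]
    refine (round_le _ 1).trans ?_
    rw [abs_sub_comm]; simp; rw [abs_of_nonneg (by linarith)]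

theorem frac_add {x : UnitAddCircle} {v : ℝ} (h : |v| < ‖x‖) :
    frac (x + v) = frac x + v := by
  have h1 := norm_le_frac x
  have h2 := abs_lt.1 h
  conv_lhs => rw [← coe_frac x, ← AddCircle.coe_add]
  exact frac_coe_of_mem (by linarith) (by linarith)

theorem continuousAt_frac {x : UnitAddCircle} (hx : x ≠ 0) : ContinuousAt frac x := by
  have := AddCircle.continuousAt_equivIco (p := (1 : ℝ)) 0 (x := x) (by simpa using hx)
  exact continuous_subtype_val.continuousAt.comp this

/-- In this form the cocycle is a difference of two translates of one function, hence telescopes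
when `β` lies on the orbit of `0`. -/
theorem phi_eq (β x : UnitAddCircle) : phi β x = frac (x - β) - frac x := by
  have hx := frac_mem x
  have hb := frac_mem β
  have h : frac (x - β) = Int.fract (frac x - frac β) := by
    rw [← frac_coe, AddCircle.coe_sub, coe_frac, coe_frac]
  rw [phi, h]
  split_ifs with hlt
  · rw [show Int.fract (frac x - frac β) = frac x - frac β + 1 from
      Int.fract_eq_iff.2 ⟨by linarith, by linarith, -1, by push_cast; ring⟩]
    ring
  · rw [Int.fract_eq_self.2 ⟨by linarith, by linarith⟩]
    ring

/-! ### Sums of translates of the fractional part -/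

/-- The transfer function `Ψ` with `Ψ m x - Ψ m (x + A) = frac (x - m A) - frac x`. -/
noncomputable def Psi (A : UnitAddCircle) (m : ℤ) (x : UnitAddCircle) : ℝ :=
  ∑ j ∈ Finset.Ioc 0 m, frac (x - j • A) - ∑ j ∈ Finset.Ioc m 0, frac (x - j • A)

theorem Psi_zero (A x : UnitAddCircle) : Psi A 0 x = 0 := by simp [Psi]

theorem Psi_succ (A : UnitAddCircle) (m : ℤ) (x : UnitAddCircle) :
    Psi A (m + 1) x = Psi A m x + frac (x - (m + 1) • A) := by
  rcases le_or_gt 0 m with hm | hm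
  · have h1 : Finset.Ioc 0 (m + 1) = insert (m + 1) (Finset.Ioc 0 m) := by
      ext j; simp only [Finset.mem_Ioc, Finset.mem_insert]; omega
    have h2 : Finset.Ioc m 0 = ∅ := Finset.Ioc_eq_empty_of_le hm
    have h3 : Finset.Ioc (m + 1) 0 = ∅ := Finset.Ioc_eq_empty_of_le (by omega)
    rw [Psi, Psi, h1, h2, h3, Finset.sum_insert (by simp)]
    ring
  · have h1 : Finset.Ioc m 0 = insert (m + 1) (Finset.Ioc (m + 1) 0) := by
      ext j; simp only [Finset.mem_Ioc, Finset.mem_insert]; omega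
    have h2 : Finset.Ioc 0 m = ∅ := Finset.Ioc_eq_empty_of_le hm.le
    have h3 : Finset.Ioc 0 (m + 1) = ∅ := Finset.Ioc_eq_empty_of_le (by omega)
    rw [Psi, Psi, h1, h2, h3, Finset.sum_insert (by simp)]
    ring

theorem Psi_sub_comp_add (A : UnitAddCircle) (m : ℤ) (x : UnitAddCircle) :
    Psi A m x - Psi A m (x + A) = frac (x - m • A) - frac x := by
  have key : ∀ m : ℤ, Psi A (m + 1) x - Psi A (m + 1) (x + A) =
      Psi A m x - Psi A m (x + A) + (frac (x - (m + 1) • A) - frac (x - m • A)) := by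
    intro m
    rw [Psi_succ, Psi_succ, show x + A - (m + 1) • A = x - m • A by rw [add_smul, one_smul]; abel]
    ring
  induction m using Int.induction_on with
  | zero => simp [Psi_zero]
  | succ m ih => rw [key, ih]; ring
  | pred m ih =>
    have := key (-m - 1)
    rw [sub_add_cancel, ih] at this
    linarith

theorem Psi_add (A : UnitAddCircle) (m l : ℤ) (x : UnitAddCircle) :
    Psi A (m + l) x = Psi A m x + Psi A l (x - m • A) := by
  have key : ∀ l : ℤ, Psi A (m + (l + 1)) x - Psi A (l + 1) (x - m • A) =
      Psi A (m + l) x - Psi A l (x - m • A) := by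
    intro l
    rw [← add_assoc, Psi_succ, Psi_succ,
      show x - m • A - (l + 1) • A = x - (m + l + 1) • A by simp only [add_smul, one_smul]; abel]
    ring
  suffices h : Psi A (m + l) x - Psi A l (x - m • A) = Psi A m x by linarith
  induction l using Int.induction_on with
  | zero => simp [Psi_zero]
  | succ l ih => rw [key, ih]
  | pred l ih => have := key (-l - 1); rw [sub_add_cancel, ih] at this; exact this.symm

/-- Each translate of `frac` has slope `1` away from its jump, and `Psi A m` is a signed sum of
`|m|` of them: no jump is crossed, so the slope is `m`. -/
theorem Psi_add_coe {A : UnitAddCircle} {m : ℤ} {x : UnitAddCircle} {v : ℝ}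
    (h : ∀ j ∈ Finset.Ioc (min 0 m) (max 0 m), |v| < ‖x - j • A‖) :
    Psi A m (x + v) = Psi A m x + m * v := by
  have h1 : ∀ j ∈ Finset.Ioc 0 m, frac (x + v - j • A) = frac (x - j • A) + v := by
    intro j hj
    rw [show x + v - j • A = x - j • A + v by abel]
    refine frac_add (h j ?_)
    simp only [Finset.mem_Ioc] at hj ⊢; omega
  have h2 : ∀ j ∈ Finset.Ioc m 0, frac (x + v - j • A) = frac (x - j • A) + v := by
    intro j hj
    rw [show x + v - j • A = x - j • A + v by abel]
    refine frac_add (h j ?_)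
    simp only [Finset.mem_Ioc] at hj ⊢; omega
  rw [Psi, Psi, Finset.sum_congr rfl h1, Finset.sum_congr rfl h2]
  simp only [Finset.sum_add_distrib, Finset.sum_const, Int.card_Ioc, nsmul_eq_mul]
  rcases le_or_gt 0 m with hm | hm
  · have : ((m - 0).toNat : ℝ) = m := by
      have : ((m - 0).toNat : ℤ) = m := by omega
      exact_mod_cast this
    have h0 : (0 - m).toNat = 0 := by omega
    rw [this, h0]; push_cast; ring
  · have : ((0 - m).toNat : ℝ) = -m := by
      have : ((0 - m).toNat : ℤ) = -m := by omega
      exact_mod_cast this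
    have h0 : (m - 0).toNat = 0 := by omega
    rw [this, h0]; push_cast; ring

theorem measurable_Psi (A : UnitAddCircle) (m : ℤ) : Measurable (Psi A m) := by
  unfold Psi
  refine Measurable.sub ?_ ?_ <;>
  exact Finset.measurable_fun_sum _ fun j _ => measurable_frac.comp (measurable_id.sub_const _)

/-- The set of points within `r` of one of the points `j A`, `j ∈ J`. -/
def nearOrbit (A : UnitAddCircle) (J : Finset ℤ) (r : ℝ) : Set UnitAddCircle :=
  {x | ∃ j ∈ J, ‖x - j • A‖ ≤ r}

theorem nearOrbit_eq (A : UnitAddCircle) (J : Finset ℤ) (r : ℝ) :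
    nearOrbit A J r = ⋃ j ∈ J, Metric.closedBall (j • A) r := by
  ext x; simp [nearOrbit, dist_eq_norm]

theorem measurableSet_nearOrbit (A : UnitAddCircle) (J : Finset ℤ) (r : ℝ) :
    MeasurableSet (nearOrbit A J r) := by
  rw [nearOrbit_eq]
  exact J.measurableSet_biUnion fun j _ => measurableSet_closedBall

theorem volume_nearOrbit_le (A : UnitAddCircle) (J : Finset ℤ) (r : ℝ) :
    volume (nearOrbit A J r) ≤ ENNReal.ofReal (J.card * (2 * r)) := by
  rw [nearOrbit_eq]
  refine (measure_biUnion_finset_le _ _).trans ?_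
  calc _ ≤ ∑ j ∈ J, ENNReal.ofReal (2 * r) := by
        refine Finset.sum_le_sum fun j _ => ?_
        rw [AddCircle.volume_closedBall]
        exact ENNReal.ofReal_le_ofReal (min_le_right _ _)
    _ = _ := by
      rw [Finset.sum_const, nsmul_eq_mul, ENNReal.ofReal_mul (by positivity)]; simp

end IrrationalRotation

/-! ### Fourier analysis of averages at a small scale. -/

namespace IrrationalRotation

open AddCircle Filter Topology

theorem volume_eq_haarAddCircle :
    (volume : Measure UnitAddCircle) = haarAddCircle := by
  rw [AddCircle.volume_eq_smul_haarAddCircle]; simp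

instance : IsProbabilityMeasure (volume : Measure UnitAddCircle) :=
  ⟨UnitAddCircle.measure_univ⟩

theorem memLp_of_bound {f : UnitAddCircle → ℂ} {C : ℝ} (hf : Measurable f)
    (hC : ∀ x, ‖f x‖ ≤ C) (p : ENNReal) : MemLp f p volume :=
  MemLp.of_bound hf.aestronglyMeasurable C (ae_of_all _ hC)

theorem integrable_norm_sq {f : UnitAddCircle → ℂ} {C : ℝ} (hf : Measurable f)
    (hC : ∀ x, ‖f x‖ ≤ C) : Integrable (fun x => ‖f x‖ ^ 2) :=
  (memLp_of_bound hf hC 2).norm.integrable_sq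

/-- Parseval's identity. -/
theorem hasSum_sq_norm_fourierCoeff {f : UnitAddCircle → ℂ} {C : ℝ} (hf : Measurable f)
    (hC : ∀ x, ‖f x‖ ≤ C) :
    HasSum (fun k : ℤ => ‖fourierCoeff f k‖ ^ 2) (∫ x, ‖f x‖ ^ 2) := by
  have h : MemLp f 2 haarAddCircle := by
    rw [← volume_eq_haarAddCircle]; exact memLp_of_bound hf hC 2
  have h1 := hasSum_sq_fourierCoeff h.toLp
  have h2 : ∫ t, ‖h.toLp f t‖ ^ 2 ∂haarAddCircle = ∫ x, ‖f x‖ ^ 2 := by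
    rw [volume_eq_haarAddCircle]
    refine integral_congr_ae ?_
    filter_upwards [h.coeFn_toLp] with x hx
    rw [hx]
  rw [h2] at h1
  simpa [fourierCoeff_congr_ae h.coeFn_toLp] using h1

theorem fourierCoeff_comp_add (f : UnitAddCircle → ℂ) (v : UnitAddCircle) (k : ℤ) :
    fourierCoeff (fun x => f (x + v)) k = fourier k v * fourierCoeff f k := by
  unfold fourierCoeff
  rw [← integral_add_right_eq_self (fun t => fourier (-k) t • f t) v, ← integral_const_mul]
  congr 1; ext t
  simp only [smul_eq_mul, fourier_eq_e, smul_add, e_add, neg_smul]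
  rw [e_neg (k • v)]
  have := e_ne_zero (k • v)
  field_simp

/-- The average of `f` over the arc `(x, x + u]`. -/
noncomputable def avg (u : ℝ) (f : UnitAddCircle → ℂ) (x : UnitAddCircle) : ℂ :=
  (u⁻¹ : ℝ) • ∫ y in Set.Ioc 0 u, f (x + (y : UnitAddCircle))

/-- The multiplier of `avg u` on the Fourier side. -/
noncomputable def mult (u : ℝ) (k : ℤ) : ℂ :=
  (u⁻¹ : ℝ) • ∫ y in Set.Ioc 0 u, fourier k (y : UnitAddCircle)

theorem integrableOn_comp_add {f : UnitAddCircle → ℂ} {C : ℝ} (hf : Measurable f)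
    (hC : ∀ x, ‖f x‖ ≤ C) (x : UnitAddCircle) (u : ℝ) :
    IntegrableOn (fun y : ℝ => f (x + (y : UnitAddCircle))) (Set.Ioc 0 u) := by
  refine Integrable.of_bound ?_ C (ae_of_all _ fun y => hC _)
  exact (hf.comp (measurable_const.add AddCircle.measurable_mk')).aestronglyMeasurable

theorem measurable_avg {f : UnitAddCircle → ℂ} (hf : Measurable f) (u : ℝ) :
    Measurable (avg u f) := by
  have h : StronglyMeasurable (fun z : UnitAddCircle × ℝ => f (z.1 + (z.2 : UnitAddCircle))) :=
    (hf.comp (measurable_fst.add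
      (AddCircle.measurable_mk'.comp measurable_snd))).stronglyMeasurable
  have h2 := (h.integral_prod_right' (ν := volume.restrict (Set.Ioc 0 u))).measurable
  exact h2.const_smul (u⁻¹ : ℝ)

theorem norm_avg_sub_le {f g : ℝ → ℂ} {u C : ℝ} (hu : 0 < u)
    (hf : IntegrableOn f (Set.Ioc 0 u)) (hg : IntegrableOn g (Set.Ioc 0 u))
    (hC : ∀ y ∈ Set.Ioc 0 u, ‖f y - g y‖ ≤ C) :
    ‖(u⁻¹ : ℝ) • (∫ y in Set.Ioc 0 u, f y) - (u⁻¹ : ℝ) • ∫ y in Set.Ioc 0 u, g y‖ ≤ C := by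
  rw [← smul_sub, ← integral_sub hf hg, norm_smul, norm_inv, Real.norm_of_nonneg hu.le]
  have := norm_setIntegral_le_of_norm_le_const (μ := volume) (s := Set.Ioc 0 u)
    (by simp) hC
  rw [Real.volume_real_Ioc_of_le hu.le, sub_zero] at this
  rw [inv_mul_le_iff₀ hu]; linarith

theorem norm_avg_le {f : UnitAddCircle → ℂ} {C u : ℝ} (hu : 0 < u)
    (hC : ∀ x, ‖f x‖ ≤ C) (x : UnitAddCircle) : ‖avg u f x‖ ≤ C := by
  rw [avg, norm_smul, norm_inv, Real.norm_of_nonneg hu.le]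
  have := norm_setIntegral_le_of_norm_le_const (μ := volume) (s := Set.Ioc 0 u)
    (f := fun y : ℝ => f (x + (y : UnitAddCircle))) (C := C) (by simp) (fun y _ => hC _)
  rw [Real.volume_real_Ioc_of_le hu.le, sub_zero] at this
  rw [inv_mul_le_iff₀ hu]; linarith

theorem fourierCoeff_avg {f : UnitAddCircle → ℂ} {C : ℝ} (hf : Measurable f)
    (hC : ∀ x, ‖f x‖ ≤ C) (u : ℝ) (k : ℤ) :
    fourierCoeff (avg u f) k = mult u k * fourierCoeff f k := by
  have h1 : ∀ y : ℝ, ∫ x, fourier (-k) x * f (x + (y : UnitAddCircle)) ∂haarAddCircle =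
      fourier k (y : UnitAddCircle) * fourierCoeff f k := fun y => by
    rw [← fourierCoeff_comp_add]; rfl
  have h2 : ∫ x, (∫ y in Set.Ioc 0 u, fourier (-k) x * f (x + (y : UnitAddCircle))) ∂haarAddCircle
      = ∫ y in Set.Ioc 0 u, ∫ x, fourier (-k) x * f (x + (y : UnitAddCircle)) ∂haarAddCircle := by
    refine integral_integral_swap ?_
    refine Integrable.of_bound ?_ C (ae_of_all _ fun z => ?_)
    · refine Measurable.aestronglyMeasurable ?_
      refine Measurable.mul ((map_continuous (fourier (-k))).measurable.comp measurable_fst) ?_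
      exact hf.comp (measurable_fst.add (AddCircle.measurable_mk'.comp measurable_snd))
    · show ‖fourier (-k) z.1 * f (z.1 + (z.2 : UnitAddCircle))‖ ≤ C
      rw [norm_mul, fourier_eq_e, norm_e, one_mul]; exact hC _
  calc fourierCoeff (avg u f) k
      = (u⁻¹ : ℝ) • ∫ x, (∫ y in Set.Ioc 0 u, fourier (-k) x * f (x + (y : UnitAddCircle)))
          ∂haarAddCircle := by
        rw [← integral_smul]
        unfold fourierCoeff avg
        congr 1; ext x
        rw [integral_const_mul, smul_eq_mul, mul_smul_comm]
    _ = _ := by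
      rw [h2]; simp_rw [h1]
      rw [integral_mul_const, mult, smul_mul_assoc]

theorem norm_mult_le_one {u : ℝ} (hu : 0 < u) (k : ℤ) : ‖mult u k‖ ≤ 1 := by
  have := norm_avg_le (f := fun x => fourier k x) (C := 1) hu
    (fun x => by rw [fourier_eq_e, norm_e]) 0
  simpa [avg, mult] using this

/-- The explicit integral of a character, multiplied out so that `k = 0` needs no exception. -/
theorem norm_mult_mul (u : ℝ) (hu : 0 < u) (k : ℤ) :
    ‖mult u k‖ * (2 * Real.pi * |k * u|) = ‖e ((k * u : ℝ) : UnitAddCircle) - 1‖ := by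
  rcases eq_or_ne k 0 with rfl | hk
  · simp [e_zero]
  have hc : (2 * Real.pi * Complex.I * k : ℂ) ≠ 0 := by
    have : (k : ℂ) ≠ 0 := by exact_mod_cast hk
    simp [Real.pi_ne_zero, this]
  have h1 : ∫ y in Set.Ioc 0 u, fourier k (y : UnitAddCircle) =
      (e ((k * u : ℝ) : UnitAddCircle) - 1) / (2 * Real.pi * Complex.I * k) := by
    rw [← intervalIntegral.integral_of_le hu.le, e_coe]
    have := integral_exp_mul_complex (a := 0) (b := u) hc
    simp only [Complex.ofReal_zero, mul_zero, Complex.exp_zero] at this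
    rw [show (2 * Real.pi * Complex.I * ((k * u : ℝ) : ℂ) : ℂ) =
      2 * Real.pi * Complex.I * k * u by push_cast; ring, ← this]
    congr 1; ext y
    rw [fourier_coe_apply]; simp
  rw [mult, h1, norm_smul, norm_div, norm_inv, Real.norm_of_nonneg hu.le]
  simp only [norm_mul, Complex.norm_I, Complex.norm_real, Complex.norm_intCast, abs_mul,
    Real.norm_eq_abs, abs_of_pos hu, abs_of_pos Real.pi_pos, mul_one, Complex.norm_ofNat]
  have : |(k : ℝ)| ≠ 0 := by simpa using hk
  field_simp

theorem norm_mult_sub_one_le {u : ℝ} (hu : 0 < u) (k : ℤ) :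
    ‖mult u k - 1‖ ≤ 2 * Real.pi * |k * u| := by
  have hc : Continuous fun y : ℝ => fourier k (y : UnitAddCircle) :=
    (map_continuous (fourier k)).comp (AddCircle.continuous_mk' 1)
  have := norm_avg_sub_le (f := fun y : ℝ => fourier k (y : UnitAddCircle)) (g := fun _ => 1)
    (C := 2 * Real.pi * |k * u|) hu (hc.integrableOn_Ioc) (by simp) (fun y hy => by
      rw [fourier_eq_e, ← AddCircle.coe_zsmul, zsmul_eq_mul]
      refine (norm_e_sub_one_le _).trans ?_
      rw [abs_mul, abs_mul, abs_of_pos hy.1, abs_of_pos hu]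
      have := hy.2
      gcongr)
  simpa [mult, hu.le, hu.ne'] using this

/-- The difference of the averages of `f` over the arcs `(x, x + u]` and `(x - u, x]`. -/
noncomputable def dif (u : ℝ) (f : UnitAddCircle → ℂ) (x : UnitAddCircle) : ℂ :=
  avg u f x - avg u f (x - (u : UnitAddCircle))

theorem measurable_dif {f : UnitAddCircle → ℂ} (hf : Measurable f) (u : ℝ) :
    Measurable (dif u f) :=
  (measurable_avg hf u).sub ((measurable_avg hf u).comp (measurable_id.sub_const _))

theorem norm_dif_le {f : UnitAddCircle → ℂ} {u : ℝ} (hu : 0 < u)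
    (hC : ∀ x, ‖f x‖ ≤ 1) (x : UnitAddCircle) : ‖dif u f x‖ ≤ 2 := by
  refine (norm_sub_le _ _).trans ?_
  linarith [norm_avg_le hu hC x, norm_avg_le hu hC (x - (u : UnitAddCircle))]

theorem integrable_fourier_mul {f : UnitAddCircle → ℂ} {C : ℝ} (hf : Measurable f)
    (hC : ∀ x, ‖f x‖ ≤ C) : Integrable f haarAddCircle := by
  rw [← volume_eq_haarAddCircle]
  exact memLp_one_iff_integrable.1 (memLp_of_bound hf hC 1)

theorem fourierCoeff_sub {f g : UnitAddCircle → ℂ} {C : ℝ} (hf : Measurable f)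
    (hg : Measurable g) (hfC : ∀ x, ‖f x‖ ≤ C) (hgC : ∀ x, ‖g x‖ ≤ C) (k : ℤ) :
    fourierCoeff (fun x => f x - g x) k = fourierCoeff f k - fourierCoeff g k := by
  have h := fourierCoeff.add (integrable_fourier_mul hf hfC)
    ((integrable_fourier_mul hg hgC).const_mul (-1))
  have h2 : fourierCoeff (fun x => -1 * g x) k = -1 * fourierCoeff g k :=
    fourierCoeff.const_mul g (-1) k
  have h3 := congrFun h k
  simp only [Pi.add_apply] at h3
  rw [h2] at h3
  rw [show fourierCoeff f k - fourierCoeff g k = fourierCoeff f k + -1 * fourierCoeff g k by ring,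
    ← h3]
  congr 1; ext x; simp [sub_eq_add_neg]

theorem norm_fourierCoeff_dif {f : UnitAddCircle → ℂ} (hf : Measurable f)
    (hC : ∀ x, ‖f x‖ ≤ 1) {u : ℝ} (hu : 0 < u) (k : ℤ) :
    ‖fourierCoeff (dif u f) k‖ =
      ‖mult u k‖ * ‖e ((k * u : ℝ) : UnitAddCircle) - 1‖ * ‖fourierCoeff f k‖ := by
  have h1 : fourierCoeff (fun x => avg u f (x - (u : UnitAddCircle))) k =
      fourier k (-(u : UnitAddCircle)) * fourierCoeff (avg u f) k := by
    rw [← fourierCoeff_comp_add]; rfl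
  have h2 : fourierCoeff (dif u f) k =
      fourierCoeff (avg u f) k - fourierCoeff (fun x => avg u f (x - (u : UnitAddCircle))) k :=
    fourierCoeff_sub (measurable_avg hf u)
      ((measurable_avg hf u).comp (measurable_id.sub_const _))
      (norm_avg_le hu hC) (fun x => norm_avg_le hu hC _) k
  rw [h2, h1, fourierCoeff_avg hf hC, fourier_eq_e, smul_neg, e_neg, ← AddCircle.coe_zsmul,
    zsmul_eq_mul]
  set E := e ((k * u : ℝ) : UnitAddCircle)
  have hE : E ≠ 0 := e_ne_zero _
  have hE1 : ‖E‖ = 1 := norm_e _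
  rw [show mult u k * fourierCoeff f k - E⁻¹ * (mult u k * fourierCoeff f k) =
    mult u k * ((E - 1) * E⁻¹) * fourierCoeff f k by field_simp]
  simp [hE1]

/-- With `r = |k| * u` the left side is `O(min (r ^ 2) (r ^ (-2)))`. The majorant has weaker decay
at both ends, but it telescopes along lacunary sequences. -/
theorem sq_mult_le {u : ℝ} (hu : 0 < u) (k : ℤ) :
    (‖mult u k‖ * ‖e ((k * u : ℝ) : UnitAddCircle) - 1‖) ^ 2 ≤
      240 * (|(k : ℝ)| * u / ((1 + |(k : ℝ)| * u) * (2 + |(k : ℝ)| * u))) := by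
  have h1 := norm_mult_le_one hu k
  have h2 := norm_mult_mul u hu k
  have h3 := norm_e_sub_one_le (k * u)
  have h4 := norm_e_sub_one_le_two ((k * u : ℝ) : UnitAddCircle)
  rw [abs_mul, abs_of_pos hu] at h2 h3
  set r := |(k : ℝ)| * u with hr
  have hr0 : 0 ≤ r := by positivity
  set E := ‖e ((k * u : ℝ) : UnitAddCircle) - 1‖
  have hE : 0 ≤ E := norm_nonneg _
  set m := ‖mult u k‖
  have hm : 0 ≤ m := norm_nonneg _
  have hpi := Real.pi_gt_three
  have hpi' := Real.pi_lt_d2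
  rcases le_total r 1 with hr1 | hr1
  · have h5 : m * E ≤ 2 * Real.pi * r := by nlinarith
    have h6 : m * E ≤ 6.3 * r := h5.trans (by nlinarith)
    have h7 : (m * E) ^ 2 ≤ (6.3 * r) ^ 2 := pow_le_pow_left₀ (by positivity) h6 2
    have h8 : 40 * r ≤ 240 * (r / ((1 + r) * (2 + r))) := by
      rw [← mul_div_assoc, le_div_iff₀ (by positivity)]
      nlinarith [mul_nonneg hr0 hr0]
    nlinarith
  · have h5 : m * r ≤ 1 := by nlinarith [mul_nonneg hm hr0]
    have h6 : m * E * r ≤ 2 := by nlinarith [mul_nonneg hm hr0]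
    have h7 : (m * E * r) ^ 2 ≤ 4 := by nlinarith [mul_nonneg (mul_nonneg hm hE) hr0]
    have h8 : (m * E) ^ 2 * r ^ 2 ≤ 4 := by linarith [mul_pow (m * E) r 2]
    rw [← mul_div_assoc, le_div_iff₀ (by positivity)]
    have h9 : (1 + r) * (2 + r) ≤ 6 * r ^ 2 := by nlinarith
    nlinarith [mul_le_mul_of_nonneg_left h9 (sq_nonneg (m * E))]

/-- The summand is `r / (1 + r) - r / (2 + r)`, and halving `r` turns `r / (1 + r)` into `r / (2 +
r)`. The sum therefore telescopes with step two, leaving two boundary terms of size at most `1`. -/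
theorem sum_div_le {r : ℕ → ℝ} (h0 : ∀ n, 0 ≤ r n) (h2 : ∀ n, 2 * r (n + 2) ≤ r n) (N : ℕ) :
    ∑ n ∈ Finset.range N, r n / ((1 + r n) * (2 + r n)) ≤ 2 := by
  have key : ∀ n, r n / ((1 + r n) * (2 + r n)) ≤
      r n / (1 + r n) - r (n + 2) / (1 + r (n + 2)) := by
    intro n
    have h1 := h0 n
    have h3 := h0 (n + 2)
    have h4 := h2 n
    have h5 : r (n + 2) / (1 + r (n + 2)) ≤ r n / (2 + r n) := by
      rw [div_le_div_iff₀ (by positivity) (by positivity)]; nlinarith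
    have h6 : r n / ((1 + r n) * (2 + r n)) = r n / (1 + r n) - r n / (2 + r n) := by
      field_simp; ring
    linarith
  have hb : ∀ n, 0 ≤ r n / (1 + r n) ∧ r n / (1 + r n) ≤ 1 := fun n => by
    have h1 := h0 n
    exact ⟨by positivity, by rw [div_le_one (by positivity)]; linarith⟩
  have hsum : ∀ N, ∑ n ∈ Finset.range N, r n / ((1 + r n) * (2 + r n)) ≤
      r 0 / (1 + r 0) + r 1 / (1 + r 1) - r N / (1 + r N) - r (N + 1) / (1 + r (N + 1)) := by
    intro N
    induction N with
    | zero => simp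
    | succ N ih => rw [Finset.sum_range_succ]; linarith [key N]
  linarith [hsum N, (hb 0).2, (hb 1).2, (hb N).1, (hb (N + 1)).1]

/-- A Littlewood-Paley type inequality along a lacunary sequence of scales. -/
theorem summable_integral_dif {f : UnitAddCircle → ℂ} (hf : Measurable f)
    (hC : ∀ x, ‖f x‖ ≤ 1) {u : ℕ → ℝ} (hu : ∀ n, 0 < u n) (hu2 : ∀ n, 2 * u (n + 2) ≤ u n) :
    Summable fun n => ∫ x, ‖dif (u n) f x‖ ^ 2 := by
  refine summable_of_sum_range_le (c := 480 * ∫ x, ‖f x‖ ^ 2)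
    (fun n => integral_nonneg fun x => by positivity) fun N => ?_
  have h1 : HasSum (fun k : ℤ => ∑ n ∈ Finset.range N, ‖fourierCoeff (dif (u n) f) k‖ ^ 2)
      (∑ n ∈ Finset.range N, ∫ x, ‖dif (u n) f x‖ ^ 2) :=
    hasSum_sum fun n _ =>
      hasSum_sq_norm_fourierCoeff (measurable_dif hf _) (norm_dif_le (hu n) hC)
  refine hasSum_le (fun k => ?_) h1 ((hasSum_sq_norm_fourierCoeff hf hC).mul_left 480)
  have h2 : ∀ n ∈ Finset.range N, ‖fourierCoeff (dif (u n) f) k‖ ^ 2 ≤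
      240 * (|(k : ℝ)| * u n / ((1 + |(k : ℝ)| * u n) * (2 + |(k : ℝ)| * u n))) *
        ‖fourierCoeff f k‖ ^ 2 := by
    intro n _
    rw [norm_fourierCoeff_dif hf hC (hu n), mul_pow]
    exact mul_le_mul_of_nonneg_right (sq_mult_le (hu n) k) (by positivity)
  refine (Finset.sum_le_sum h2).trans ?_
  rw [← Finset.sum_mul, ← Finset.mul_sum]
  have h3 := sum_div_le (r := fun n => |(k : ℝ)| * u n)
    (fun n => mul_nonneg (abs_nonneg _) (hu n).le)
    (fun n => by nlinarith [hu2 n, abs_nonneg (k : ℝ)]) N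
  exact mul_le_mul_of_nonneg_right (by linarith) (by positivity)

theorem tendsto_mult {u : ℕ → ℝ} (hu : ∀ n, 0 < u n) (hu0 : Tendsto u atTop (𝓝 0)) (k : ℤ) :
    Tendsto (fun n => mult (u n) k) atTop (𝓝 1) := by
  rw [tendsto_iff_norm_sub_tendsto_zero]
  refine squeeze_zero (fun n => norm_nonneg _) (fun n => norm_mult_sub_one_le (hu n) k) ?_
  have : Tendsto (fun n => 2 * Real.pi * |k * u n|) atTop (𝓝 (2 * Real.pi * |(k : ℝ) * 0|)) :=
    ((hu0.const_mul _).abs).const_mul _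
  simpa using this

theorem tendsto_integral_sub_avg {f : UnitAddCircle → ℂ} (hf : Measurable f)
    (hC : ∀ x, ‖f x‖ ≤ 1) {u : ℕ → ℝ} (hu : ∀ n, 0 < u n) (hu0 : Tendsto u atTop (𝓝 0)) :
    Tendsto (fun n => ∫ x, ‖f x - avg (u n) f x‖ ^ 2) atTop (𝓝 0) := by
  have h1 : ∀ n, ∫ x, ‖f x - avg (u n) f x‖ ^ 2 =
      ∑' k : ℤ, ‖(1 - mult (u n) k) * fourierCoeff f k‖ ^ 2 := by
    intro n
    have hm : Measurable fun x => f x - avg (u n) f x := hf.sub (measurable_avg hf (u n))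
    rw [← (hasSum_sq_norm_fourierCoeff (C := 2) hm
      (fun x => (norm_sub_le _ _).trans (by linarith [hC x, norm_avg_le (hu n) hC x]))).tsum_eq]
    congr 1; ext k
    rw [fourierCoeff_sub hf (measurable_avg hf (u n)) hC (norm_avg_le (hu n) hC),
      fourierCoeff_avg hf hC, sub_mul, one_mul]
  simp_rw [h1]
  have h2 : (0 : ℝ) = ∑' k : ℤ, ‖(1 - 1) * fourierCoeff f k‖ ^ 2 := by simp
  rw [h2]
  refine tendsto_tsum_of_dominated_convergence
    (bound := fun k => 4 * ‖fourierCoeff f k‖ ^ 2)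
    ((hasSum_sq_norm_fourierCoeff hf hC).summable.mul_left 4) (fun k => ?_)
    (Eventually.of_forall fun n k => ?_)
  · exact ((((tendsto_const_nhds (x := (1 : ℂ))).sub (tendsto_mult hu hu0 k)).mul_const _).norm).pow 2
  · rw [norm_mul, mul_pow, Real.norm_of_nonneg (by positivity)]
    have : ‖1 - mult (u n) k‖ ≤ 2 :=
      (norm_sub_le _ _).trans (by rw [norm_one]; linarith [norm_mult_le_one (hu n) k])
    have h3 : ‖1 - mult (u n) k‖ ^ 2 ≤ 4 := by nlinarith [norm_nonneg (1 - mult (u n) k)]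
    exact mul_le_mul_of_nonneg_right h3 (by positivity)

theorem tendsto_integral_avg_avg {f : UnitAddCircle → ℂ} (hf : Measurable f)
    (hC : ∀ x, ‖f x‖ ≤ 1) {u : ℕ → ℝ} (hu : ∀ n, 0 < u n) (hu0 : Tendsto u atTop (𝓝 0)) :
    Tendsto (fun n => ∫ x, ‖avg (u n) (avg (u n) f) x‖ ^ 2) atTop (𝓝 (∫ x, ‖f x‖ ^ 2)) := by
  have h1 : ∀ n, ∫ x, ‖avg (u n) (avg (u n) f) x‖ ^ 2 =
      ∑' k : ℤ, ‖mult (u n) k * (mult (u n) k * fourierCoeff f k)‖ ^ 2 := by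
    intro n
    rw [← (hasSum_sq_norm_fourierCoeff (measurable_avg (measurable_avg hf (u n)) (u n))
      (norm_avg_le (hu n) (norm_avg_le (hu n) hC))).tsum_eq]
    congr 1; ext k
    rw [fourierCoeff_avg (measurable_avg hf (u n)) (norm_avg_le (hu n) hC),
      fourierCoeff_avg hf hC]
  simp_rw [h1]
  have h2 : ∫ x, ‖f x‖ ^ 2 = ∑' k : ℤ, ‖1 * (1 * fourierCoeff f k)‖ ^ 2 := by
    simp_rw [one_mul]; exact (hasSum_sq_norm_fourierCoeff hf hC).tsum_eq.symm
  rw [h2]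
  refine tendsto_tsum_of_dominated_convergence (bound := fun k => ‖fourierCoeff f k‖ ^ 2)
    (hasSum_sq_norm_fourierCoeff hf hC).summable (fun k => ?_)
    (Eventually.of_forall fun n k => ?_)
  · have h := tendsto_mult hu hu0 k
    exact ((h.mul (h.mul_const _)).norm).pow 2
  · rw [norm_mul, norm_mul, Real.norm_of_nonneg (by positivity)]
    have h3 := norm_mult_le_one (hu n) k
    refine pow_le_pow_left₀ (by positivity) ?_ 2
    calc _ ≤ 1 * (1 * ‖fourierCoeff f k‖) := by gcongr
      _ = _ := by ring

/-- On the Fourier side, `‖e (k v) - 1‖ ≤ 2 π |k v|`, while `mult u k` times `2 π |k u|` has modulus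
`‖e (k u) - 1‖`. One average is thus spent on replacing `v` by `u`; the other is the one already
contained in `dif`, which is why `f` is averaged twice. -/
theorem integral_avg_avg_shift_le {f : UnitAddCircle → ℂ} (hf : Measurable f)
    (hC : ∀ x, ‖f x‖ ≤ 1) {u : ℝ} (hu : 0 < u) (v : ℝ) :
    ∫ x, ‖avg u (avg u f) (x + (v : UnitAddCircle)) - avg u (avg u f) x‖ ^ 2 ≤
      (|v| / u) ^ 2 * ∫ x, ‖dif u f x‖ ^ 2 := by
  have hm := measurable_avg (measurable_avg hf u) u
  have hb := norm_avg_le hu (norm_avg_le hu hC)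
  have hm' : Measurable fun x : UnitAddCircle => avg u (avg u f) (x + (v : UnitAddCircle)) :=
    hm.comp (measurable_id.add_const _)
  refine hasSum_le (fun k => ?_)
    (hasSum_sq_norm_fourierCoeff (C := 2) (hm'.sub hm) (fun x => (norm_sub_le _ _).trans
      (by linarith [hb x, hb (x + (v : UnitAddCircle))])))
    ((hasSum_sq_norm_fourierCoeff (measurable_dif hf u) (norm_dif_le hu hC)).mul_left _)
  rw [norm_fourierCoeff_dif hf hC hu, ← mul_pow]
  refine pow_le_pow_left₀ (norm_nonneg _) ?_ 2
  have h0 : fourierCoeff (fun x => avg u (avg u f) (x + (v : UnitAddCircle)) -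
      avg u (avg u f) x) k = (e ((k * v : ℝ) : UnitAddCircle) - 1) *
        (mult u k * (mult u k * fourierCoeff f k)) := by
    rw [fourierCoeff_sub hm' hm (fun x => hb _) hb, fourierCoeff_comp_add,
      fourierCoeff_avg (measurable_avg hf u) (norm_avg_le hu hC), fourierCoeff_avg hf hC,
      fourier_eq_e, ← AddCircle.coe_zsmul, zsmul_eq_mul]
    ring
  show ‖fourierCoeff (fun x => avg u (avg u f) (x + (v : UnitAddCircle)) -
      avg u (avg u f) x) k‖ ≤ _
  rw [h0, norm_mul, norm_mul, norm_mul]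
  have h1 := norm_e_sub_one_le (k * v)
  have h2 := norm_mult_mul u hu k
  set m := ‖mult u k‖
  have hm0 : 0 ≤ m := norm_nonneg _
  have h3 : ‖e ((k * v : ℝ) : UnitAddCircle) - 1‖ * m ≤
      |v| / u * ‖e ((k * u : ℝ) : UnitAddCircle) - 1‖ := by
    rw [← h2]
    calc _ ≤ 2 * Real.pi * |k * v| * m := by gcongr
      _ = _ := by rw [abs_mul, abs_mul, abs_of_pos hu]; field_simp
  calc _ = ‖e ((k * v : ℝ) : UnitAddCircle) - 1‖ * m * (m * ‖fourierCoeff f k‖) := by ring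
    _ ≤ |v| / u * ‖e ((k * u : ℝ) : UnitAddCircle) - 1‖ * (m * ‖fourierCoeff f k‖) := by gcongr
    _ = _ := by ring

end IrrationalRotation

/-! ### Transfer functions along the orbit of the discontinuity. -/

namespace IrrationalRotation

open Filter Topology

/-- `f` is a measurable unimodular solution of `exp (2 π i s φ_β) = exp (2 π i t) f / (f ∘ T)`,
where `T` is the rotation by `A`, written multiplicatively without quotients. -/
structure IsTransfer (A β t : UnitAddCircle) (s : ℝ) (f : UnitAddCircle → ℂ) : Prop where
  measurable : Measurable f
  norm_eq : ∀ x, ‖f x‖ = 1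
  ae_eq : ∀ᵐ x, f (x + A) = e (t - ((s * (frac (x - β) - frac x) : ℝ) : UnitAddCircle)) * f x

theorem ae_coe {P : UnitAddCircle → Prop} (h : ∀ᵐ x, P x) : ∀ᵐ y : ℝ, P (y : UnitAddCircle) := by
  rw [← Measure.restrict_univ (μ := (volume : Measure ℝ)), ← iUnion_Ioc_intCast ℝ,
    ae_restrict_iUnion_iff]
  intro n
  exact (UnitAddCircle.measurePreserving_mk (n : ℝ)).quasiMeasurePreserving.ae h

theorem ae_add {P : UnitAddCircle → Prop} (h : ∀ᵐ x, P x) (z : UnitAddCircle) :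
    ∀ᵐ x, P (x + z) :=
  (measurePreserving_add_right volume z).quasiMeasurePreserving.ae h

theorem ae_add_real {P : ℝ → Prop} (h : ∀ᵐ x, P x) (z : ℝ) : ∀ᵐ x, P (z + x) :=
  (measurePreserving_add_left volume z).quasiMeasurePreserving.ae h

variable {A β t : UnitAddCircle} {s : ℝ} {f : UnitAddCircle → ℂ}

/-- Near a point of the orbit of `0` which is close neither to `0` nor to `β`, the cocycle is
constant. -/
theorem IsTransfer.ae_step (hf : IsTransfer A β t s f) (z : UnitAddCircle) :
    ∃ C : ℂ, ‖C‖ = 1 ∧ ∀ᵐ v : ℝ, |v| < ‖z‖ → |v| < ‖z - β‖ → f (z + v + A) = C * f (z + v) := by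
  refine ⟨e (t - ((s * (frac (z - β) - frac z) : ℝ) : UnitAddCircle)), norm_e _, ?_⟩
  filter_upwards [ae_coe (ae_add hf.ae_eq z)] with v hv h1 h2
  rw [add_comm (v : UnitAddCircle)] at hv
  rw [hv, frac_add h1, show z + v - β = z - β + v by abel, frac_add h2]
  ring_nf

/-- The jump of the cocycle at `0`. -/
theorem IsTransfer.ae_jump (hf : IsTransfer A β t s f) :
    ∃ C : ℂ, ‖C‖ = 1 ∧ ∀ᵐ v : ℝ, |v| < 1 → |v| < ‖β‖ →
      f (A + v) = C * (if v < 0 then e (s : UnitAddCircle) else 1) * f v := by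
  refine ⟨e (t - ((s * frac (-β) : ℝ) : UnitAddCircle)), norm_e _, ?_⟩
  filter_upwards [ae_coe hf.ae_eq] with v hv h1 h2
  have h3 := abs_lt.1 h1
  rw [add_comm, hv, show (v : UnitAddCircle) - β = -β + v by abel, frac_add (by rwa [norm_neg])]
  congr 1
  split_ifs with hneg
  · rw [frac_coe, show Int.fract v = v + 1 from
      Int.fract_eq_iff.2 ⟨by linarith, by linarith, -1, by push_cast; ring⟩, ← e_add]
    congr 1
    rw [sub_add, sub_right_inj, ← AddCircle.coe_sub]
    congr 1; ring
  · rw [frac_coe_of_mem (by linarith) h3.2, mul_one]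
    congr 3; ring

/-- Between `-j • A` and `0` the orbit starts from the points of index `-j, …, -1`, which avoid both
discontinuities, so only a constant is accumulated. -/
theorem IsTransfer.ae_backward (hf : IsTransfer A β t s f) {r : ℝ} {K : ℕ}
    (h0 : ∀ l : ℤ, -K < l → l < 0 → r ≤ ‖l • A‖) (hβ : ∀ l : ℤ, -K < l → l < 0 → r ≤ ‖l • A - β‖)
    (j : ℕ) (hj : j < K) :
    ∃ C : ℂ, ‖C‖ = 1 ∧ ∀ᵐ v : ℝ, |v| < r → f (-(j : ℤ) • A + v) = C * f v := by
  induction j with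
  | zero => exact ⟨1, by simp, by simp⟩
  | succ j ih =>
    obtain ⟨C, hC, h1⟩ := ih (by omega)
    obtain ⟨C', hC', h2⟩ := hf.ae_step ((-((j + 1 : ℕ) : ℤ)) • A)
    refine ⟨C'⁻¹ * C, by simp [hC, hC'], ?_⟩
    filter_upwards [h1, h2] with v h1 h2 hv
    have h3 := h2 (hv.trans_le (h0 _ (by omega) (by omega)))
      (hv.trans_le (hβ _ (by omega) (by omega)))
    have h4 : C' ≠ 0 := fun h => by simp [h] at hC'
    have h5 : -((j + 1 : ℕ) : ℤ) • A + (v : UnitAddCircle) + A = -(j : ℤ) • A + v := by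
      push_cast; simp only [neg_smul, add_smul, one_smul]; abel
    rw [h5, h1 hv] at h3
    rw [mul_assoc, h3]; field_simp

/-- The first step starts at `0` and picks up the jump factor `e s` on the side `v < 0`; the later
steps avoid both discontinuities. Index `0` is included in `hβ` because `β` must stay away from this
first step as well. -/
theorem IsTransfer.ae_forward (hf : IsTransfer A β t s f) {r : ℝ} (hr : r ≤ 1) {K : ℕ}
    (h0 : ∀ l : ℤ, 0 < l → l < K → r ≤ ‖l • A‖) (hβ : ∀ l : ℤ, 0 ≤ l → l < K → r ≤ ‖l • A - β‖)
    (j : ℕ) (hj : j < K) :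
    ∃ C : ℂ, ‖C‖ = 1 ∧ ∀ᵐ v : ℝ, |v| < r → f (((j + 1 : ℕ) : ℤ) • A + v) =
      C * (if v < 0 then e (s : UnitAddCircle) else 1) * f v := by
  induction j with
  | zero =>
    obtain ⟨C, hC, h1⟩ := hf.ae_jump
    refine ⟨C, hC, ?_⟩
    filter_upwards [h1] with v h1 hv
    have h2 := hβ 0 le_rfl (by omega)
    rw [zero_smul, zero_sub, norm_neg] at h2
    simpa using h1 (hv.trans_le hr) (hv.trans_le h2)
  | succ j ih =>
    obtain ⟨C, hC, h1⟩ := ih (by omega)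
    obtain ⟨C', hC', h2⟩ := hf.ae_step (((j + 1 : ℕ) : ℤ) • A)
    refine ⟨C' * C, by simp [hC, hC'], ?_⟩
    filter_upwards [h1, h2] with v h1 h2 hv
    have h3 := h2 (hv.trans_le (h0 _ (by omega) (by omega)))
      (hv.trans_le (hβ _ (by omega) (by omega)))
    have h5 : ((j + 1 : ℕ) : ℤ) • A + (v : UnitAddCircle) + A = ((j + 1 + 1 : ℕ) : ℤ) • A + v := by
      push_cast; simp only [add_smul, one_smul]; abel
    rw [← h5, h3, h1 hv]; ring

theorem norm_avg_sub_avg_le {g h : ℝ → ℂ} {u a b : ℝ} (hu : 0 < u) (hab : a ≤ b)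
    (hg : IntegrableOn g (Set.Ioc 0 u)) (hh : IntegrableOn h (Set.Ioc 0 u))
    (hg1 : ∀ y, ‖g y‖ ≤ 1) (hh1 : ∀ y, ‖h y‖ ≤ 1)
    (heq : ∀ᵐ y, y ∈ Set.Ioc 0 u → y ∉ Set.Icc a b → g y = h y) :
    ‖(u⁻¹ : ℝ) • (∫ y in Set.Ioc 0 u, g y) - (u⁻¹ : ℝ) • ∫ y in Set.Ioc 0 u, h y‖ ≤
      2 * (b - a) / u := by
  rw [← smul_sub, ← integral_sub hg hh, norm_smul, norm_inv, Real.norm_of_nonneg hu.le,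
    inv_mul_eq_div]
  have hi : IntegrableOn (fun _ : ℝ => (2 : ℝ)) (Set.Icc a b) := by simp
  have h1 : ‖∫ y in Set.Ioc 0 u, (g y - h y)‖ ≤
      ∫ y in Set.Ioc 0 u, (Set.Icc a b).indicator (fun _ => (2 : ℝ)) y := by
    refine norm_integral_le_of_norm_le
      ((integrable_indicator_iff measurableSet_Icc).2 hi).integrableOn ?_
    rw [ae_restrict_iff' measurableSet_Ioc]
    filter_upwards [heq] with y hy hyu
    by_cases hyab : y ∈ Set.Icc a b
    · rw [Set.indicator_of_mem hyab]
      exact (norm_sub_le _ _).trans (by linarith [hg1 y, hh1 y])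
    · rw [hy hyu hyab, sub_self, norm_zero, Set.indicator_of_notMem hyab]
  have h2 : ∫ y in Set.Ioc 0 u, (Set.Icc a b).indicator (fun _ => (2 : ℝ)) y ≤ 2 * (b - a) := by
    refine (setIntegral_le_integral ((integrable_indicator_iff measurableSet_Icc).2 hi)
      (ae_of_all _ fun y => Set.indicator_nonneg (fun _ _ => by norm_num) _)).trans ?_
    rw [integral_indicator measurableSet_Icc, setIntegral_const, Real.volume_real_Icc_of_le hab,
      smul_eq_mul, mul_comm]
  gcongr
  exact h1.trans h2

end IrrationalRotation

/-! ### The jump at `0` forces oscillation on one of its two sides. -/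

namespace IrrationalRotation

open Filter Topology

variable {A β t : UnitAddCircle} {s : ℝ} {f : UnitAddCircle → ℂ}

theorem avg_eq_mul {z : UnitAddCircle} {C : ℂ} {u r x : ℝ}
    (h : ∀ᵐ v : ℝ, |v| < r → f (z + v) = C * f v) (hx : ∀ y ∈ Set.Ioc 0 u, |x + y| < r) :
    avg u f (z + x) = C * avg u f x := by
  rw [avg, avg, mul_smul_comm, ← integral_const_mul]
  congr 1
  refine setIntegral_congr_ae measurableSet_Ioc ?_
  filter_upwards [ae_add_real h x] with y hy hyu
  have := hy (hx y hyu)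
  rwa [AddCircle.coe_add, ← add_assoc] at this

/-- The jump factor `χ` equals `κ` on the whole arc except in `[a, b]`; treating it as constant
there costs at most the length of that interval. -/
theorem norm_avg_sub_mul_le (hf : Measurable f) (hf1 : ∀ x, ‖f x‖ ≤ 1) {z : UnitAddCircle}
    {C κ : ℂ} {u r x a b : ℝ} {χ : ℝ → ℂ} (hu : 0 < u) (hab : a ≤ b) (hC : ‖C‖ = 1) (hκ : ‖κ‖ = 1)
    (h : ∀ᵐ v : ℝ, |v| < r → f (z + v) = C * χ v * f v)
    (hx : ∀ y ∈ Set.Ioc 0 u, |x + y| < r)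
    (hχ : ∀ y ∈ Set.Ioc 0 u, y ∉ Set.Icc a b → χ (x + y) = κ) :
    ‖avg u f (z + x) - C * κ * avg u f x‖ ≤ 2 * (b - a) / u := by
  have h1 := norm_avg_sub_avg_le (g := fun y => f (z + x + y)) (h := fun y => C * κ * f (x + y))
    hu hab (integrableOn_comp_add hf hf1 _ _) ((integrableOn_comp_add hf hf1 _ _).const_mul _)
    (fun _ => hf1 _) (fun y => by rw [norm_mul, norm_mul, hC, hκ, one_mul, one_mul]; exact hf1 _)
    (by
      filter_upwards [ae_add_real h x] with y hy hyu hyab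
      have := hy (hx y hyu)
      rw [hχ y hyu hyab] at this
      rwa [AddCircle.coe_add, ← add_assoc] at this)
  rw [integral_const_mul, ← mul_smul_comm] at h1
  exact h1

/-- The key pointwise inequality: on the two sides of the passage near the discontinuity `0`, the
local differences of `f` cannot both be small. -/
theorem IsTransfer.le_norm_dif_add_norm_dif (hf : IsTransfer A β t s f) {u η : ℝ} (hu : 0 < u)
    (hu1 : 2 * u ≤ 1) (hη : η = u * ‖e (s : UnitAddCircle) - 1‖ / 16) {K₁ K₂ : ℕ}
    (h0 : ∀ l : ℤ, -K₁ < l → l < K₂ → l ≠ 0 → 2 * u ≤ ‖l • A‖)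
    (hβ : ∀ l : ℤ, -K₁ < l → l < K₂ → 2 * u ≤ ‖l • A - β‖)
    {j i : ℕ} (hj : j < K₁) (hi : i < K₂) {w : UnitAddCircle} (hw : ‖w‖ ≤ η) :
    let z := w + (-(j : ℤ)) • A
    let z' := w + ((i + 1 : ℕ) : ℤ) • A
    ‖e (s : UnitAddCircle) - 1‖ / 2 ≤ ‖dif u f z‖ + ‖dif u f z'‖ + 2 * (1 - ‖avg u f z‖) ∧
    ‖e (s : UnitAddCircle) - 1‖ / 2 ≤ ‖dif u f z‖ + ‖dif u f z'‖ + 2 * (1 - ‖avg u f z'‖) := by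
  obtain ⟨x, rfl, hx⟩ := exists_coe_eq_abs_eq_norm w
  rw [← hx] at hw
  set ω := e (s : UnitAddCircle) with hω
  have hω1 : ‖ω‖ = 1 := norm_e _
  have hω2 : ‖ω - 1‖ ≤ 2 := norm_e_sub_one_le_two _
  have hηu : η ≤ u / 8 := by rw [hη]; nlinarith
  have hη0 : 0 ≤ η := (abs_nonneg x).trans hw
  have hx2 := abs_le.1 hw
  obtain ⟨C, hC, hback⟩ := hf.ae_backward (r := 2 * u) (K := K₁)
    (fun l h1 h2 => h0 l h1 (by omega) (by omega)) (fun l h1 h2 => hβ l h1 (by omega)) j hj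
  obtain ⟨C', hC', hforw⟩ := hf.ae_forward hu1 (K := K₂)
    (fun l h1 h2 => h0 l (by omega) h2 (by omega)) (fun l h1 h2 => hβ l (by omega) h2) i hi
  have hf1 : ∀ x, ‖f x‖ ≤ 1 := fun x => (hf.norm_eq x).le
  have hr1 : ∀ y ∈ Set.Ioc 0 u, |x + y| < 2 * u := fun y hy => by
    rw [abs_lt]; constructor <;> linarith [hy.1, hy.2]
  have hr2 : ∀ y ∈ Set.Ioc 0 u, |x - u + y| < 2 * u := fun y hy => by
    rw [abs_lt]; constructor <;> linarith [hy.1, hy.2]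
  have b1 := avg_eq_mul hback hr1
  have b2 := avg_eq_mul hback hr2
  have f1 := norm_avg_sub_mul_le (κ := 1) (a := 0) (b := η) hf.measurable hf1 hu hη0 hC'
    norm_one hforw hr1 (fun y hy hy' => by
      rw [if_neg]
      rw [Set.mem_Icc, not_and, not_le] at hy'
      have := hy' hy.1.le
      linarith)
  have f2 := norm_avg_sub_mul_le (κ := ω) (a := u - η) (b := u) hf.measurable hf1 hu
    (by linarith) hC' hω1 hforw hr2 (fun y hy hy' => by
      rw [if_pos]
      rw [Set.mem_Icc, not_and_or, not_le, not_le] at hy'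
      rcases hy' with hy' | hy'
      · linarith
      · linarith [hy.2])
  intro z z'
  have hz1 : avg u f z = C * avg u f x := by rw [← b1, add_comm]
  have hz2 : dif u f z = C * (avg u f x - avg u f (x - u : ℝ)) := by
    rw [dif, hz1, mul_sub, ← b2, AddCircle.coe_sub]
    congr 2; show (x : UnitAddCircle) + _ - _ = _; abel
  -- The offset `|x| ≤ η` misplaces the jump on a piece of length at most `η` of each arc; the
  -- constant `1 / 16` in `η` makes this error `‖ω - 1‖ / 8` for each of the two averages.
  have hq : (2 * (η - 0) / u) = ‖ω - 1‖ / 8 := by rw [hη]; field_simp; ring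
  have hq2 : (2 * (u - (u - η)) / u) = ‖ω - 1‖ / 8 := by rw [hη]; field_simp; ring
  rw [hq] at f1
  rw [hq2] at f2
  rw [mul_one] at f1
  have e1 : ((i + 1 : ℕ) : ℤ) • A + (x : UnitAddCircle) = z' := add_comm _ _
  have e2 : ((i + 1 : ℕ) : ℤ) • A + ((x - u : ℝ) : UnitAddCircle) = z' - u := by
    rw [AddCircle.coe_sub]; show _ = (x : UnitAddCircle) + _ - _; abel
  rw [e1] at f1
  rw [e2] at f2
  set P := avg u f x
  set Q := avg u f (x - u : ℝ)
  have g1 : ‖avg u f z‖ = ‖P‖ := by rw [hz1, norm_mul, hC, one_mul]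
  have g2 : ‖dif u f z‖ = ‖P - Q‖ := by rw [hz2, norm_mul, hC, one_mul]
  have g3 : ‖P - ω * Q‖ ≤ ‖dif u f z'‖ + ‖ω - 1‖ / 4 := by
    have h1 : ‖C' * (P - ω * Q)‖ = ‖P - ω * Q‖ := by rw [norm_mul, hC', one_mul]
    rw [← h1, dif, show C' * (P - ω * Q) = (avg u f z' - avg u f (z' - u)) -
      (avg u f z' - C' * P) + (avg u f (z' - u) - C' * ω * Q) by ring]
    have := norm_add_le ((avg u f z' - avg u f (z' - u)) - (avg u f z' - C' * P))
      (avg u f (z' - u) - C' * ω * Q)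
    have := norm_sub_le (avg u f z' - avg u f (z' - u)) (avg u f z' - C' * P)
    linarith
  have g4 : ‖avg u f z'‖ ≤ ‖P‖ + ‖ω - 1‖ / 8 := by
    have := norm_add_le (avg u f z' - C' * P) (C' * P)
    rw [sub_add_cancel, norm_mul, hC', one_mul] at this
    linarith
  -- The contradiction in quantitative form: `P` close both to `Q` and to `ω * Q` forces `P` to be
  -- small, whereas averages of a unimodular function are mostly of modulus near `1`.
  have g5 : ‖ω - 1‖ * ‖P‖ ≤ ‖P - Q‖ + ‖P - ω * Q‖ := by
    rw [← norm_mul, show (ω - 1) * P = ω * (P - Q) - (P - ω * Q) by ring]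
    refine (norm_sub_le _ _).trans ?_
    rw [norm_mul, hω1, one_mul]
  have g6 : ‖P‖ ≤ 1 := norm_avg_le hu hf1 _
  have g7 : ‖ω - 1‖ * (1 - ‖P‖) ≤ 2 * (1 - ‖P‖) :=
    mul_le_mul_of_nonneg_right hω2 (by linarith)
  constructor
  · rw [g1, g2]; linarith [norm_nonneg (ω - 1)]
  · rw [g2]; linarith [norm_nonneg (ω - 1)]

/-- The balls of radius `η` about the points `j • A` are disjoint by the separation hypothesis. -/
theorem sum_setIntegral_le {G : UnitAddCircle → ℝ} (hG : Integrable G) (hG0 : ∀ x, 0 ≤ G x)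
    {η : ℝ} (J : Finset ℤ) (hJ : ∀ i ∈ J, ∀ j ∈ J, i ≠ j → 2 * η < ‖(i - j) • A‖) :
    ∑ j ∈ J, ∫ w in Metric.closedBall (0 : UnitAddCircle) η, G (w + j • A) ≤ ∫ w, G w := by
  have h1 : ∀ j ∈ J, ∫ w in Metric.closedBall (0 : UnitAddCircle) η, G (w + j • A) =
      ∫ w in Metric.closedBall (j • A) η, G w := by
    intro j _
    rw [← (measurePreserving_add_right volume (j • A)).setIntegral_preimage_emb
      (measurableEmbedding_addRight _) G]
    congr 2
    ext w; simp [dist_eq_norm]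
  rw [Finset.sum_congr rfl h1, ← integral_biUnion_finset J
    (fun j _ => measurableSet_closedBall) ?_ (fun j _ => hG.integrableOn)]
  · exact setIntegral_le_integral hG (ae_of_all _ hG0)
  · intro i hi j hj hij
    refine Metric.closedBall_disjoint_closedBall ?_
    rw [dist_eq_norm, ← sub_smul, ← two_mul]
    exact hJ i hi j hj hij

/-- Integrate the pointwise bound over the ball for all `K₁ * K₂` pairs: each backward ball is
counted `K₂` times, each forward ball `K₁` times, and balls within one family are disjoint. -/
theorem mul_le_of_pairing {F G : UnitAddCircle → ℝ} (hF : Integrable F) (hG : Integrable G)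
    (hF0 : ∀ x, 0 ≤ F x) (hG0 : ∀ x, 0 ≤ G x) {η c : ℝ} (hη : 0 ≤ η) (hη1 : 2 * η ≤ 1) {K₁ K₂ : ℕ}
    (h0 : ∀ l : ℤ, |l| < max K₁ K₂ → l ≠ 0 → 2 * η < ‖l • A‖)
    (h : ∀ j < K₁, ∀ i < K₂, ∀ w : UnitAddCircle, ‖w‖ ≤ η →
      c ≤ F (w + (-(j : ℤ)) • A) + G (w + ((i + 1 : ℕ) : ℤ) • A)) :
    K₁ * K₂ * (2 * η * c) ≤ K₂ * (∫ x, F x) + K₁ * ∫ x, G x := by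
  set B := Metric.closedBall (0 : UnitAddCircle) η
  have hvol : (volume : Measure UnitAddCircle).real B = 2 * η := by
    rw [Measure.real, AddCircle.volume_closedBall, min_eq_right hη1, ENNReal.toReal_ofReal]
    linarith
  have hF' : ∀ z, Integrable (fun w => F (w + z)) (volume.restrict B) := fun z =>
    ((measurePreserving_add_right volume z).integrable_comp_of_integrable hF).integrableOn
  have hG' : ∀ z, Integrable (fun w => G (w + z)) (volume.restrict B) := fun z =>
    ((measurePreserving_add_right volume z).integrable_comp_of_integrable hG).integrableOn
  have h1 : ∀ j < K₁, ∀ i < K₂, 2 * η * c ≤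
      (∫ w in B, F (w + (-(j : ℤ)) • A)) + ∫ w in B, G (w + ((i + 1 : ℕ) : ℤ) • A) := by
    intro j hj i hi
    rw [← integral_add (hF' _) (hG' _)]
    have : ∫ w in B, c = 2 * η * c := by rw [setIntegral_const, hvol, smul_eq_mul]
    rw [← this]
    refine setIntegral_mono_on (by simp) ((hF' _).add (hG' _)) measurableSet_closedBall ?_
    intro w hw
    exact h j hj i hi w (by simpa [B] using hw)
  have h2 : ∑ j ∈ Finset.range K₁, ∫ w in B, F (w + (-(j : ℤ)) • A) ≤ ∫ x, F x := by
    have := sum_setIntegral_le (A := A) hF hF0 (η := η) ((Finset.range K₁).image fun j : ℕ => -(j : ℤ)) (by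
      intro i hi j hj hij
      simp only [Finset.mem_image, Finset.mem_range] at hi hj
      obtain ⟨i, hi, rfl⟩ := hi
      obtain ⟨j, hj, rfl⟩ := hj
      refine h0 _ ?_ (by omega)
      rw [abs_lt]; omega)
    rwa [Finset.sum_image (by intro i _ j _ hij; simpa using hij)] at this
  have h3 : ∑ i ∈ Finset.range K₂, ∫ w in B, G (w + ((i + 1 : ℕ) : ℤ) • A) ≤ ∫ x, G x := by
    have := sum_setIntegral_le (A := A) hG hG0 (η := η)
      ((Finset.range K₂).image fun i : ℕ => ((i + 1 : ℕ) : ℤ)) (by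
      intro i hi j hj hij
      simp only [Finset.mem_image, Finset.mem_range] at hi hj
      obtain ⟨i, hi, rfl⟩ := hi
      obtain ⟨j, hj, rfl⟩ := hj
      refine h0 _ ?_ (by omega)
      rw [abs_lt]; omega)
    rwa [Finset.sum_image (by intro i _ j _ hij; simpa using hij)] at this
  have h4 : ∑ j ∈ Finset.range K₁, ∑ i ∈ Finset.range K₂, 2 * η * c ≤
      ∑ j ∈ Finset.range K₁, ∑ i ∈ Finset.range K₂, ((∫ w in B, F (w + (-(j : ℤ)) • A)) +
        ∫ w in B, G (w + ((i + 1 : ℕ) : ℤ) • A)) :=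
    Finset.sum_le_sum fun j hj => Finset.sum_le_sum fun i hi =>
      h1 j (Finset.mem_range.1 hj) i (Finset.mem_range.1 hi)
  simp only [Finset.sum_add_distrib, Finset.sum_const, Finset.card_range, nsmul_eq_mul,
    ← Finset.mul_sum] at h4
  have h5 := mul_le_mul_of_nonneg_left h2 (Nat.cast_nonneg (α := ℝ) K₂)
  have h6 := mul_le_mul_of_nonneg_left h3 (Nat.cast_nonneg (α := ℝ) K₁)
  linarith

end IrrationalRotation

/-! ### Energy estimates and the multiples of `α` approximating `β`. -/

namespace IrrationalRotation

open Filter Topology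

/-- The total square variation of `f` at scale `u`. -/
noncomputable def difEnergy (u : ℝ) (f : UnitAddCircle → ℂ) : ℝ := ∫ x, ‖dif u f x‖ ^ 2

/-- The defect of `f` from being unimodular and constant at scale `u`. -/
noncomputable def defect (u : ℝ) (f : UnitAddCircle → ℂ) : ℝ :=
  ∫ x, (‖dif u f x‖ + 2 * (1 - ‖avg u f x‖)) ^ 2

theorem integrable_defect {f : UnitAddCircle → ℂ} (hf : Measurable f) (hf1 : ∀ x, ‖f x‖ ≤ 1)
    {u : ℝ} (hu : 0 < u) :
    Integrable fun x => (‖dif u f x‖ + 2 * (1 - ‖avg u f x‖)) ^ 2 := by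
  refine Integrable.of_bound (C := 16) ?_ (ae_of_all _ fun x => ?_)
  · have h1 := (measurable_dif hf u).norm
    have h2 := (measurable_avg hf u).norm
    exact ((h1.add ((h2.const_sub 1).const_mul 2)).pow_const 2).aestronglyMeasurable
  · rw [Real.norm_of_nonneg (by positivity)]
    have h1 := norm_dif_le hu hf1 x
    have h2 := norm_avg_le hu hf1 x
    have h3 := norm_nonneg (dif u f x)
    have h4 := norm_nonneg (avg u f x)
    nlinarith

theorem difEnergy_nonneg (u : ℝ) (f : UnitAddCircle → ℂ) : 0 ≤ difEnergy u f :=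
  integral_nonneg fun _ => by positivity

theorem defect_nonneg (u : ℝ) (f : UnitAddCircle → ℂ) : 0 ≤ defect u f :=
  integral_nonneg fun _ => by positivity

theorem defect_le {f : UnitAddCircle → ℂ} (hf : Measurable f) (hf1 : ∀ x, ‖f x‖ = 1)
    {u : ℝ} (hu : 0 < u) :
    defect u f ≤ 2 * difEnergy u f + 8 * ∫ x, ‖f x - avg u f x‖ ^ 2 := by
  have hf1' : ∀ x, ‖f x‖ ≤ 1 := fun x => (hf1 x).le
  have hm : Measurable fun x => f x - avg u f x := hf.sub (measurable_avg hf u)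
  have i1 := integrable_norm_sq (measurable_dif hf u) (norm_dif_le hu hf1')
  have i2 := integrable_norm_sq (C := 2) hm (fun x => (norm_sub_le _ _).trans
    (by linarith [hf1' x, norm_avg_le hu hf1' x]))
  rw [defect, difEnergy, ← integral_const_mul, ← integral_const_mul,
    ← integral_add (i1.const_mul 2) (i2.const_mul 8)]
  refine integral_mono (integrable_defect hf hf1' hu) ((i1.const_mul 2).add (i2.const_mul 8)) ?_
  intro x
  have h1 : 1 - ‖avg u f x‖ ≤ ‖f x - avg u f x‖ := by
    have := norm_sub_norm_le (f x) (avg u f x)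
    rwa [hf1 x] at this
  have h2 : 0 ≤ 1 - ‖avg u f x‖ := by linarith [norm_avg_le hu hf1' x]
  have h3 := norm_nonneg (dif u f x)
  have h4 : (1 - ‖avg u f x‖) ^ 2 ≤ ‖f x - avg u f x‖ ^ 2 := pow_le_pow_left₀ h2 h1 2
  show _ ≤ 2 * ‖dif u f x‖ ^ 2 + 8 * ‖f x - avg u f x‖ ^ 2
  nlinarith [sq_nonneg (‖dif u f x‖ - 2 * (1 - ‖avg u f x‖))]

variable {A β t : UnitAddCircle} {s : ℝ} {f : UnitAddCircle → ℂ}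

/-- The defect only tends to `0`, whereas the energy is summable. Since the modulus of the average
may be tested on either side of the jump, the defect can be placed on whichever side carries the
smaller weight when `K₁` and `K₂` differ. -/
theorem IsTransfer.window_le (hf : IsTransfer A β t s f) {u : ℝ} (hu : 0 < u)
    (hu1 : 2 * u ≤ 1) {K₁ K₂ : ℕ}
    (h0 : ∀ l : ℤ, |l| < max K₁ K₂ → l ≠ 0 → 2 * u ≤ ‖l • A‖)
    (hβ : ∀ l : ℤ, -K₁ < l → l < K₂ → 2 * u ≤ ‖l • A - β‖) :
    K₁ * K₂ * (u * ‖e (s : UnitAddCircle) - 1‖ ^ 3 / 64) ≤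
      K₂ * defect u f + K₁ * difEnergy u f ∧
    K₁ * K₂ * (u * ‖e (s : UnitAddCircle) - 1‖ ^ 3 / 64) ≤
      K₂ * difEnergy u f + K₁ * defect u f := by
  set δ := ‖e (s : UnitAddCircle) - 1‖ with hδ
  have hδ0 : 0 ≤ δ := norm_nonneg _
  have hδ2 : δ ≤ 2 := norm_e_sub_one_le_two _
  have hf1 : ∀ x, ‖f x‖ ≤ 1 := fun x => (hf.norm_eq x).le
  set η := u * δ / 16 with hη
  have hη0 : 0 ≤ η := by positivity
  have hηu : η ≤ u / 8 := by rw [hη]; nlinarith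
  have key := fun j hj i hi w hw => hf.le_norm_dif_add_norm_dif (K₁ := K₁) (K₂ := K₂) hu hu1 hη
    (fun l h1 h2 h3 => h0 l (by rw [abs_lt]; omega) h3) hβ (j := j) (i := i) hj hi (w := w) hw
  have hsq : ∀ x y : ℝ, 0 ≤ x → 0 ≤ y → δ / 2 ≤ x + y → δ ^ 2 / 8 ≤ x ^ 2 + y ^ 2 := by
    intro x y hx hy h
    nlinarith [sq_nonneg (x - y), mul_self_le_mul_self (by positivity) h]
  have hval : u * δ ^ 3 / 64 = 2 * η * (δ ^ 2 / 8) := by rw [hη]; ring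
  have h0' : ∀ l : ℤ, |l| < max K₁ K₂ → l ≠ 0 → 2 * η < ‖l • A‖ := fun l h1 h2 => by
    have := h0 l h1 h2; linarith
  have iD := integrable_norm_sq (measurable_dif hf.measurable u) (norm_dif_le hu hf1)
  have iE := integrable_defect hf.measurable hf1 hu
  have hE : ∀ x, 0 ≤ ‖dif u f x‖ + 2 * (1 - ‖avg u f x‖) := fun x => by
    linarith [norm_avg_le hu hf1 x, norm_nonneg (dif u f x)]
  rw [hval]
  constructor
  · refine mul_le_of_pairing iE iD (fun _ => by positivity) (fun _ => by positivity) hη0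
      (by linarith) h0' fun j hj i hi w hw => ?_
    refine hsq _ _ (hE _) (norm_nonneg _) ?_
    have := (key j hj i hi w hw).1
    linarith
  · refine mul_le_of_pairing iD iE (fun _ => by positivity) (fun _ => by positivity) hη0
      (by linarith) h0' fun j hj i hi w hw => ?_
    refine hsq _ _ (norm_nonneg _) (hE _) ?_
    have := (key j hj i hi w hw).2
    linarith

section Convergents

variable {α : ℝ} {a q : ℕ → ℕ} {p : ℕ → ℤ}

theorem ConvergentData.tendsto_div_q (h : ConvergentData α a q p) (ρ : ℝ) :
    Tendsto (fun n => ρ / q n) atTop (𝓝 0) :=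
  tendsto_const_nhds.div_atTop h.tendsto_q

/-- The Littlewood-Paley bound at scales `ρ / q n`, which at least halve every two steps. -/
theorem IsTransfer.summable_difEnergy (hf : IsTransfer A β t s f) (h : ConvergentData α a q p)
    {ρ : ℝ} (hρ : 0 < ρ) : Summable fun n => difEnergy (ρ / q n) f := by
  refine summable_integral_dif hf.measurable (fun x => (hf.norm_eq x).le)
    (fun n => div_pos hρ (h.q_pos' n)) fun n => ?_
  have h1 := h.q_pos' n
  have h2 : (2 * q n : ℝ) ≤ q (n + 2) := by exact_mod_cast h.two_mul_q_le n
  rw [← mul_div_assoc, div_le_div_iff₀ (h.q_pos' _) h1]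
  nlinarith

theorem IsTransfer.tendsto_defect (hf : IsTransfer A β t s f) (h : ConvergentData α a q p)
    {ρ : ℝ} (hρ : 0 < ρ) : Tendsto (fun n => defect (ρ / q n) f) atTop (𝓝 0) := by
  have hu : ∀ n, 0 < ρ / (q n : ℝ) := fun n => div_pos hρ (h.q_pos' n)
  refine squeeze_zero (fun n => defect_nonneg _ _)
    (fun n => defect_le hf.measurable hf.norm_eq (hu n)) ?_
  have h1 := (hf.summable_difEnergy h hρ).tendsto_atTop_zero
  have h2 := tendsto_integral_sub_avg hf.measurable (fun x => (hf.norm_eq x).le) hu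
    (h.tendsto_div_q ρ)
  simpa using (h1.const_mul 2).add (h2.const_mul 8)

/-- If no such multiple exists, a symmetric window of length about `ε * q n` is free of `β`. Its
lower bound `K * u * δ ^ 3 / 64` is then bounded below independently of `n`, while defect and energy
tend to `0`. -/
theorem IsTransfer.eventually_exists_zsmul (hf : IsTransfer (α : UnitAddCircle) β t s f)
    (h : ConvergentData α a q p) (hs : ∀ m : ℤ, s ≠ m) {ε : ℝ} (hε : 0 < ε) :
    ∀ᶠ n in atTop, ∃ l : ℤ, |(l : ℝ)| ≤ ε * q n ∧ ‖l • (α : UnitAddCircle) - β‖ ≤ ε / q n := by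
  wlog hε1 : ε ≤ 1 / 4 generalizing ε
  · filter_upwards [this (ε := 1 / 4) (by norm_num) le_rfl] with n ⟨l, h1, h2⟩
    have := h.q_pos' n
    have hε2 : 1 / 4 ≤ ε := by linarith
    exact ⟨l, h1.trans (by gcongr), h2.trans (by gcongr)⟩
  set δ := ‖e (s : UnitAddCircle) - 1‖ with hδ
  have hδ0 : 0 < δ := norm_pos_iff.2 (sub_ne_zero.2 (e_coe_ne_one hs))
  have h1 := (hf.summable_difEnergy h (half_pos hε)).tendsto_atTop_zero
  have h2 := hf.tendsto_defect h (half_pos hε)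
  have h3 := h2.add h1
  rw [add_zero] at h3
  filter_upwards [h3.eventually (gt_mem_nhds (show 0 < ε ^ 2 / 4 * (δ ^ 3 / 64) by positivity)),
    h.tendsto_q.eventually_ge_atTop (2 / ε)] with n hn hq
  by_contra hcon
  push Not at hcon
  have hqn := h.q_pos' n
  set K := ⌊ε * q n⌋₊
  have hK1 : (K : ℝ) ≤ ε * q n := Nat.floor_le (by positivity)
  have hK2 : ε * q n < K + 1 := Nat.lt_floor_add_one _
  have hq2 : 2 ≤ ε * q n := by rwa [div_le_iff₀' hε] at hq
  have hKq : ∀ l : ℤ, |l| < K → |(l : ℝ)| ≤ ε * q n := fun l hl => by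
    have : |(l : ℝ)| < K := by exact_mod_cast hl
    linarith
  have hw := (hf.window_le (u := ε / 2 / q n) (by positivity) (by
      have : (1 : ℝ) ≤ q n := by exact_mod_cast h.q_pos n
      rw [← mul_div_assoc, div_le_one hqn]; linarith) (K₁ := K) (K₂ := K)
    (fun l hl hl0 => by
      refine le_trans ?_ (h.one_div_le_norm_zsmul n l hl0 ?_)
      · rw [← mul_div_assoc, div_le_div_iff₀ hqn (by positivity)]; nlinarith
      · have := hKq l (by simpa using hl)
        have h6 : 2 * |(l : ℝ)| ≤ q n := by nlinarith
        exact_mod_cast h6)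
    (fun l hl1 hl2 => by
      have := hcon l (hKq l (by rw [abs_lt]; exact ⟨hl1, hl2⟩))
      rw [← mul_div_assoc, mul_div_cancel₀ _ (two_ne_zero)]
      exact this.le)).1
  rw [← hδ] at hw
  have hKpos : (0 : ℝ) < K := by linarith
  have h5 : (K : ℝ) * (ε / 2 / q n * δ ^ 3 / 64) ≤
      defect (ε / 2 / q n) f + difEnergy (ε / 2 / q n) f := by
    have : (K : ℝ) * (K * (ε / 2 / q n * δ ^ 3 / 64)) ≤
        K * (defect (ε / 2 / q n) f + difEnergy (ε / 2 / q n) f) := by linarith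
    exact le_of_mul_le_mul_left this hKpos
  have h6 : ε ^ 2 / 4 * (δ ^ 3 / 64) ≤ (K : ℝ) * (ε / 2 / q n * δ ^ 3 / 64) := by
    have h7 : ε * q n / 2 ≤ K := by linarith
    calc ε ^ 2 / 4 * (δ ^ 3 / 64) = ε * q n / 2 * (ε / 2 / q n * δ ^ 3 / 64) := by
          field_simp; ring
      _ ≤ _ := by gcongr
  linarith

/-- The integers `k n` such that `k n • α` approximates `β` at scale `1 / q n`. -/
theorem IsTransfer.exists_approx (hf : IsTransfer (α : UnitAddCircle) β t s f)
    (h : ConvergentData α a q p) (hs : ∀ m : ℤ, s ≠ m) :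
    ∃ k : ℕ → ℤ, ∀ ε > 0, ∀ᶠ n in atTop,
      |(k n : ℝ)| ≤ ε * q n ∧ ‖k n • (α : UnitAddCircle) - β‖ ≤ ε / q n := by
  classical
  let P : ℕ → ℝ → ℤ → Prop := fun n ε l =>
    |(l : ℝ)| ≤ ε * q n ∧ ‖l • (α : UnitAddCircle) - β‖ ≤ ε / q n
  have hP : ∀ n ε ε' l, ε ≤ ε' → P n ε l → P n ε' l := fun n ε ε' l hε hl => by
    have := h.q_pos' n
    exact ⟨hl.1.trans (by gcongr), hl.2.trans (by gcongr)⟩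
  refine ⟨fun n => if hn : ∃ l, P n (1 / 8) l then hn.choose else 0, fun ε hε => ?_⟩
  filter_upwards [hf.eventually_exists_zsmul h hs (lt_min hε (show (0 : ℝ) < 1 / 8 by norm_num))]
    with n ⟨l, hl⟩
  have h8 : P n (1 / 8) l := hP _ _ _ _ (min_le_right _ _) hl
  have hn : ∃ l, P n (1 / 8) l := ⟨l, h8⟩
  rw [dif_pos hn]
  have hc := hn.choose_spec
  set k := hn.choose
  have hqn := h.q_pos' n
  -- The fixed tolerance `1 / 8` already determines the multiple: two candidates would differ by a
  -- nonzero integer of size at most `q n / 4` whose multiple of `α` has norm at most `1 / (4 * q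
  -- n)`. Hence one choice serves every `ε`.
  have : k = l := by
    by_contra hne
    have h1 := h.one_div_le_norm_zsmul n (k - l) (sub_ne_zero.2 hne) (by
      have h2 : 2 * |((k - l : ℤ) : ℝ)| ≤ q n := by
        push_cast
        have := abs_sub (k : ℝ) l
        linarith [hc.1, h8.1]
      exact_mod_cast h2)
    have h3 : (k - l) • (α : UnitAddCircle) = k • (α : UnitAddCircle) - β - (l • ↑α - β) := by
      rw [sub_smul]; abel
    rw [h3] at h1
    have h4 := norm_sub_le (k • (α : UnitAddCircle) - β) (l • ↑α - β)
    have h5 : 1 / (2 * q n : ℝ) ≤ 1 / 8 / q n + 1 / 8 / q n := by linarith [hc.2, h8.2]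
    rw [← add_div, div_le_div_iff₀ (by positivity) hqn] at h5
    nlinarith
  rw [this]
  exact hP _ _ _ _ (min_le_left _ _) hl

/-- A window extending about `q n / 8` on one side of `0` and `|k n|` on the other stops just before
the jump at `β`. It yields `|k n| * u = O(difEnergy u f)`, which is `|k n| / q n` up to a constant,
and the energies are summable. -/
theorem IsTransfer.summable_approx (hf : IsTransfer (α : UnitAddCircle) β t s f)
    (h : ConvergentData α a q p) (hs : ∀ m : ℤ, s ≠ m) {k : ℕ → ℤ}
    (hk : ∀ ε > 0, ∀ᶠ n in atTop,
      |(k n : ℝ)| ≤ ε * q n ∧ ‖k n • (α : UnitAddCircle) - β‖ ≤ ε / q n) :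
    Summable fun n => |(k n : ℝ)| / q n := by
  set δ := ‖e (s : UnitAddCircle) - 1‖ with hδ
  have hδ0 : 0 < δ := norm_pos_iff.2 (sub_ne_zero.2 (e_coe_ne_one hs))
  have hρ : (0 : ℝ) < 1 / 16 := by norm_num
  have hsum := (hf.summable_difEnergy h hρ).mul_left (16 * 128 / δ ^ 3)
  refine hsum.of_norm_bounded_eventually_nat ?_
  filter_upwards [hk (1 / 8) (by norm_num), (hf.tendsto_defect h hρ).eventually
    (gt_mem_nhds (show 0 < 1 / 256 * (δ ^ 3 / 128) by positivity)),
    h.tendsto_q.eventually_ge_atTop 16] with n ⟨hk1, hk2⟩ hE hq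
  have hqn := h.q_pos' n
  rw [Real.norm_of_nonneg (by positivity)]
  set u : ℝ := 1 / 16 / q n with hu
  have hu0 : 0 < u := by positivity
  have hu1 : 2 * u ≤ 1 := by
    rw [hu, ← mul_div_assoc, div_le_one hqn]; linarith
  set K₀ := ⌊(q n : ℝ) / 8⌋₊
  have hK1 : (K₀ : ℝ) ≤ q n / 8 := Nat.floor_le (by positivity)
  have hK2 : (q n : ℝ) / 8 < K₀ + 1 := Nat.lt_floor_add_one _
  have hK3 : (q n : ℝ) / 16 ≤ K₀ := by linarith
  have hK0 : (0 : ℝ) < K₀ := by linarith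
  have hm : ((k n).natAbs : ℝ) = |(k n : ℝ)| := by rw [Nat.cast_natAbs]; simp
  set m := (k n).natAbs with hmdef
  rw [← hm] at hk1 ⊢
  have hmq : 8 * m ≤ q n := by
    have : (8 * m : ℝ) ≤ q n := by linarith
    exact_mod_cast this
  have hKq : 8 * K₀ ≤ q n := by
    have : (8 * K₀ : ℝ) ≤ q n := by linarith
    exact_mod_cast this
  have h0 : ∀ l : ℤ, 4 * |l| ≤ q n → l ≠ 0 → 2 * u ≤ ‖l • (α : UnitAddCircle)‖ := by
    intro l hl hl0
    refine le_trans ?_ (h.one_div_le_norm_zsmul n l hl0 (by linarith [abs_nonneg l]))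
    rw [hu, ← mul_div_assoc, div_le_div_iff₀ hqn (by positivity)]; linarith
  have hβ : ∀ l : ℤ, 8 * |l| ≤ q n → l ≠ k n → 2 * u ≤ ‖l • (α : UnitAddCircle) - β‖ := by
    intro l hl hlk
    have h1 := h.one_div_le_norm_zsmul n (l - k n) (sub_ne_zero.2 hlk) (by
      have := abs_sub l (k n)
      have : |k n| = m := by rw [hmdef]; simp
      omega)
    have h3 : (l - k n) • (α : UnitAddCircle) = l • (α : UnitAddCircle) - β - (k n • ↑α - β) := by
      rw [sub_smul]; abel
    rw [h3] at h1
    have h4 := norm_sub_le (l • (α : UnitAddCircle) - β) (k n • ↑α - β)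
    have h5 : 1 / (2 * q n : ℝ) = 8 * u := by rw [hu]; field_simp; norm_num
    have h6 : 1 / 8 / (q n : ℝ) = 2 * u := by rw [hu]; field_simp; norm_num
    linarith
  have hmain : (m : ℝ) * (u * δ ^ 3 / 128) ≤ difEnergy u f := by
    -- For large `n` the defect absorbs at most half of the lower bound, which explains `128` in
    -- place of `64`.
    have hEK : defect u f ≤ K₀ * (u * δ ^ 3 / 128) := by
      refine hE.le.trans ?_
      calc 1 / 256 * (δ ^ 3 / 128) = q n / 16 * (u * δ ^ 3 / 128) := by rw [hu]; field_simp; norm_num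
        _ ≤ _ := by gcongr
    have hmE : (m : ℝ) * defect u f ≤ m * (K₀ * (u * δ ^ 3 / 128)) := by gcongr
    have hfin : ∀ D : ℝ, (K₀ * m * (u * δ ^ 3 / 64) ≤ m * defect u f + K₀ * D) →
        m * (u * δ ^ 3 / 128) ≤ D := fun D hD => by
      have : K₀ * (m * (u * δ ^ 3 / 128)) ≤ K₀ * D := by linarith
      exact le_of_mul_le_mul_left this hK0
    refine hfin _ ?_
    -- The sign of `k n` tells on which side of `0` the orbit meets `β`, hence which side of the
    -- window must be cut at length `m`.
    rcases le_total 0 (k n) with hpos | hneg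
    · refine (hf.window_le hu0 hu1 (K₁ := K₀) (K₂ := m) (fun l hl hl0 => h0 l (by omega) hl0)
        (fun l h1 h2 => hβ l ?_ (by omega))).1
      rcases abs_cases l with ⟨h, _⟩ | ⟨h, _⟩ <;> omega
    · have := (hf.window_le hu0 hu1 (K₁ := m) (K₂ := K₀) (fun l hl hl0 => h0 l (by omega) hl0)
        (fun l h1 h2 => hβ l (by rcases abs_cases l with ⟨h, _⟩ | ⟨h, _⟩ <;> omega) (by omega))).2
      rw [← hδ] at this
      linarith
  have h7 : (m : ℝ) / q n = 16 * 128 / δ ^ 3 * (m * (u * δ ^ 3 / 128)) := by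
    rw [hu]; field_simp
  rw [h7]
  gcongr

end Convergents

end IrrationalRotation

/-! ### Translation by `q n • α` and its phase. -/

namespace IrrationalRotation

open Filter Topology

variable {A β t : UnitAddCircle} {s : ℝ} {f : UnitAddCircle → ℂ}

theorem IsTransfer.ae_iterate (hf : IsTransfer A β t s f) (q : ℕ) :
    ∀ᵐ z, f (z + q • A) = e (q • t - ((s * ∑ j ∈ Finset.range q,
      (frac (z + j • A - β) - frac (z + j • A)) : ℝ) : UnitAddCircle)) * f z := by
  induction q with
  | zero => simp [e_zero]
  | succ q ih =>
    filter_upwards [ih, ae_add hf.ae_eq (q • A)] with z h1 h2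
    rw [succ_nsmul, ← add_assoc, h2, h1, ← mul_assoc, ← e_add, Finset.sum_range_succ, succ_nsmul]
    congr 2
    rw [mul_add, AddCircle.coe_add]; abel

/-- Replacing `β` by `k • A` costs `-γ` per term. What remains telescopes to `Psi A k z - Psi A k (z
+ D)`, which is `-k * D` because no jump is crossed. -/
theorem sum_frac_sub {k : ℤ} {γ D : ℝ} (hβ : β = k • A + (γ : UnitAddCircle)) {q : ℕ}
    (hD : q • A = (D : UnitAddCircle)) {z : UnitAddCircle}
    (h1 : ∀ j < q, |γ| < ‖z - (k - (j : ℤ)) • A‖)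
    (h2 : ∀ j ∈ Finset.Ioc (min 0 k) (max 0 k), |D| < ‖z - j • A‖) :
    ∑ j ∈ Finset.range q, (frac (z + j • A - β) - frac (z + j • A)) = -(q * γ + k * D) := by
  have h3 : ∀ j ∈ Finset.range q, frac (z + j • A - β) - frac (z + j • A) =
      -γ + (Psi A k (z + j • A) - Psi A k (z + (j + 1) • A)) := by
    intro j hj
    have h4 := Psi_sub_comp_add A k (z + j • A)
    rw [add_assoc, ← succ_nsmul] at h4
    rw [h4]
    have h5 : z + j • A - k • A = z - (k - (j : ℤ)) • A := by
      rw [sub_smul, natCast_zsmul]; abel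
    have h6 : frac (z + j • A - k • A + ((-γ : ℝ) : UnitAddCircle)) =
        frac (z + j • A - k • A) + -γ := by
      refine frac_add ?_
      rw [abs_neg, h5]; exact h1 j (Finset.mem_range.1 hj)
    have h7 : z + j • A - β = z + j • A - k • A + ((-γ : ℝ) : UnitAddCircle) := by
      rw [hβ, AddCircle.coe_neg]; abel
    rw [h7, h6]; ring
  rw [Finset.sum_congr rfl h3, Finset.sum_add_distrib, Finset.sum_range_sub', hD, zero_smul,
    add_zero, Psi_add_coe h2]
  simp; ring

/-- The phase by which `f` is multiplied under a translation by `q • A`, away from the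
discontinuities. -/
noncomputable def phase (t : UnitAddCircle) (s : ℝ) (q : ℕ) (k : ℤ) (γ D : ℝ) : UnitAddCircle :=
  q • t + ((s * (q * γ + k * D) : ℝ) : UnitAddCircle)

theorem IsTransfer.avg_avg_add (hf : IsTransfer A β t s f) {k : ℤ} {γ D : ℝ}
    (hβ : β = k • A + (γ : UnitAddCircle)) {q : ℕ} (hD : q • A = (D : UnitAddCircle))
    {u : ℝ} (hu : 0 < u) {x : UnitAddCircle}
    (h1 : ∀ j < q, 2 * u + |γ| < ‖x - (k - (j : ℤ)) • A‖)
    (h2 : ∀ j ∈ Finset.Ioc (min 0 k) (max 0 k), 2 * u + |D| < ‖x - j • A‖) :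
    avg u (avg u f) (x + D) = e (phase t s q k γ D) * avg u (avg u f) x := by
  have key : ∀ᵐ v : ℝ, |v| ≤ 2 * u →
      f (x + D + v) = e (phase t s q k γ D) * f (x + v) := by
    filter_upwards [ae_coe (ae_add (hf.ae_iterate q) x)] with v hv hvu
    have hn : ∀ w : UnitAddCircle, ‖x - w‖ - 2 * u ≤ ‖v + x - w‖ := fun w => by
      have := norm_sub_norm_le (x - w) (-(v : UnitAddCircle))
      rw [norm_neg, sub_neg_eq_add, show x - w + v = v + x - w by abel] at this
      have := norm_coe_le v
      linarith
    rw [sum_frac_sub hβ hD (fun j hj => by linarith [h1 j hj, hn ((k - (j : ℤ)) • A)])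
      (fun j hj => by linarith [h2 j hj, hn (j • A)]), hD] at hv
    rw [show x + D + v = v + x + D by abel, hv, add_comm x]
    congr 2
    rw [phase, mul_neg, AddCircle.coe_neg, sub_neg_eq_add]
  have inner : ∀ y ∈ Set.Ioc 0 u, avg u f (x + D + (y : ℝ)) =
      e (phase t s q k γ D) * avg u f (x + (y : ℝ)) := by
    intro y hy
    rw [avg, avg, mul_smul_comm, ← integral_const_mul]
    congr 1
    refine setIntegral_congr_ae measurableSet_Ioc ?_
    filter_upwards [ae_add_real key y] with y' hy' hyu'
    have := hy' (by rw [abs_le]; constructor <;> linarith [hy.1, hy.2, hyu'.1, hyu'.2])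
    rwa [AddCircle.coe_add, ← add_assoc, ← add_assoc] at this
  rw [avg, avg, mul_smul_comm, ← integral_const_mul]
  congr 1
  exact setIntegral_congr_fun measurableSet_Ioc inner

/-- The double average `g` satisfies `g (x + D) = e θ * g x` outside a set of measure at most `1 /
4`, and keeps mass at least `1 / 2` there. Thus `‖e θ - 1‖ ^ 2 / 2` is at most the squared `L²`
distance of `g` to its translate by `D`, controlled by the energy. -/
theorem IsTransfer.sq_norm_phase_le (hf : IsTransfer A β t s f) {k : ℤ} {γ D : ℝ}
    (hβ : β = k • A + (γ : UnitAddCircle)) {q : ℕ} (hD : q • A = (D : UnitAddCircle))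
    {u : ℝ} (hu : 0 < u)
    (hbad : q * (2 * (2 * u + |γ|)) + |(k : ℝ)| * (2 * (2 * u + |D|)) ≤ 1 / 4)
    (hint : 3 / 4 ≤ ∫ x, ‖avg u (avg u f) x‖ ^ 2) :
    8 * ‖phase t s q k γ D‖ ^ 2 ≤ (|D| / u) ^ 2 * difEnergy u f := by
  have hf1 : ∀ x, ‖f x‖ ≤ 1 := fun x => (hf.norm_eq x).le
  set θ := phase t s q k γ D with hθ
  set g := avg u (avg u f) with hg
  have hgm : Measurable g := measurable_avg (measurable_avg hf.measurable u) u
  have hg1 : ∀ x, ‖g x‖ ≤ 1 := norm_avg_le hu (norm_avg_le hu hf1)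
  let J₁ := (Finset.range q).image fun j : ℕ => k - (j : ℤ)
  let J₂ := Finset.Ioc (min 0 k) (max 0 k)
  let B := nearOrbit A J₁ (2 * u + |γ|) ∪ nearOrbit A J₂ (2 * u + |D|)
  have hB : MeasurableSet B := (measurableSet_nearOrbit _ _ _).union (measurableSet_nearOrbit _ _ _)
  have hJ₁ : (J₁.card : ℝ) ≤ q := by
    have := Finset.card_image_le (s := Finset.range q) (f := fun j : ℕ => k - (j : ℤ))
    rw [Finset.card_range] at this
    exact_mod_cast this
  have hJ₂ : (J₂.card : ℝ) = |(k : ℝ)| := by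
    have h1 : (J₂.card : ℤ) = |k| := by
      simp only [J₂, Int.card_Ioc]
      rcases abs_cases k with ⟨h, _⟩ | ⟨h, _⟩ <;> omega
    exact_mod_cast h1
  have hvol : (volume : Measure UnitAddCircle).real B ≤ 1 / 4 := by
    have h1 : (volume : Measure UnitAddCircle) B ≤ ENNReal.ofReal (1 / 4) := by
      refine (measure_union_le _ _).trans ?_
      refine (add_le_add (volume_nearOrbit_le _ _ _) (volume_nearOrbit_le _ _ _)).trans ?_
      rw [← ENNReal.ofReal_add (by positivity) (by positivity)]
      refine ENNReal.ofReal_le_ofReal (le_trans ?_ hbad)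
      rw [hJ₂]
      gcongr
    exact ENNReal.toReal_le_of_le_ofReal (by norm_num) h1
  have hgood : ∀ x ∈ Bᶜ, g (x + D) = e θ * g x := by
    intro x hx
    simp only [B, Set.mem_compl_iff, Set.mem_union, not_or, nearOrbit, Set.mem_ofPred_eq,
      not_exists, not_and, not_le] at hx
    refine hf.avg_avg_add hβ hD hu (fun j hj => hx.1 _ ?_) hx.2
    exact Finset.mem_image_of_mem _ (Finset.mem_range.2 hj)
  have hgi : Integrable fun x => ‖g x‖ ^ 2 := integrable_norm_sq hgm hg1
  have h1 : 1 / 2 ≤ ∫ x in Bᶜ, ‖g x‖ ^ 2 := by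
    have h2 := integral_add_compl hB hgi
    have h3 : ∫ x in B, ‖g x‖ ^ 2 ≤ 1 / 4 := by
      have h4 : ∫ x in B, ‖g x‖ ^ 2 ≤ ∫ x in B, (1 : ℝ) := by
        refine setIntegral_mono hgi.integrableOn (by simp) fun x => ?_
        exact pow_le_one₀ (norm_nonneg _) (hg1 x)
      rw [setIntegral_const, smul_eq_mul, mul_one] at h4
      linarith
    linarith
  have hdi : Integrable fun x => ‖g (x + D) - g x‖ ^ 2 :=
    integrable_norm_sq (C := 2) ((hgm.comp (measurable_id.add_const _)).sub hgm)
      (fun x => (norm_sub_le _ _).trans (by linarith [hg1 x, hg1 (x + D)]))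
  have h5 : ‖e θ - 1‖ ^ 2 * ∫ x in Bᶜ, ‖g x‖ ^ 2 ≤ ∫ x, ‖g (x + D) - g x‖ ^ 2 := by
    rw [← integral_const_mul]
    refine le_trans (le_of_eq ?_) (setIntegral_le_integral (s := Bᶜ) hdi
      (ae_of_all _ fun x => by positivity))
    refine setIntegral_congr_fun hB.compl fun x hx => ?_
    rw [hgood x hx, ← mul_pow, ← norm_mul]
    congr 2; ring
  have h6 := integral_avg_avg_shift_le hf.measurable hf1 hu D
  have h7 := four_mul_norm_le θ
  have h8 : (4 * ‖θ‖) ^ 2 ≤ ‖e θ - 1‖ ^ 2 := pow_le_pow_left₀ (by positivity) h7 2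
  have h9 : (4 * ‖θ‖) ^ 2 * (1 / 2) ≤ ‖e θ - 1‖ ^ 2 * ∫ x in Bᶜ, ‖g x‖ ^ 2 := by gcongr
  have h10 := (h9.trans h5).trans h6
  rw [difEnergy]
  linarith

section Convergents

variable {α : ℝ} {a q : ℕ → ℕ} {p : ℕ → ℤ}

/-- The weight `a n` is affordable because `|q n * α - p n| ≤ 1 / q (n + 1) ≤ 1 / (a n * q n)`: the
displacement is smaller than the scale by a factor of order `a n`. -/
theorem IsTransfer.summable_phase (hf : IsTransfer (α : UnitAddCircle) β t s f)
    (h : ConvergentData α a q p) {k : ℕ → ℤ} {γ : ℕ → ℝ}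
    (hγ : ∀ n, β = k n • (α : UnitAddCircle) + (γ n : UnitAddCircle))
    (hk : ∀ ε > 0, ∀ᶠ n in atTop, |(k n : ℝ)| ≤ ε * q n ∧ |γ n| ≤ ε / q n) :
    Summable fun n => (a n * ‖phase t s (q n) (k n) (γ n) (q n * α - p n)‖) ^ 2 := by
  have hρ : (0 : ℝ) < 1 / 64 := by norm_num
  have hsum := (hf.summable_difEnergy h hρ).mul_left 512
  refine hsum.of_norm_bounded_eventually_nat ?_
  have hlim := tendsto_integral_avg_avg hf.measurable (fun x => (hf.norm_eq x).le)
    (fun n => div_pos hρ (h.q_pos' n)) (h.tendsto_div_q (1 / 64))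
  have hone : ∫ x, ‖f x‖ ^ 2 = 1 := by simp [hf.norm_eq]
  rw [hone] at hlim
  filter_upwards [hk (1 / 64) hρ, hlim.eventually (lt_mem_nhds (show (3 / 4 : ℝ) < 1 by norm_num))]
    with n ⟨hk1, hk2⟩ hint
  rw [Real.norm_of_nonneg (by positivity)]
  have hq := h.q_pos' n
  have hq1 := h.q_pos' (n + 1)
  have hqq : (q n : ℝ) ≤ q (n + 1) := by exact_mod_cast h.q_le_succ n
  have hD := h.abs_sub_le n
  set D : ℝ := q n * α - p n with hDdef
  have hDq : |D| * q (n + 1) ≤ 1 := by rwa [le_div_iff₀ hq1] at hD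
  have hDq' : |D| * q n ≤ 1 :=
    (mul_le_mul_of_nonneg_left hqq (abs_nonneg _)).trans hDq
  have hq' : (1 : ℝ) ≤ q n := by exact_mod_cast h.q_pos n
  have h1 := hf.sq_norm_phase_le (hγ n) (q := q n) (D := D)
    (by rw [hDdef, ← h.coe_q_zsmul n, natCast_zsmul]) (div_pos hρ hq) (by
      have e1 : (q n : ℝ) * (2 * (2 * (1 / 64 / q n) + |γ n|)) = 1 / 16 + 2 * (|γ n| * q n) := by
        field_simp; ring
      have e2 : |γ n| * q n ≤ 1 / 64 := by rwa [le_div_iff₀ hq] at hk2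
      have e3 : |(k n : ℝ)| * (2 * (2 * (1 / 64 / q n) + |D|)) ≤
          1 / 64 * q n * (2 * (2 * (1 / 64 / q n) + |D|)) := by gcongr
      have e4 : 1 / 64 * q n * (2 * (2 * (1 / 64 / q n) + |D|)) =
          1 / 1024 + 1 / 32 * (|D| * q n) := by
        field_simp; ring
      rw [e1]; linarith) hint.le
  set θ := ‖phase t s (q n) (k n) (γ n) D‖
  set E := difEnergy (1 / 64 / q n) f
  have hE : 0 ≤ E := difEnergy_nonneg _ _
  have ha : (a n * q n : ℝ) ≤ q (n + 1) := by exact_mod_cast h.a_mul_q_le n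
  have h2 : a n * (|D| / (1 / 64 / q n)) ≤ 64 := by
    calc a n * (|D| / (1 / 64 / q n)) = 64 * (|D| * (a n * q n)) := by field_simp
      _ ≤ 64 * (|D| * q (n + 1)) := by gcongr
      _ ≤ 64 := by linarith
  have h3 : (a n * (|D| / (1 / 64 / q n))) ^ 2 ≤ 64 ^ 2 := pow_le_pow_left₀ (by positivity) h2 2
  have h4 : (a n : ℝ) ^ 2 * (8 * θ ^ 2) ≤ a n ^ 2 * ((|D| / (1 / 64 / q n)) ^ 2 * E) := by gcongr
  have h5 : (a n : ℝ) ^ 2 * ((|D| / (1 / 64 / q n)) ^ 2 * E) ≤ 64 ^ 2 * E := by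
    rw [← mul_assoc, ← mul_pow]; gcongr
  rw [mul_pow]; linarith

end Convergents
end IrrationalRotation

/-! ### The digits `b n` and their two series. -/

namespace IrrationalRotation

open Filter Topology

variable {α s : ℝ} {β t : UnitAddCircle} {f : UnitAddCircle → ℂ} {a q : ℕ → ℕ} {p : ℕ → ℤ}

/-- Consecutive `k n` approximate the same `β`, so their difference is small against `q (n + 1)` and
its multiple of `α` is small against `1 / q n`; this forces divisibility by `q n` for large `n`. -/
theorem ConvergentData.exists_dvd_sub (h : ConvergentData α a q p) {k : ℕ → ℤ}
    (hk : ∀ ε > 0, ∀ᶠ n in atTop,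
      |(k n : ℝ)| ≤ ε * q n ∧ ‖k n • (α : UnitAddCircle) - β‖ ≤ ε / q n) :
    ∃ k' : ℕ → ℤ, k' 0 = 0 ∧ (∀ n, (q n : ℤ) ∣ k' (n + 1) - k' n) ∧ k' =ᶠ[atTop] k := by
  have hdvd : ∀ᶠ n in atTop, (q n : ℤ) ∣ k (n + 1) - k n := by
    have h1 := hk (1 / 8) (by norm_num)
    filter_upwards [h1, (tendsto_add_atTop_nat 1).eventually h1] with n ⟨h2, h3⟩ ⟨h4, h5⟩
    have hq := h.q_pos' n
    have hq1 := h.q_pos' (n + 1)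
    have hqq : (q n : ℝ) ≤ q (n + 1) := by exact_mod_cast h.q_le_succ n
    refine h.dvd_of_small_norm n _ ?_
    have e1 : |((k (n + 1) - k n : ℤ) : ℝ)| / q (n + 1) ≤ 1 / 4 := by
      rw [div_le_iff₀ hq1]
      push_cast
      have := abs_sub (k (n + 1) : ℝ) (k n)
      linarith
    have e2 : q n * ‖(k (n + 1) - k n) • (α : UnitAddCircle)‖ ≤ 1 / 4 := by
      have e3 : (k (n + 1) - k n) • (α : UnitAddCircle) =
          k (n + 1) • (α : UnitAddCircle) - β - (k n • ↑α - β) := by rw [sub_smul]; abel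
      rw [e3]
      have e4 := norm_sub_le (k (n + 1) • (α : UnitAddCircle) - β) (k n • ↑α - β)
      have e5 : 1 / 8 / (q (n + 1) : ℝ) ≤ 1 / 8 / q n := by gcongr
      have e6 : ‖k (n + 1) • (α : UnitAddCircle) - β - (k n • ↑α - β)‖ ≤ 1 / 4 / q n := by
        have : 1 / 4 / (q n : ℝ) = 1 / 8 / q n + 1 / 8 / q n := by ring
        linarith
      rw [le_div_iff₀ hq] at e6
      linarith
    linarith
  obtain ⟨N, hN⟩ := eventually_atTop.1 hdvd
  -- Constant values up to `N + 1` make the early differences vanish; the first difference may be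
  -- arbitrary because `q 0 = 1`.
  refine ⟨fun n => if n = 0 then 0 else k (max n (N + 1)), by simp, fun n => ?_, ?_⟩
  · beta_reduce
    rcases Nat.eq_zero_or_pos n with rfl | hn
    · simp [h.q_zero]
    · rw [if_neg (by omega), if_neg (by omega)]
      rcases le_or_gt (N + 1) n with h1 | h1
      · rw [max_eq_left (by omega), max_eq_left h1]; exact hN n (by omega)
      · rw [max_eq_right (by omega), max_eq_right (by omega)]; simp
  · filter_upwards [eventually_ge_atTop (N + 1)] with n hn
    rw [if_neg (by omega), max_eq_left hn]

theorem eq_of_coe_eq {x y : ℝ} (h : (x : UnitAddCircle) = y) (hxy : |x - y| < 1) : x = y := by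
  rw [← sub_eq_zero, ← AddCircle.coe_sub, AddCircle.coe_eq_zero_iff] at h
  obtain ⟨m, hm⟩ := h
  rw [zsmul_eq_mul, mul_one] at hm
  rw [← hm] at hxy
  have : |m| < 1 := by exact_mod_cast hxy
  rw [Int.abs_lt_one_iff] at this
  rw [this] at hm
  push_cast at hm; linarith

/-- Put `x n = γ n + k n * α`; the phase is `q n • t + s * (q n * x n - k n * p n)`. A step adds `b
n * p n` to `x n` and `b n * q n` to `k n`, which leaves `q n * x - p n * k` unchanged. So `θ n` may
be computed with the index `n + 1`, as may `θ (n + 2)` up to `b (n + 1) * s` times a determinant `±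
1`; then the recurrences of `q` and `p` cancel everything else. -/
theorem phase_sub {n : ℕ} (h : ConvergentData α a q p) {k b : ℕ → ℤ} {γ : ℕ → ℝ}
    (hk1 : k (n + 1) = k n + b n * q n) (hk2 : k (n + 2) = k (n + 1) + b (n + 1) * q (n + 1))
    (hγ1 : γ (n + 1) = γ n - b n * (q n * α - p n))
    (hγ2 : γ (n + 2) = γ (n + 1) - b (n + 1) * (q (n + 1) * α - p (n + 1))) :
    let θ := fun n => phase t s (q n) (k n) (γ n) (q n * α - p n)
    θ (n + 2) - a (n + 1) • θ (n + 1) - θ n =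
      ((-(-1) ^ (n + 1) * (b (n + 1) * s) : ℝ) : UnitAddCircle) := by
  intro θ
  have hdet : (p (n + 2) * q (n + 1) - p (n + 1) * q (n + 2) : ℝ) = (-1) ^ (n + 1) := by
    exact_mod_cast h.det (n + 1)
  have hq : (q (n + 2) : ℝ) = a (n + 1) * q (n + 1) + q n := by exact_mod_cast h.q_succ n
  have hp : (p (n + 2) : ℝ) = a (n + 1) * p (n + 1) + p n := by exact_mod_cast h.p_succ n
  have hk1' : (k (n + 1) : ℝ) = k n + b n * q n := by exact_mod_cast hk1
  have hk2' : (k (n + 2) : ℝ) = k (n + 1) + b (n + 1) * q (n + 1) := by exact_mod_cast hk2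
  have ht : q (n + 2) • t - a (n + 1) • q (n + 1) • t - q n • t = 0 := by
    rw [h.q_succ, add_smul, mul_smul]; abel
  simp only [θ, phase, smul_add]
  rw [show ∀ x y z x' y' z' : UnitAddCircle, x + x' - (y + y') - (z + z') =
    (x - y - z) + (x' - y' - z') by intros; abel, ht, zero_add, ← AddCircle.coe_nsmul,
    ← AddCircle.coe_sub, ← AddCircle.coe_sub]
  congr 1
  rw [← hdet, hγ2, hk2', nsmul_eq_mul]
  have hk0 : (k n : ℝ) = k (n + 1) - b n * q n := by linarith
  have hγ0 : γ n = γ (n + 1) + b n * (q n * α - p n) := by linarith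
  rw [hk0, hγ0]
  have hq0 : (q n : ℝ) = q (n + 2) - a (n + 1) * q (n + 1) := by linarith
  have hp0 : (p n : ℝ) = p (n + 2) - a (n + 1) * p (n + 1) := by linarith
  rw [hq0, hp0]
  ring

/-- The necessary condition: existence of the digits. -/
theorem IsTransfer.exists_digits (hf : IsTransfer (α : UnitAddCircle) β t s f)
    (h : ConvergentData α a q p) (hs : ∀ m : ℤ, s ≠ m) :
    ∃ b : ℕ → ℤ, (Summable fun n => |(b n : ℝ)| / a n) ∧
      (Summable fun n => ‖((b n * s : ℝ) : UnitAddCircle)‖ ^ 2) ∧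
      Tendsto (fun N => ∑ n ∈ Finset.range N, (b n * q n : ℤ) • (α : UnitAddCircle)) atTop
        (𝓝 β) := by
  obtain ⟨k₀, hk₀⟩ := hf.exists_approx h hs
  obtain ⟨k, hkz, hdvd, hkk⟩ := h.exists_dvd_sub hk₀
  have hk : ∀ ε > 0, ∀ᶠ n in atTop,
      |(k n : ℝ)| ≤ ε * q n ∧ ‖k n • (α : UnitAddCircle) - β‖ ≤ ε / q n := fun ε hε => by
    filter_upwards [hk₀ ε hε, hkk] with n h1 h2
    rwa [h2]
  choose b hb using hdvd
  have hkb : ∀ n, k (n + 1) = k n + b n * q n := fun n => by linarith [hb n]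
  have hsumk := hf.summable_approx h hs hk
  have hγ : ∀ n, ∃ γ : ℝ, (γ : UnitAddCircle) = β - k n • (α : UnitAddCircle) ∧
      |γ| = ‖β - k n • (α : UnitAddCircle)‖ := fun n => exists_coe_eq_abs_eq_norm _
  choose γ hγ1 hγ2 using hγ
  have hkγ : ∀ ε > 0, ∀ᶠ n in atTop, |(k n : ℝ)| ≤ ε * q n ∧ |γ n| ≤ ε / q n := fun ε hε => by
    filter_upwards [hk ε hε] with n hn
    rwa [hγ2, norm_sub_rev]
  have hbq : ∀ n, |(b n : ℝ)| * q n ≤ |(k (n + 1) : ℝ)| + |(k n : ℝ)| := fun n => by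
    have h1 : (b n : ℝ) * q n = k (n + 1) - k n := by
      have := hkb n
      have : (k (n + 1) : ℝ) = k n + b n * q n := by exact_mod_cast this
      linarith
    have h2 := congrArg abs h1
    rw [abs_mul, abs_of_pos (h.q_pos' n)] at h2
    rw [h2]; exact abs_sub _ _
  refine ⟨b, ?_, ?_, ?_⟩
  · refine Summable.of_nonneg_of_le (fun n => by positivity) (fun n => ?_)
      ((((summable_nat_add_iff 1).2 hsumk).add hsumk).mul_left 2)
    have hq := h.q_pos' n
    have hq1 := h.q_pos' (n + 1)
    have ha : (0 : ℝ) < a n := by exact_mod_cast h.a_pos n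
    have hqq : (q n : ℝ) ≤ q (n + 1) := by exact_mod_cast h.q_le_succ n
    have hqa : (q (n + 1) : ℝ) ≤ 2 * a n * q n := by exact_mod_cast h.q_succ_le n
    calc |(b n : ℝ)| / a n = |(b n : ℝ)| * q n / (a n * q n) := by field_simp
      _ ≤ |(b n : ℝ)| * q n / (q (n + 1) / 2) := by
        gcongr; linarith
      _ = 2 * (|(b n : ℝ)| * q n / q (n + 1)) := by field_simp
      _ ≤ 2 * ((|(k (n + 1) : ℝ)| + |(k n : ℝ)|) / q (n + 1)) := by gcongr; exact hbq n
      _ = 2 * (|(k (n + 1) : ℝ)| / q (n + 1) + |(k n : ℝ)| / q (n + 1)) := by rw [add_div]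
      _ ≤ _ := by gcongr
  · have hph := hf.summable_phase h (k := k) (γ := γ) (fun n => by rw [hγ1]; abel) hkγ
    set θ := fun n => phase t s (q n) (k n) (γ n) (q n * α - p n) with hθ
    -- Both sides agree modulo `1`; being small, they agree as real numbers once `n` is large.
    have hγstep : ∀ᶠ n in atTop, γ (n + 1) = γ n - b n * (q n * α - p n) := by
      have h1 := hkγ (1 / 8) (by norm_num)
      filter_upwards [h1, (tendsto_add_atTop_nat 1).eventually h1] with n ⟨h2, h3⟩ ⟨h4, h5⟩
      have hq := h.q_pos' n
      have hq1 := h.q_pos' (n + 1)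
      have hqn : (1 : ℝ) ≤ q n := by exact_mod_cast h.q_pos n
      have hqn1 : (1 : ℝ) ≤ q (n + 1) := by exact_mod_cast h.q_pos (n + 1)
      have hqq : (q n : ℝ) ≤ q (n + 1) := by exact_mod_cast h.q_le_succ n
      refine eq_of_coe_eq ?_ ?_
      · rw [hγ1, AddCircle.coe_sub, hγ1, hkb, ← zsmul_eq_mul (q n * α - p n : ℝ) (b n),
          AddCircle.coe_zsmul, ← h.coe_q_zsmul, add_smul, mul_smul]
        abel
      · have e1 : |γ (n + 1)| ≤ 1 / 8 := h5.trans (div_le_self (by norm_num) hqn1)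
        have e2 : |γ n| ≤ 1 / 8 := h3.trans (div_le_self (by norm_num) hqn)
        have e3 : |b n * (q n * α - p n : ℝ)| ≤ 1 / 4 := by
          rw [abs_mul]
          calc |(b n : ℝ)| * |q n * α - p n| ≤ |(b n : ℝ)| * (1 / q (n + 1)) := by
                gcongr; exact h.abs_sub_le n
            _ ≤ |(b n : ℝ)| * q n * (1 / q (n + 1)) := by
                gcongr; exact le_mul_of_one_le_right (abs_nonneg _) hqn
            _ ≤ (1 / 8 * q (n + 1) + 1 / 8 * q (n + 1)) * (1 / q (n + 1)) := by
                gcongr; exact (hbq n).trans (by linarith)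
            _ = 1 / 4 := by field_simp; norm_num
        have e4 : γ (n + 1) - (γ n - b n * (q n * α - p n)) =
          γ (n + 1) - γ n + b n * (q n * α - p n) := by ring
        rw [e4]
        have := abs_add_le (γ (n + 1) - γ n) (b n * (q n * α - p n))
        have := abs_sub (γ (n + 1)) (γ n)
        linarith
    rw [← summable_nat_add_iff 1]
    have hθs : Summable fun n => ‖θ n‖ ^ 2 := by
      refine Summable.of_nonneg_of_le (fun n => by positivity) (fun n => ?_) hph
      have : (1 : ℝ) ≤ a n := by exact_mod_cast h.a_pos n
      refine pow_le_pow_left₀ (norm_nonneg _) ?_ 2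
      exact le_mul_of_one_le_left (norm_nonneg _) this
    have hsum := (((summable_nat_add_iff 2).2 hθs).add
      (((summable_nat_add_iff 1).2 hph).add hθs)).mul_left 3
    refine hsum.of_norm_bounded_eventually_nat ?_
    filter_upwards [hγstep, (tendsto_add_atTop_nat 1).eventually hγstep] with n h1 h2
    have h3 := phase_sub (t := t) (s := s) h (hkb n) (hkb (n + 1)) h1 h2
    have h4 : ‖((b (n + 1) * s : ℝ) : UnitAddCircle)‖ =
        ‖((-(-1) ^ (n + 1) * (b (n + 1) * s) : ℝ) : UnitAddCircle)‖ := by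
      rcases neg_one_pow_eq_or ℝ (n + 1) with h5 | h5 <;> rw [h5]
      · rw [neg_mul, one_mul, AddCircle.coe_neg, norm_neg]
      · rw [neg_neg, one_mul]
    rw [Real.norm_of_nonneg (by positivity), h4, ← h3]
    show ‖θ (n + 2) - a (n + 1) • θ (n + 1) - θ n‖ ^ 2 ≤ _
    have h6 : ‖θ (n + 2) - a (n + 1) • θ (n + 1) - θ n‖ ≤
        ‖θ (n + 2)‖ + a (n + 1) * ‖θ (n + 1)‖ + ‖θ n‖ := by
      have e1 := norm_sub_le (θ (n + 2) - a (n + 1) • θ (n + 1)) (θ n)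
      have e2 := norm_sub_le (θ (n + 2)) (a (n + 1) • θ (n + 1))
      have e3 := norm_nsmul_le (n := a (n + 1)) (a := θ (n + 1))
      linarith
    refine (pow_le_pow_left₀ (norm_nonneg _) h6 2).trans ?_
    show _ ≤ 3 * (‖θ (n + 2)‖ ^ 2 + ((a (n + 1) * ‖θ (n + 1)‖) ^ 2 + ‖θ n‖ ^ 2))
    nlinarith [sq_nonneg (‖θ (n + 2)‖ - a (n + 1) * ‖θ (n + 1)‖),
      sq_nonneg (‖θ (n + 2)‖ - ‖θ n‖), sq_nonneg (a (n + 1) * ‖θ (n + 1)‖ - ‖θ n‖)]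
  · have h1 : ∀ N, ∑ n ∈ Finset.range N, (b n * q n : ℤ) • (α : UnitAddCircle) =
        k N • (α : UnitAddCircle) := by
      intro N
      induction N with
      | zero => simp [hkz]
      | succ N ih => rw [Finset.sum_range_succ, ih, hkb, add_smul]
    simp_rw [h1]
    rw [tendsto_iff_norm_sub_tendsto_zero]
    refine squeeze_zero' (Eventually.of_forall fun n => norm_nonneg _)
      ((hk 1 one_pos).mono fun n hn => hn.2) (h.tendsto_div_q 1)

end IrrationalRotation

/-! ### Almost orthogonality of sawtooth sums. -/

namespace IrrationalRotation

open Filter Topology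

/-- The centered sawtooth function, complex valued. -/
noncomputable def saw (x : UnitAddCircle) : ℂ := ((frac x - 1 / 2 : ℝ) : ℂ)

theorem measurable_saw : Measurable saw :=
  Complex.measurable_ofReal.comp (measurable_frac.sub_const _)

theorem norm_saw_le (x : UnitAddCircle) : ‖saw x‖ ≤ 1 / 2 := by
  rw [saw, Complex.norm_real, Real.norm_eq_abs, abs_le]
  have := frac_mem x
  constructor <;> linarith

theorem fourierCoeff_saw (k : ℤ) :
    fourierCoeff saw k = -1 / (2 * Real.pi * Complex.I * k) := by
  have h := fourierCoeff_bernoulli_eq one_ne_zero k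
  rw [Nat.factorial_one, Nat.cast_one, pow_one] at h
  rw [← h]
  congr 1
  ext x
  simp only [saw, Function.comp]
  congr 1
  exact (bernoulliFun_one _).symm

theorem norm_fourierCoeff_saw_mul {q : ℕ} (hq : 0 < q) (k : ℤ) :
    q * ‖fourierCoeff saw (q * k)‖ = ‖fourierCoeff saw k‖ := by
  rw [fourierCoeff_saw, fourierCoeff_saw]
  push_cast
  rw [show (2 * Real.pi * Complex.I * (q * k) : ℂ) = q * (2 * Real.pi * Complex.I * k) by ring,
    norm_div, norm_div, norm_mul, Complex.norm_natCast]
  have : (q : ℝ) ≠ 0 := by exact_mod_cast hq.ne'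
  rw [mul_div_assoc', mul_div_mul_left _ _ this]

theorem sum_Ioc_zero_cast {M : Type*} [AddCommMonoid M] (F : ℤ → M) (q : ℕ) :
    ∑ j ∈ Finset.Ioc (0 : ℤ) q, F j = ∑ i ∈ Finset.range q, F (i + 1) := by
  induction q with
  | zero => simp
  | succ q ih =>
    have h1 : Finset.Ioc (0 : ℤ) ((q + 1 : ℕ) : ℤ) = insert ((q : ℤ) + 1) (Finset.Ioc (0 : ℤ) q) := by
      ext j; simp only [Finset.mem_Ioc, Finset.mem_insert]; push_cast; omega
    rw [h1, Finset.sum_insert (by simp), ih, Finset.sum_range_succ, add_comm]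

/-- The sum of the translates of the sawtooth function by the multiples of `p / q`. -/
noncomputable def sawSum (q : ℕ) (p : ℤ) (x : UnitAddCircle) : ℂ :=
  ∑ j ∈ Finset.Ioc (0 : ℤ) q, saw (x - j • ((p / q : ℝ) : UnitAddCircle))

theorem measurable_sawSum (q : ℕ) (p : ℤ) : Measurable (sawSum q p) :=
  Finset.measurable_fun_sum _ fun _ _ => measurable_saw.comp (measurable_id.sub_const _)

theorem norm_sawSum_le (q : ℕ) (p : ℤ) (x : UnitAddCircle) : ‖sawSum q p x‖ ≤ q / 2 := by
  refine (norm_sum_le _ _).trans ((Finset.sum_le_sum fun j _ => norm_saw_le _).trans (le_of_eq ?_))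
  simp; ring

theorem fourierCoeff_sum_of_bound {ι : Type*} (S : Finset ι) {g : ι → UnitAddCircle → ℂ}
    {C : ι → ℝ} (hg : ∀ i, Measurable (g i)) (hC : ∀ i x, ‖g i x‖ ≤ C i) (k : ℤ) :
    fourierCoeff (fun x => ∑ i ∈ S, g i x) k = ∑ i ∈ S, fourierCoeff (g i) k := by
  have h := fourierCoeff.sum S g (fun i _ => integrable_fourier_mul (hg i) (hC i))
  have h2 := congrFun h k
  rw [Finset.sum_apply] at h2
  rw [← h2]
  congr 1; ext x; simp

theorem fourierCoeff_sawSum (q : ℕ) (p : ℤ) (k : ℤ) :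
    fourierCoeff (sawSum q p) k = (∑ i ∈ Finset.range q,
      e (-(k • ((p / q : ℝ) : UnitAddCircle))) ^ (i + 1)) * fourierCoeff saw k := by
  have h1 := fourierCoeff_sum_of_bound (Finset.Ioc (0 : ℤ) q)
    (g := fun j x => saw (x - j • ((p / q : ℝ) : UnitAddCircle))) (C := fun _ => 1 / 2)
    (fun j => measurable_saw.comp (measurable_id.sub_const _)) (fun j x => norm_saw_le _) k
  have h2 : ∀ j : ℤ, fourierCoeff (fun x => saw (x - j • ((p / q : ℝ) : UnitAddCircle))) k =
      e (-(k • j • ((p / q : ℝ) : UnitAddCircle))) * fourierCoeff saw k := fun j => by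
    simp only [sub_eq_add_neg]
    rw [fourierCoeff_comp_add, fourier_eq_e, smul_neg]
  have h3 : ∀ (x : UnitAddCircle) (n : ℕ), e x ^ n = e (n • x) := fun x n => by
    induction n with
    | zero => simp [e_zero]
    | succ n ih => rw [pow_succ, ih, succ_nsmul, e_add]
  rw [show sawSum q p = fun x => ∑ j ∈ Finset.Ioc (0 : ℤ) q,
    saw (x - j • ((p / q : ℝ) : UnitAddCircle)) from rfl, h1, Finset.sum_mul, sum_Ioc_zero_cast]
  refine Finset.sum_congr rfl fun i _ => ?_
  rw [h2, h3, smul_neg, ← natCast_zsmul, smul_comm k]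
  push_cast; rfl

theorem norm_fourierCoeff_sawSum_le (q : ℕ) (p k : ℤ) :
    ‖fourierCoeff (sawSum q p) k‖ ≤ q * ‖fourierCoeff saw k‖ := by
  rw [fourierCoeff_sawSum, norm_mul]
  gcongr
  refine (norm_sum_le _ _).trans ?_
  simp [norm_e]

theorem e_neg_zsmul_div {q : ℕ} (hq : 0 < q) {p k : ℤ} (h : (q : ℤ) ∣ k) :
    e (-(k • ((p / q : ℝ) : UnitAddCircle))) = 1 := by
  obtain ⟨m, rfl⟩ := h
  have hq' : (q : ℝ) ≠ 0 := by exact_mod_cast hq.ne'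
  have : ((q : ℤ) * m) • ((p / q : ℝ) : UnitAddCircle) = 0 := by
    rw [← AddCircle.coe_zsmul, AddCircle.coe_eq_zero_iff]
    refine ⟨m * p, ?_⟩
    simp only [zsmul_eq_mul]; push_cast; field_simp
  rw [this, neg_zero, e_zero]

theorem norm_fourierCoeff_sawSum_of_dvd {q : ℕ} (hq : 0 < q) {p k : ℤ} (h : (q : ℤ) ∣ k) :
    ‖fourierCoeff (sawSum q p) k‖ = q * ‖fourierCoeff saw k‖ := by
  rw [fourierCoeff_sawSum, e_neg_zsmul_div hq h]
  simp

/-- The coefficient contains a full geometric sum over the powers of a `q`-th root of unity other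
than `1`. -/
theorem fourierCoeff_sawSum_of_not_dvd {q : ℕ} (hq : 0 < q) {p k : ℤ}
    (hpq : IsCoprime (q : ℤ) p) (h : ¬ (q : ℤ) ∣ k) : fourierCoeff (sawSum q p) k = 0 := by
  have hq' : (q : ℝ) ≠ 0 := by exact_mod_cast hq.ne'
  rw [fourierCoeff_sawSum]
  set ζ := e (-(k • ((p / q : ℝ) : UnitAddCircle))) with hζ
  have h1 : ζ ≠ 1 := by
    intro h1
    have h2 := four_mul_norm_le (-(k • ((p / q : ℝ) : UnitAddCircle)))
    rw [← hζ, h1, sub_self, norm_zero, norm_neg, ← AddCircle.coe_zsmul] at h2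
    have h3 : ‖((k • (p / q : ℝ) : ℝ) : UnitAddCircle)‖ = 0 :=
      le_antisymm (by linarith) (norm_nonneg _)
    rw [UnitAddCircle.norm_eq, abs_eq_zero, sub_eq_zero, zsmul_eq_mul] at h3
    set m := round ((k : ℝ) * (p / q))
    have h4 : (k * p : ℝ) = q * m := by rw [← h3]; field_simp
    have h5 : k * p = q * m := by exact_mod_cast h4
    exact h (hpq.dvd_of_dvd_mul_right ⟨m, h5⟩)
  have h2 : ζ ^ q = 1 := by
    have h3 : ∀ (x : UnitAddCircle) (n : ℕ), e x ^ n = e (n • x) := fun x n => by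
      induction n with
      | zero => simp [e_zero]
      | succ n ih => rw [pow_succ, ih, succ_nsmul, e_add]
    rw [hζ, h3, smul_neg, ← natCast_zsmul, ← mul_smul]
    exact e_neg_zsmul_div hq (dvd_mul_right _ _)
  have h3 : (∑ i ∈ Finset.range q, ζ ^ i) = 0 := by
    have := geom_sum_mul ζ q
    rw [h2, sub_self] at this
    exact (mul_eq_zero.1 this).resolve_right (sub_ne_zero.2 h1)
  simp_rw [pow_succ]
  rw [← Finset.sum_mul, h3]; simp

/-- Only frequencies `q * k` survive, with the modulus that `saw` has at `k`, because its
coefficients decay exactly like `1 / k`. So the sum of `q` sawtooths has the `L²` norm of a single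
one. -/
theorem hasSum_sq_norm_fourierCoeff_sawSum {q : ℕ} (hq : 0 < q) {p : ℤ}
    (hpq : IsCoprime (q : ℤ) p) :
    ∃ c ≤ 1 / 4, HasSum (fun k => ‖fourierCoeff (sawSum q p) k‖ ^ 2) c := by
  refine ⟨∫ x, ‖saw x‖ ^ 2, ?_, ?_⟩
  · have : ∫ x, ‖saw x‖ ^ 2 ≤ ∫ x : UnitAddCircle, (1 / 4 : ℝ) :=
      integral_mono (integrable_norm_sq measurable_saw norm_saw_le) (by simp) fun x => by
        have := norm_saw_le x
        have := norm_nonneg (saw x)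
        show ‖saw x‖ ^ 2 ≤ 1 / 4
        nlinarith
    simpa using this
  · have hinj : Function.Injective fun k : ℤ => (q : ℤ) * k :=
      mul_right_injective₀ (by exact_mod_cast hq.ne')
    rw [← hinj.hasSum_iff]
    · refine (hasSum_sq_norm_fourierCoeff measurable_saw norm_saw_le).congr_fun fun k => ?_
      simp only [Function.comp]
      rw [norm_fourierCoeff_sawSum_of_dvd hq (dvd_mul_right _ _), norm_fourierCoeff_saw_mul hq]
    · intro k hk
      rw [fourierCoeff_sawSum_of_not_dvd hq hpq, norm_zero, zero_pow two_ne_zero]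
      rintro ⟨m, rfl⟩
      exact hk ⟨m, rfl⟩

/-- At a multiple of `q'` the coefficient for `q'` is `q'` times that of `saw`, the one for `q` at
most `q` times it; at other frequencies both sides vanish. Using it in both orders gives the factor
`min (q / q') (q' / q)`. -/
theorem norm_mul_norm_fourierCoeff_sawSum_le {q q' : ℕ} (hq' : 0 < q') {p p' : ℤ}
    (hpq : IsCoprime (q' : ℤ) p') (k : ℤ) :
    ‖fourierCoeff (sawSum q p) k‖ * ‖fourierCoeff (sawSum q' p') k‖ ≤
      q / q' * ‖fourierCoeff (sawSum q' p') k‖ ^ 2 := by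
  by_cases h : (q' : ℤ) ∣ k
  · have h1 := norm_fourierCoeff_sawSum_le q p k
    have h2 := norm_fourierCoeff_sawSum_of_dvd hq' (p := p') h
    have hq0 : (0 : ℝ) < q' := by exact_mod_cast hq'
    have h3 : (q : ℝ) * ‖fourierCoeff saw k‖ = q / q' * ‖fourierCoeff (sawSum q' p') k‖ := by
      rw [h2]; field_simp
    rw [sq, ← mul_assoc]
    gcongr
    rwa [← h3]
  · rw [fourierCoeff_sawSum_of_not_dvd hq' hpq h]; simp

section Convergents

variable {α : ℝ} {a q : ℕ → ℕ} {p : ℕ → ℤ}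

/-- The row sums needed for a Schur-type bound, reduced to the telescoping majorant of `sum_div_le`.
-/
theorem ConvergentData.sum_min_div_le (h : ConvergentData α a q p) (n : ℕ) (S : Finset ℕ) :
    ∑ m ∈ S, min ((q n : ℝ) / q m) (q m / q n) ≤ 12 := by
  obtain ⟨N, hN⟩ := S.exists_nat_subset_range
  refine (Finset.sum_le_sum_of_subset_of_nonneg hN fun m _ _ => by positivity).trans ?_
  have h1 : ∀ m ∈ Finset.range N, min ((q n : ℝ) / q m) (q m / q n) ≤
      6 * ((q n : ℝ) / q m / ((1 + (q n : ℝ) / q m) * (2 + (q n : ℝ) / q m))) := by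
    intro m _
    have hn := h.q_pos' n
    have hm := h.q_pos' m
    have h2 : (q m : ℝ) / q n = 1 / ((q n : ℝ) / q m) := by field_simp
    have hr : 0 < (q n : ℝ) / q m := by positivity
    rw [h2]
    set r := (q n : ℝ) / q m
    rcases le_total r 1 with h3 | h3
    · refine (min_le_left _ _).trans ?_
      rw [← mul_div_assoc, le_div_iff₀ (by positivity)]
      nlinarith [mul_nonneg hr.le hr.le, mul_nonneg (mul_nonneg hr.le hr.le) (sub_nonneg.2 h3)]
    · refine (min_le_right _ _).trans ?_
      rw [← mul_div_assoc, div_le_div_iff₀ (by positivity) (by positivity)]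
      nlinarith
  refine (Finset.sum_le_sum h1).trans ?_
  rw [← Finset.mul_sum]
  have := sum_div_le (r := fun m => (q n : ℝ) / q m) (fun m => by positivity) (fun m => by
    have hm := h.q_pos' m
    have h2 : (2 * q m : ℝ) ≤ q (m + 2) := by exact_mod_cast h.two_mul_q_le m
    have hn := h.q_pos' n
    rw [← mul_div_assoc, div_le_div_iff₀ (h.q_pos' _) hm]
    nlinarith) N
  linarith

/-- Almost orthogonality of the functions `sawSum (q n) (p n)`, and of their translates. -/
theorem ConvergentData.integral_sum_sawSum_le (h : ConvergentData α a q p) (c : ℕ → ℝ)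
    (w : ℕ → UnitAddCircle) (S : Finset ℕ) :
    ∫ x, ‖∑ n ∈ S, (c n : ℂ) * sawSum (q n) (p n) (x + w n)‖ ^ 2 ≤ 6 * ∑ n ∈ S, c n ^ 2 := by
  set g : ℕ → UnitAddCircle → ℂ := fun n x => (c n : ℂ) * sawSum (q n) (p n) (x + w n) with hg
  have hgm : ∀ n, Measurable (g n) := fun n =>
    ((measurable_sawSum _ _).comp (measurable_id.add_const _)).const_mul _
  have hgb : ∀ n x, ‖g n x‖ ≤ |c n| * (q n / 2) := fun n x => by
    rw [hg, norm_mul, Complex.norm_real, Real.norm_eq_abs]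
    gcongr
    exact norm_sawSum_le _ _ _
  have hcoef : ∀ n k, ‖fourierCoeff (g n) k‖ = |c n| * ‖fourierCoeff (sawSum (q n) (p n)) k‖ := by
    intro n k
    rw [hg]
    simp only
    rw [fourierCoeff.const_mul (fun x => sawSum (q n) (p n) (x + w n)), fourierCoeff_comp_add,
      norm_mul, norm_mul, fourier_eq_e, norm_e, one_mul, Complex.norm_real, Real.norm_eq_abs]
  choose σ hσ hσs using fun n =>
    hasSum_sq_norm_fourierCoeff_sawSum (h.q_pos n) (h.isCoprime n)
  set μ : ℕ → ℕ → ℝ := fun n m => min ((q n : ℝ) / q m) (q m / q n) with hμ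
  have hμ0 : ∀ n m, 0 ≤ μ n m := fun n m => by positivity
  have hμs : ∀ n m, μ n m = μ m n := fun n m => min_comm _ _
  have hsumm : Measurable fun x => ∑ n ∈ S, g n x := Finset.measurable_fun_sum _ fun n _ => hgm n
  have h1 := hasSum_sq_norm_fourierCoeff (C := ∑ n ∈ S, |c n| * (q n / 2)) hsumm
    (fun x => (norm_sum_le _ _).trans (Finset.sum_le_sum fun n _ => hgb n x))
  have h2 : HasSum (fun k => ∑ n ∈ S, ∑ m ∈ S, |c n| * |c m| * μ n m *
      (‖fourierCoeff (sawSum (q n) (p n)) k‖ ^ 2 + ‖fourierCoeff (sawSum (q m) (p m)) k‖ ^ 2))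
      (∑ n ∈ S, ∑ m ∈ S, |c n| * |c m| * μ n m * (σ n + σ m)) :=
    hasSum_sum fun n _ => hasSum_sum fun m _ => ((hσs n).add (hσs m)).mul_left _
  have h3 : ∫ x, ‖∑ n ∈ S, g n x‖ ^ 2 ≤
      ∑ n ∈ S, ∑ m ∈ S, |c n| * |c m| * μ n m * (σ n + σ m) := by
    refine hasSum_le (fun k => ?_) h1 h2
    rw [fourierCoeff_sum_of_bound S hgm hgb]
    refine (pow_le_pow_left₀ (norm_nonneg _) (norm_sum_le _ _) 2).trans ?_
    rw [sq, Finset.sum_mul_sum]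
    refine Finset.sum_le_sum fun n _ => Finset.sum_le_sum fun m _ => ?_
    rw [hcoef, hcoef]
    have e1 := norm_mul_norm_fourierCoeff_sawSum_le (q := q n) (p := p n) (h.q_pos m)
      (h.isCoprime m) k
    have e2 := norm_mul_norm_fourierCoeff_sawSum_le (q := q m) (p := p m) (h.q_pos n)
      (h.isCoprime n) k
    set x := ‖fourierCoeff (sawSum (q n) (p n)) k‖
    set y := ‖fourierCoeff (sawSum (q m) (p m)) k‖
    have e3 : x * y ≤ μ n m * (x ^ 2 + y ^ 2) := by
      have hx : 0 ≤ (q m / q n : ℝ) * y ^ 2 := by positivity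
      have hy : 0 ≤ (q n / q m : ℝ) * x ^ 2 := by positivity
      rw [hμ]
      simp only
      rw [min_mul_of_nonneg _ _ (by positivity)]
      exact le_min (by linarith) (by linarith)
    calc |c n| * x * (|c m| * y) = |c n| * |c m| * (x * y) := by ring
      _ ≤ |c n| * |c m| * (μ n m * (x ^ 2 + y ^ 2)) := by gcongr
      _ = _ := by ring
  refine h3.trans ?_
  have h4 : ∀ n m, |c n| * |c m| * μ n m * (σ n + σ m) ≤
      (c n ^ 2 * μ n m + c m ^ 2 * μ m n) / 4 := by
    intro n m
    have e1 : |c n| * |c m| ≤ (c n ^ 2 + c m ^ 2) / 2 := by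
      nlinarith [sq_nonneg (|c n| - |c m|), sq_abs (c n), sq_abs (c m)]
    calc |c n| * |c m| * μ n m * (σ n + σ m) ≤ |c n| * |c m| * μ n m * (1 / 2) := by
          have := hμ0 n m
          gcongr; linarith [hσ n, hσ m]
      _ ≤ (c n ^ 2 + c m ^ 2) / 2 * μ n m * (1 / 2) := by
          have := hμ0 n m
          gcongr
      _ = _ := by rw [hμs m n]; ring
  -- Schur's test: the weights `μ n m` are symmetric with row sums at most `12`.
  have h5 : ∑ n ∈ S, ∑ m ∈ S, c n ^ 2 * μ n m ≤ 12 * ∑ n ∈ S, c n ^ 2 := by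
    rw [Finset.mul_sum]
    refine Finset.sum_le_sum fun n _ => ?_
    rw [← Finset.mul_sum, mul_comm]
    exact mul_le_mul_of_nonneg_right (h.sum_min_div_le n S) (sq_nonneg _)
  have h6 : ∑ n ∈ S, ∑ m ∈ S, c m ^ 2 * μ m n = ∑ n ∈ S, ∑ m ∈ S, c n ^ 2 * μ n m :=
    Finset.sum_comm
  calc _ ≤ ∑ n ∈ S, ∑ m ∈ S, (c n ^ 2 * μ n m + c m ^ 2 * μ m n) / 4 :=
        Finset.sum_le_sum fun n _ => Finset.sum_le_sum fun m _ => h4 n m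
    _ = (∑ n ∈ S, ∑ m ∈ S, c n ^ 2 * μ n m) / 2 := by
        simp only [← Finset.sum_div, Finset.sum_add_distrib]
        rw [h6]; ring
    _ ≤ _ := by linarith

end Convergents
end IrrationalRotation

/-! ### Almost everywhere convergence, and `Psi` compared with sawtooth sums. -/

namespace IrrationalRotation

open Filter Topology

theorem norm_toLp_sq {g : UnitAddCircle → ℂ} (hg : MemLp g 2 volume) :
    ‖hg.toLp g‖ ^ 2 = ∫ x, ‖g x‖ ^ 2 := by
  have h0 : 0 ≤ ∫ x, ‖g x‖ ^ 2 := integral_nonneg fun _ => by positivity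
  rw [Lp.norm_toLp, hg.eLpNorm_eq_integral_rpow_norm (by simp) (by simp)]
  simp only [ENNReal.toReal_ofNat, Real.rpow_ofNat]
  rw [ENNReal.toReal_ofReal (by positivity), ← Real.rpow_natCast, ← Real.rpow_mul h0]
  simp

/-- A sequence of bounded functions which is Cauchy in `L²` has a subsequence converging almost
everywhere. -/
theorem exists_seq_ae_tendsto_of_integral_le {F : ℕ → UnitAddCircle → ℂ} {C : ℕ → ℝ}
    (hF : ∀ N, Measurable (F N)) (hC : ∀ N x, ‖F N x‖ ≤ C N) {c : ℕ → ℝ}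
    (hc : Summable c)
    (h : ∀ N M, N ≤ M → ∫ x, ‖F M x - F N x‖ ^ 2 ≤ ∑ n ∈ Finset.Ico N M, c n) :
    ∃ ns : ℕ → ℕ, StrictMono ns ∧ ∀ᵐ x, ∃ l, Tendsto (fun i => F (ns i) x) atTop (𝓝 l) := by
  have hm : ∀ N, MemLp (F N) 2 volume := fun N => memLp_of_bound (hF N) (hC N) 2
  have hcau : CauchySeq fun N => (hm N).toLp := by
    rw [Metric.cauchySeq_iff']
    intro ε hε
    obtain ⟨N, hN⟩ := Metric.cauchySeq_iff'.1 hc.hasSum.tendsto_sum_nat.cauchySeq (ε ^ 2)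
      (by positivity)
    refine ⟨N, fun n hn => ?_⟩
    have h1 := hN n hn
    rw [Real.dist_eq, ← Finset.sum_Ico_eq_sub _ hn] at h1
    have h2 := (h N n hn).trans_lt ((le_abs_self _).trans_lt h1)
    have h3 : ‖(hm n).toLp - (hm N).toLp‖ ^ 2 = ∫ x, ‖F n x - F N x‖ ^ 2 := by
      rw [← MemLp.toLp_sub, norm_toLp_sq]; rfl
    rw [dist_eq_norm]
    exact lt_of_pow_lt_pow_left₀ 2 hε.le (by rw [h3]; exact h2)
  obtain ⟨V, hV⟩ := cauchySeq_tendsto_of_complete hcau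
  obtain ⟨ns, hns, hae⟩ := (tendstoInMeasure_of_tendsto_Lp hV).exists_seq_tendsto_ae
  refine ⟨ns, hns, ?_⟩
  have h1 : ∀ᵐ x, ∀ N, (hm N).toLp (F N) x = F N x := ae_all_iff.2 fun N => (hm N).coeFn_toLp
  filter_upwards [hae, h1] with x hx h1
  exact ⟨V x, by simpa [h1] using hx⟩

variable {α : ℝ} {a q : ℕ → ℕ} {p : ℕ → ℤ}

theorem ConvergentData.exists_seq_ae_tendsto (h : ConvergentData α a q p) {c : ℕ → ℝ}
    (hc : Summable fun n => c n ^ 2) (w : ℕ → UnitAddCircle) :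
    ∃ ns : ℕ → ℕ, StrictMono ns ∧ ∀ᵐ x, ∃ l, Tendsto (fun i =>
      ∑ n ∈ Finset.range (ns i), (c n : ℂ) * sawSum (q n) (p n) (x + w n)) atTop (𝓝 l) := by
  refine exists_seq_ae_tendsto_of_integral_le
    (F := fun N x => ∑ n ∈ Finset.range N, (c n : ℂ) * sawSum (q n) (p n) (x + w n))
    (C := fun N => ∑ n ∈ Finset.range N, |c n| * (q n / 2))
    (fun N => Finset.measurable_fun_sum _ fun n _ =>
      ((measurable_sawSum _ _).comp (measurable_id.add_const _)).const_mul _)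
    (fun N x => (norm_sum_le _ _).trans (Finset.sum_le_sum fun n _ => ?_))
    (c := fun n => 6 * c n ^ 2) (hc.mul_left 6) fun N M hNM => ?_
  · rw [norm_mul, Complex.norm_real, Real.norm_eq_abs]
    gcongr
    exact norm_sawSum_le _ _ _
  · simp_rw [← Finset.sum_Ico_eq_sub _ hNM]
    rw [← Finset.mul_sum]
    exact h.integral_sum_sawSum_le c w _

/-- Away from the discontinuities, the transfer function of order `b' * q n` is `b'` times the
one of order `q n`, up to a constant. -/
theorem Psi_mul {A : UnitAddCircle} {q : ℕ} {D : ℝ} (hD : (q : ℤ) • A = (D : UnitAddCircle))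
    {B : ℕ} {x : UnitAddCircle} (hx : ∀ j ∈ Finset.Ioc (0 : ℤ) q, B * |D| < ‖x - j • A‖)
    (b : ℤ) (hb : |b| ≤ B) :
    Psi A (b * q) x = b * Psi A q x - q * D * (b * (b - 1) / 2) := by
  have key : ∀ l : ℤ, |l| ≤ B → Psi A ((l + 1) * q) x = Psi A (l * q) x + Psi A q x - q * (l * D) := by
    intro l hl
    have h1 : x - (l * q) • A = x + ((-(l * D) : ℝ) : UnitAddCircle) := by
      rw [mul_smul, hD, AddCircle.coe_neg, ← zsmul_eq_mul, AddCircle.coe_zsmul, sub_eq_add_neg]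
    rw [add_mul, one_mul, Psi_add, h1, Psi_add_coe]
    · push_cast; ring
    · intro j hj
      refine lt_of_le_of_lt ?_ (hx j (by simpa using hj))
      rw [abs_neg, abs_mul]
      gcongr
      exact_mod_cast hl
  induction b using Int.induction_on with
  | zero => simp [Psi_zero]
  | succ l ih =>
    have hl : |(l : ℤ)| ≤ B := by
      rw [abs_of_nonneg (by positivity)] at hb ⊢; omega
    rw [key l hl, ih hl]; push_cast; ring
  | pred l ih =>
    have hl : |-(l : ℤ)| ≤ B := by
      rw [abs_of_nonpos (by omega)] at hb ⊢; omega
    have h1 := key (-l - 1) hb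
    rw [sub_add_cancel, ih hl] at h1
    push_cast at h1 ⊢
    linarith

/-- Modulo `1` each sawtooth is a translate of `x`. Hence the character of frequency `l * q` can be
absorbed as `l` times the real sawtooth sum, up to a constant. -/
theorem sawSum_eq (q : ℕ) (p : ℤ) (x : UnitAddCircle) :
    ∃ r : ℝ, sawSum q p x = r ∧
      (r : UnitAddCircle) = q • x - ((∑ j ∈ Finset.Ioc (0 : ℤ) q, (j * (p / q) + 1 / 2) : ℝ) :
        UnitAddCircle) := by
  refine ⟨∑ j ∈ Finset.Ioc (0 : ℤ) q, (frac (x - j • ((p / q : ℝ) : UnitAddCircle)) - 1 / 2),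
    by simp [sawSum, saw], ?_⟩
  have hsum : ∀ (S : Finset ℤ) (F : ℤ → ℝ), ((∑ j ∈ S, F j : ℝ) : UnitAddCircle) =
      ∑ j ∈ S, (F j : UnitAddCircle) := fun S F =>
    map_sum (QuotientAddGroup.mk' (AddSubgroup.zmultiples (1 : ℝ))) F S
  rw [hsum, hsum]
  have h1 : ∀ j ∈ Finset.Ioc (0 : ℤ) q,
      ((frac (x - j • ((p / q : ℝ) : UnitAddCircle)) - 1 / 2 : ℝ) : UnitAddCircle) =
      x - ((j * (p / q) + 1 / 2 : ℝ) : UnitAddCircle) := by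
    intro j _
    rw [AddCircle.coe_sub, coe_frac, AddCircle.coe_add, ← zsmul_eq_mul, AddCircle.coe_zsmul]
    abel
  rw [Finset.sum_congr rfl h1, Finset.sum_sub_distrib]
  simp

/-- Replacing `j • α` by `j • (p n / q n)` moves each jump by at most `|q n * α - p n|`, so off the
excluded neighbourhoods each term changes by a constant. -/
theorem ConvergentData.Psi_q_eq (h : ConvergentData α a q p) (n : ℕ) :
    ∃ c : ℝ, ∀ x : UnitAddCircle,
      (∀ j ∈ Finset.Ioc (0 : ℤ) (q n), |q n * α - p n| < ‖x - j • (α : UnitAddCircle)‖) →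
      (Psi (α : UnitAddCircle) (q n) x : ℂ) = sawSum (q n) (p n) x + c := by
  have hq := h.q_pos' n
  refine ⟨∑ j ∈ Finset.Ioc (0 : ℤ) (q n), (1 / 2 - j * ((q n * α - p n) / q n)), fun x hx => ?_⟩
  have h1 : Finset.Ioc ((q n : ℕ) : ℤ) 0 = ∅ := Finset.Ioc_eq_empty_of_le (by positivity)
  rw [Psi, h1, Finset.sum_empty, sub_zero, sawSum]
  simp only [saw]
  rw [← Complex.ofReal_sum, ← Complex.ofReal_add, ← Finset.sum_add_distrib]
  congr 1
  refine Finset.sum_congr rfl fun j hj => ?_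
  have hj' := Finset.mem_Ioc.1 hj
  have hj0 : (0 : ℝ) < j := by exact_mod_cast hj'.1
  have hj1 : (j : ℝ) ≤ q n := by exact_mod_cast hj'.2
  have h2 : x - j • ((p n / q n : ℝ) : UnitAddCircle) =
      x - j • (α : UnitAddCircle) + ((j * ((q n * α - p n) / q n) : ℝ) : UnitAddCircle) := by
    have h3 : (j * ((q n * α - p n) / q n) : ℝ) = j • α - j • (p n / q n : ℝ) := by
      simp only [zsmul_eq_mul]; field_simp
    rw [h3, AddCircle.coe_sub, AddCircle.coe_zsmul, AddCircle.coe_zsmul]; abel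
  rw [h2, frac_add]
  · ring
  · refine lt_of_le_of_lt ?_ (hx j hj)
    rw [abs_mul, abs_div, abs_of_pos hj0, abs_of_pos hq, mul_div_assoc', div_le_iff₀ hq, mul_comm]
    gcongr

/-- The points where the `n`-th factor of the transfer function is not controlled. -/
def badSet (α : ℝ) (q : ℕ → ℕ) (p : ℕ → ℤ) (b : ℕ → ℤ) (n : ℕ) : Set UnitAddCircle :=
  nearOrbit (α : UnitAddCircle) (Finset.Ioc 0 (q n : ℤ)) (2 * |(b n : ℝ)| * |q n * α - p n|)

theorem ConvergentData.Psi_b_mul_q (h : ConvergentData α a q p) (b : ℕ → ℤ) (n : ℕ) :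
    ∃ c : ℝ, ∀ x ∉ badSet α q p b n,
      (Psi (α : UnitAddCircle) (b n * q n) x : ℂ) = b n * sawSum (q n) (p n) x + c := by
  obtain ⟨c, hc⟩ := h.Psi_q_eq n
  set D : ℝ := q n * α - p n with hD
  refine ⟨b n * c - q n * D * (b n * (b n - 1) / 2), fun x hx => ?_⟩
  -- For `b n = 0` the bad set has radius `0` and gives no control of `Psi`, but then the left side
  -- is zero.
  rcases eq_or_ne (b n) 0 with hb | hb
  · simp [hb, Psi_zero]
  simp only [badSet, nearOrbit, Set.mem_ofPred_eq, not_exists, not_and, not_le] at hx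
  have hb1 : (1 : ℝ) ≤ |(b n : ℝ)| := by exact_mod_cast Int.one_le_abs hb
  have hD0 : 0 ≤ |D| := abs_nonneg D
  have hbn : (((b n).natAbs : ℕ) : ℝ) = |(b n : ℝ)| := by rw [Nat.cast_natAbs]; simp
  rw [Psi_mul (D := D) (h.coe_q_zsmul n) (B := (b n).natAbs) (x := x) (fun j hj => by
    refine lt_of_le_of_lt ?_ (hx j hj)
    rw [hbn]
    exact mul_le_mul_of_nonneg_right (by linarith) hD0) (b n) (by simp)]
  push_cast
  rw [hc x (fun j hj => lt_of_le_of_lt (by nlinarith) (hx j hj))]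
  ring

theorem ConvergentData.volume_badSet_le (h : ConvergentData α a q p) (b : ℕ → ℤ) (n : ℕ) :
    volume (badSet α q p b n) ≤ ENNReal.ofReal (4 * (|(b n : ℝ)| / a n)) := by
  refine (volume_nearOrbit_le _ _ _).trans (ENNReal.ofReal_le_ofReal ?_)
  have hq := h.q_pos' n
  have hq1 := h.q_pos' (n + 1)
  have ha : (0 : ℝ) < a n := by exact_mod_cast h.a_pos n
  have haq : (a n * q n : ℝ) ≤ q (n + 1) := by exact_mod_cast h.a_mul_q_le n
  have hcard : ((Finset.Ioc 0 (q n : ℤ)).card : ℝ) = q n := by simp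
  rw [hcard]
  calc (q n : ℝ) * (2 * (2 * |(b n : ℝ)| * |q n * α - p n|))
      ≤ q n * (2 * (2 * |(b n : ℝ)| * (1 / q (n + 1)))) := by
        gcongr; exact h.abs_sub_le n
    _ ≤ q n * (2 * (2 * |(b n : ℝ)| * (1 / (a n * q n)))) := by gcongr
    _ = _ := by field_simp; ring

end IrrationalRotation

/-! ### Construction of a transfer function from the digits. -/

namespace IrrationalRotation

open Filter Topology

/-- The exponent of the transfer function of `s (frac (x - k A) - frac x)`. -/
noncomputable def transferPhase (A : UnitAddCircle) (s : ℝ) (k m : ℤ) (x : UnitAddCircle) : UnitAddCircle :=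
  ((s * Psi A k x : ℝ) : UnitAddCircle) - m • x

theorem phase_comp_add (A : UnitAddCircle) (s : ℝ) (k m : ℤ) (x : UnitAddCircle) :
    transferPhase A s k m (x + A) = transferPhase A s k m x +
      (-(m • A) - ((s * (frac (x - k • A) - frac x) : ℝ) : UnitAddCircle)) := by
  rw [← Psi_sub_comp_add, mul_sub, AddCircle.coe_sub, transferPhase, transferPhase, smul_add]
  abel

theorem measurable_e_phase (A : UnitAddCircle) (s : ℝ) (k m : ℤ) :
    Measurable fun x => e (transferPhase A s k m x) := by
  have h : (fun x => e (transferPhase A s k m x)) =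
      fun x => e ((s * Psi A k x : ℝ) : UnitAddCircle) * (e (m • x))⁻¹ := by
    funext x; rw [transferPhase, e_sub, div_eq_mul_inv]
  rw [h]
  refine Measurable.mul ?_ (Measurable.inv ?_)
  · exact (continuous_e.comp (AddCircle.continuous_mk' 1)).measurable.comp
      ((measurable_Psi A k).const_mul s)
  · exact (continuous_e.comp (continuous_zsmul m)).measurable

variable {α : ℝ} {a q : ℕ → ℕ} {p : ℕ → ℤ}

/-- Off the bad set, `Psi` grows by `b n` times the sawtooth sum at `x - k • α`, and the character
by `l` times the same sum modulo `1`. What is left is the small coefficient `b n * s - l`. -/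
theorem ConvergentData.phase_step (h : ConvergentData α a q p) (s : ℝ) (b : ℕ → ℤ) (k m l : ℤ)
    (n : ℕ) :
    ∃ κ : UnitAddCircle, ∀ x, x + -(k • (α : UnitAddCircle)) ∉ badSet α q p b n →
      transferPhase (α : UnitAddCircle) s (k + b n * q n) (m + l * q n) x = transferPhase α s k m x + κ +
        (((b n * s - l) * (sawSum (q n) (p n) (x + -(k • (α : UnitAddCircle)))).re : ℝ) :
          UnitAddCircle) := by
  obtain ⟨c, hc⟩ := h.Psi_b_mul_q b n
  set D : UnitAddCircle := ((∑ j ∈ Finset.Ioc (0 : ℤ) (q n), (j * (p n / q n) + 1 / 2 : ℝ) : ℝ) :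
    UnitAddCircle) with hD
  refine ⟨((s * c : ℝ) : UnitAddCircle) - l • D - (l * q n * k) • (α : UnitAddCircle),
    fun x hx => ?_⟩
  obtain ⟨r, hr, hr'⟩ := sawSum_eq (q n) (p n) (x + -(k • (α : UnitAddCircle)))
  have h1 := hc _ hx
  rw [hr] at h1
  have h2 : Psi (α : UnitAddCircle) (b n * q n) (x + -(k • (α : UnitAddCircle))) = b n * r + c := by
    exact_mod_cast h1
  have h3 : (l * q n) • x = l • (r : UnitAddCircle) + l • D + (l * q n * k) • (α : UnitAddCircle) := by
    rw [hr', ← natCast_zsmul, ← hD, smul_sub, smul_add, smul_add, smul_neg, smul_neg]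
    simp only [mul_smul]
    abel
  have h4 : ((l * r : ℝ) : UnitAddCircle) = l • (r : UnitAddCircle) := by
    rw [← zsmul_eq_mul, AddCircle.coe_zsmul]
  rw [transferPhase, transferPhase, Psi_add, sub_eq_add_neg x, h2, add_smul, h3, hr, Complex.ofReal_re,
    sub_mul, AddCircle.coe_sub, h4,
    show s * (Psi (α : UnitAddCircle) k x + (b n * r + c)) =
      s * Psi (α : UnitAddCircle) k x + (b n * s * r + s * c) by ring,
    AddCircle.coe_add, AddCircle.coe_add]
  abel

/-- Borel-Cantelli, using invariance of the measure under the translations `w n`. -/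
theorem ConvergentData.ae_eventually_notMem_badSet (h : ConvergentData α a q p) {b : ℕ → ℤ}
    (hb : Summable fun n => |(b n : ℝ)| / a n) (w : ℕ → UnitAddCircle) :
    ∀ᵐ x, ∀ᶠ n in atTop, x + w n ∉ badSet α q p b n := by
  have h1 : ∑' n, volume ((fun x => x + w n) ⁻¹' badSet α q p b n) ≠ ⊤ := by
    have h2 : ∀ n, volume ((fun x => x + w n) ⁻¹' badSet α q p b n) ≤
        ENNReal.ofReal (4 * (|(b n : ℝ)| / a n)) := fun n => by
      rw [measure_preimage_add_right]
      exact h.volume_badSet_le b n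
    refine ne_top_of_le_ne_top ?_ (ENNReal.tsum_le_tsum h2)
    exact (hb.mul_left 4).tsum_ofReal_ne_top
  exact ae_eventually_notMem h1

theorem ConvergentData.exists_seq_ae_tendsto_e_phase (h : ConvergentData α a q p) {b l : ℕ → ℤ}
    (hb : Summable fun n => |(b n : ℝ)| / a n) {s : ℝ}
    (hl : Summable fun n => (b n * s - l n) ^ 2) :
    ∃ (ns : ℕ → ℕ) (C : ℕ → UnitAddCircle), StrictMono ns ∧ ∀ᵐ x, ∃ y,
      Tendsto (fun i => e (C (ns i) + transferPhase (α : UnitAddCircle) s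
        (∑ n ∈ Finset.range (ns i), b n * q n) (∑ n ∈ Finset.range (ns i), l n * q n) x))
        atTop (𝓝 y) := by
  set k : ℕ → ℤ := fun N => ∑ n ∈ Finset.range N, b n * q n with hk
  set m : ℕ → ℤ := fun N => ∑ n ∈ Finset.range N, l n * q n with hm
  set w : ℕ → UnitAddCircle := fun N => -(k N • (α : UnitAddCircle)) with hw
  choose κ hκ using fun n => h.phase_step s b (k n) (m n) (l n) n
  obtain ⟨ns, hns, hae⟩ := h.exists_seq_ae_tendsto hl w
  refine ⟨ns, fun N => -∑ n ∈ Finset.range N, κ n, hns, ?_⟩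
  filter_upwards [hae, h.ae_eventually_notMem_badSet hb w] with x ⟨S, hS⟩ hx
  obtain ⟨N₀, hN₀⟩ := eventually_atTop.1 hx
  set R : ℕ → ℝ := fun N => ∑ n ∈ Finset.range N,
    (b n * s - l n) * (sawSum (q n) (p n) (x + w n)).re with hR
  set F : ℕ → UnitAddCircle := fun N => -∑ n ∈ Finset.range N, κ n +
    transferPhase (α : UnitAddCircle) s (k N) (m N) x with hF
  -- Once `x` has left all bad sets, the normalised exponent differs from the partial sums of the
  -- sawtooth series by a constant depending on `x` only.
  have hconst : ∀ N ≥ N₀, F N = F N₀ - (R N₀ : UnitAddCircle) + (R N : UnitAddCircle) := by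
    intro N hN
    induction N, hN using Nat.le_induction with
    | base => abel
    | succ N hN ih =>
      have h1 := hκ N x (hN₀ N hN)
      have h2 : F (N + 1) = F N +
          (((b N * s - l N) * (sawSum (q N) (p N) (x + w N)).re : ℝ) : UnitAddCircle) := by
        simp only [hF, hk, hm, Finset.sum_range_succ] at h1 ⊢
        rw [h1]
        abel
      rw [h2, ih]
      simp only [hR, Finset.sum_range_succ, AddCircle.coe_add]
      abel
  have hRS : Tendsto (fun i => R (ns i)) atTop (𝓝 S.re) := by
    have h1 := (Complex.continuous_re.tendsto S).comp hS
    refine h1.congr fun i => ?_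
    simp only [Function.comp, hR, Complex.re_sum]
    refine Finset.sum_congr rfl fun n _ => ?_
    rw [← Complex.re_ofReal_mul]
  refine ⟨e (F N₀ - (R N₀ : UnitAddCircle) + (S.re : UnitAddCircle)), ?_⟩
  have h2 : Tendsto (fun i => e (F N₀ - (R N₀ : UnitAddCircle) + (R (ns i) : UnitAddCircle))) atTop
      (𝓝 (e (F N₀ - (R N₀ : UnitAddCircle) + (S.re : UnitAddCircle)))) :=
    (continuous_e.tendsto _).comp
      (tendsto_const_nhds.add (((AddCircle.continuous_mk' (1 : ℝ)).tendsto _).comp hRS))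
  refine h2.congr' ?_
  filter_upwards [hns.tendsto_atTop.eventually_ge_atTop N₀] with i hi
  rw [← hconst _ hi]

theorem ConvergentData.exists_isTransfer (h : ConvergentData α a q p) {b l : ℕ → ℤ}
    (hb : Summable fun n => |(b n : ℝ)| / a n) {s : ℝ}
    (hl : Summable fun n => (b n * s - l n) ^ 2) {β τ : UnitAddCircle}
    (hβ : Tendsto (fun N => ∑ n ∈ Finset.range N, (b n * q n : ℤ) • (α : UnitAddCircle)) atTop
      (𝓝 β))
    (hτ : Tendsto (fun N => ∑ n ∈ Finset.range N, (l n * q n : ℤ) • (α : UnitAddCircle)) atTop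
      (𝓝 τ)) :
    ∃ f, IsTransfer (α : UnitAddCircle) β (-τ) s f := by
  obtain ⟨ns, C, hns, hae⟩ := h.exists_seq_ae_tendsto_e_phase hb hl
  simp_rw [← Finset.sum_smul] at hβ hτ
  set k : ℕ → ℤ := fun N => ∑ n ∈ Finset.range N, b n * q n with hk
  set m : ℕ → ℤ := fun N => ∑ n ∈ Finset.range N, l n * q n with hm
  set F : ℕ → UnitAddCircle → ℂ := fun i x =>
    e (C (ns i) + transferPhase (α : UnitAddCircle) s (k (ns i)) (m (ns i)) x) with hF
  have hFm : ∀ i, Measurable (F i) := fun i => by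
    simp only [hF, e_add]
    exact (measurable_e_phase _ _ _ _).const_mul _
  obtain ⟨g, hgm, hg⟩ := measurable_limit_of_tendsto_metrizable_ae
    (fun i => (hFm i).aemeasurable) hae
  have hg1 : ∀ᵐ x, ‖g x‖ = 1 := by
    filter_upwards [hg] with x hx
    exact tendsto_nhds_unique hx.norm (by simp [hF, norm_e])
  refine ⟨fun x => if ‖g x‖ = 1 then g x else 1, ?_, ?_, ?_⟩
  · exact Measurable.ite (hgm.norm (measurableSet_singleton 1)) hgm measurable_const
  · intro x
    split_ifs with hx
    · exact hx
    · simp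
  · have hne : ∀ᵐ x : UnitAddCircle, x ≠ β := by
      rw [ae_iff]; simp only [ne_eq, not_not, Set.ofPred_eq_eq_singleton]
      have := AddCircle.volume_closedBall (T := 1) (x := β) 0
      simpa using this
    filter_upwards [hg, hg1, ae_add hg (α : UnitAddCircle), ae_add hg1 (α : UnitAddCircle), hne]
      with x h1 h2 h3 h4 h5
    rw [if_pos h2, if_pos h4]
    refine tendsto_nhds_unique h3 ?_
    have h6 : ∀ i, F i (x + α) = e (-(m (ns i) • (α : UnitAddCircle)) -
        ((s * (frac (x - k (ns i) • (α : UnitAddCircle)) - frac x) : ℝ) : UnitAddCircle)) * F i x := by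
      intro i
      simp only [hF]
      rw [phase_comp_add, ← e_add]
      congr 1; abel
    simp_rw [h6]
    refine Tendsto.mul ((continuous_e.tendsto _).comp ?_) h1
    have h7 : Tendsto (fun i => frac (x - k (ns i) • (α : UnitAddCircle))) atTop
        (𝓝 (frac (x - β))) :=
      (continuousAt_frac (sub_ne_zero.2 h5)).tendsto.comp
        (tendsto_const_nhds.sub (hβ.comp hns.tendsto_atTop))
    exact (hτ.comp hns.tendsto_atTop).neg.sub (((AddCircle.continuous_mk' (1 : ℝ)).tendsto _).comp
      ((h7.sub_const _).const_mul s))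

end IrrationalRotation

/-! ### Uniqueness of `t` modulo multiples of `α`, and the theorem. -/

namespace IrrationalRotation

open Filter Topology

/-- The eigenvalues of a rotation of the circle. -/
theorem exists_eq_zsmul_of_ae_eq_mul {A u : UnitAddCircle} {g : UnitAddCircle → ℂ}
    (hg : Measurable g) (hg1 : ∀ x, ‖g x‖ = 1) (h : ∀ᵐ x, g (x + A) = e u * g x) :
    ∃ k : ℤ, u = k • A := by
  have h1 := hasSum_sq_norm_fourierCoeff hg fun x => (hg1 x).le
  have h2 : ∫ x, ‖g x‖ ^ 2 = 1 := by simp [hg1]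
  rw [h2] at h1
  obtain ⟨k, hk⟩ : ∃ k, fourierCoeff g k ≠ 0 := by
    by_contra! h0
    have h3 : HasSum (fun k : ℤ => ‖fourierCoeff g k‖ ^ 2) 0 := by
      simp only [h0, norm_zero, ne_eq, OfNat.ofNat_ne_zero, not_false_eq_true, zero_pow]
      exact hasSum_zero
    exact one_ne_zero (h1.unique h3)
  refine ⟨k, ?_⟩
  have h3 := fourierCoeff_comp_add g A k
  rw [volume_eq_haarAddCircle] at h
  rw [fourierCoeff_congr_ae h, fourierCoeff.const_mul, fourier_eq_e] at h3
  have h4 : e (u - k • A) = 1 := by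
    rw [e_sub, mul_right_cancel₀ hk h3, div_self (e_ne_zero _)]
  have h5 := four_mul_norm_le (u - k • A)
  rw [h4, sub_self, norm_zero] at h5
  exact sub_eq_zero.1 (norm_le_zero_iff.1 (by linarith))

theorem exp_phi_eq_iff {A β t x : UnitAddCircle} {s : ℝ} {f : UnitAddCircle → ℂ}
    (hf : ∀ x, ‖f x‖ = 1) :
    Complex.exp (2 * Real.pi * Complex.I * s * phi β x) =
        (AddCircle.toCircle t : ℂ) * (f x / f (x + A)) ↔
      f (x + A) = e (t - ((s * (frac (x - β) - frac x) : ℝ) : UnitAddCircle)) * f x := by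
  have h1 : f (x + A) ≠ 0 := fun h => by simpa [h] using hf (x + A)
  have h2 : Complex.exp (2 * Real.pi * Complex.I * s * phi β x) =
      e ((s * (frac (x - β) - frac x) : ℝ) : UnitAddCircle) := by
    rw [e_coe, phi_eq]; push_cast; ring_nf
  have h3 := e_ne_zero ((s * (frac (x - β) - frac x) : ℝ) : UnitAddCircle)
  rw [h2, e_sub, mul_div_assoc', eq_div_iff h1, div_mul_eq_mul_div, eq_div_iff h3, mul_comm]
  rfl

variable {A β t u : UnitAddCircle} {s : ℝ} {f g : UnitAddCircle → ℂ}

/-- The cocycle cancels in `f / g`, leaving an eigenfunction of the rotation with eigenvalue `e (t -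
u)`. -/
theorem IsTransfer.exists_sub_eq_zsmul (hf : IsTransfer A β t s f) (hg : IsTransfer A β u s g) :
    ∃ k : ℤ, t - u = k • A := by
  refine exists_eq_zsmul_of_ae_eq_mul (hf.measurable.div hg.measurable)
    (fun x => by simp [hf.norm_eq, hg.norm_eq]) ?_
  filter_upwards [hf.ae_eq, hg.ae_eq] with x h1 h2
  have h3 := e_ne_zero (u - ((s * (frac (x - β) - frac x) : ℝ) : UnitAddCircle))
  have h4 : g x ≠ 0 := fun h => by simpa [h] using hg.norm_eq x
  rw [Pi.div_apply, Pi.div_apply, h1, h2, ← sub_add_sub_cancel t u, e_add]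
  field_simp

theorem IsTransfer.mul_character (hf : IsTransfer A β t s f) (k : ℤ) :
    IsTransfer A β (k • A + t) s fun x => e (k • x) * f x where
  measurable := (continuous_e.comp (continuous_zsmul k)).measurable.mul hf.measurable
  norm_eq x := by simp [norm_e, hf.norm_eq]
  ae_eq := by
    filter_upwards [hf.ae_eq] with x hx
    rw [hx, smul_add, add_sub_assoc, e_add, e_add]
    ring

variable {α : ℝ} {a q : ℕ → ℕ} {p : ℕ → ℤ}

theorem ConvergentData.summable_zsmul (h : ConvergentData α a q p) {l : ℕ → ℤ}
    (hl : Summable fun n => |(l n : ℝ)| / a n) :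
    Summable fun n => (l n * q n : ℤ) • (α : UnitAddCircle) := by
  refine Summable.of_norm_bounded hl fun n => ?_
  have ha : (0 : ℝ) < a n := by exact_mod_cast h.a_pos n
  have haq : (a n : ℝ) ≤ q (n + 1) := by
    have h1 := h.a_mul_q_le n
    have h2 := h.q_pos n
    exact_mod_cast (Nat.le_mul_of_pos_right _ h2).trans h1
  rw [mul_smul, h.coe_q_zsmul, ← AddCircle.coe_zsmul, zsmul_eq_mul]
  refine (norm_coe_le _).trans ?_
  rw [abs_mul, div_eq_mul_one_div]
  gcongr
  exact (h.abs_sub_le n).trans (by gcongr)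

/-- Since `b` is an integer, the rounding error `1 / 2` is at most `|b| / 2` unless `b = 0`. So
summability passes from the digits to the rounded digits. -/
theorem abs_round_mul_le (b : ℤ) (s : ℝ) : |(round (b * s) : ℝ)| ≤ (|s| + 1 / 2) * |(b : ℝ)| := by
  rcases eq_or_ne b 0 with rfl | hb
  · simp
  have h1 : (1 : ℝ) ≤ |(b : ℝ)| := by exact_mod_cast Int.one_le_abs hb
  have h2 := abs_sub_round (b * s : ℝ)
  have h3 := abs_sub_abs_le_abs_sub (round (b * s) : ℝ) (b * s)
  rw [abs_sub_comm, abs_mul] at h3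
  linarith

end IrrationalRotation

theorem mainTheorem1 (α : ℝ) (hα : Irrational α) (s : ℝ) (hs : ∀ m : ℤ, s ≠ m)
    (β t : UnitAddCircle) :
    (∃ f : UnitAddCircle → ℂ, Measurable f ∧ (∀ x, ‖f x‖ = 1) ∧
      ∀ᵐ x ∂(volume : Measure UnitAddCircle),
        Complex.exp (2 * Real.pi * Complex.I * s * IrrationalRotation.phi β x) =
          (AddCircle.toCircle t : ℂ) * (f x / f (x + (α : UnitAddCircle)))) ↔
    ∃ (b : ℕ → ℤ) (k : ℤ) (τ : UnitAddCircle),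
      HasSum (fun n : ℕ =>
        ((b n * IrrationalRotation.convergentDen α n * α : ℝ) : UnitAddCircle)) β ∧
      HasSum (fun n : ℕ =>
        ((round (b n * s) * IrrationalRotation.convergentDen α n * α : ℝ) : UnitAddCircle)) τ ∧
      t = ((k * α : ℝ) : UnitAddCircle) - τ ∧
      Summable (fun n : ℕ => |(b n : ℝ)| / IrrationalRotation.partialQuotient α (n + 1)) ∧
      Summable (fun n : ℕ => IrrationalRotation.distNearestInt (b n * s) ^ 2) := by
  obtain ⟨a, q, p, h, hq, ha⟩ := IrrationalRotation.exists_convergentData hα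
  have hcoe : ∀ (l : ℤ) (n : ℕ), ((l * q n * α : ℝ) : UnitAddCircle) =
      (l * q n : ℤ) • (α : UnitAddCircle) := fun l n => by
    rw [← AddCircle.coe_zsmul, zsmul_eq_mul]; push_cast; rfl
  have hcoe' : ∀ k : ℤ, ((k * α : ℝ) : UnitAddCircle) = k • (α : UnitAddCircle) := fun k => by
    rw [← AddCircle.coe_zsmul, zsmul_eq_mul]
  simp only [hq, ha, hcoe, hcoe', IrrationalRotation.distNearestInt, sq_abs]
  constructor
  · rintro ⟨f, hfm, hf1, hf⟩
    have hT : IrrationalRotation.IsTransfer (α : UnitAddCircle) β t s f :=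
      ⟨hfm, hf1, hf.mono fun x hx => (IrrationalRotation.exp_phi_eq_iff hf1).1 hx⟩
    obtain ⟨b, hb, hbs, hβ⟩ := hT.exists_digits h hs
    simp only [UnitAddCircle.norm_eq, sq_abs] at hbs
    have hβ' := (h.summable_zsmul hb).hasSum
    rw [tendsto_nhds_unique hβ'.tendsto_sum_nat hβ] at hβ'
    have hl : Summable fun n => |(round (b n * s) : ℝ)| / a n := by
      refine Summable.of_nonneg_of_le (fun n => by positivity) (fun n => ?_)
        (hb.mul_left (|s| + 1 / 2))
      rw [← mul_div_assoc]
      gcongr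
      exact IrrationalRotation.abs_round_mul_le _ _
    have hτ := (h.summable_zsmul hl).hasSum
    -- The sufficiency construction, applied to the digits found for `f`, gives a second solution
    -- with the same `β`; comparing the two identifies `t`.
    obtain ⟨g, hg⟩ := h.exists_isTransfer hb hbs hβ hτ.tendsto_sum_nat
    obtain ⟨k, hk⟩ := hT.exists_sub_eq_zsmul hg
    exact ⟨b, k, _, hβ', hτ, by rw [← hk]; abel, hb, hbs⟩
  · rintro ⟨b, k, τ, hβ, hτ, rfl, hb, hbs⟩
    obtain ⟨g, hg⟩ := h.exists_isTransfer hb hbs hβ.tendsto_sum_nat hτ.tendsto_sum_nat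
    have hT := hg.mul_character k
    rw [← sub_eq_add_neg] at hT
    exact ⟨_, hT.measurable, hT.norm_eq,
      hT.ae_eq.mono fun x hx => (IrrationalRotation.exp_phi_eq_iff hT.norm_eq).2 hx⟩
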